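/- Let $I\subset\mathbb R$ be open, $p:I\to\mathbb R$ of class $C^2$, $\kappa>0$, and consider the Korteweg model $$v_t-u_x=0,\qquad u_t+p(v)_x=-\kappa v_{xxx}.$$ Let $\bar U(x-\bar st)$, $\bar U=(\bar v,\bar u)$, be a homoclinic solitary wave: $\bar v$ is $C^3$ with values in $I$, $\bar u$ is $C^1$, $-\bar s\bar v'-\bar u'=0$ and $-\bar s\bar u'+p(\bar v)'=-\kappa\bar v'''$, $\bar U(x)\to U_\infty=(v_\infty,u_\infty)$ as $x\to\pm\infty$, $v_\infty\in I$, and $\bar v\not\equiv v_\infty$. Assume that the endstate is a saddle, $\bar s^2+p'(v_\infty)<0$. *Moment of instability.* A wave family through $\bar U$ is a family $U^s=(v^s,u^s)$, $s$ near $\bar s$, of homoclinic solitary waves of speed $s$ with the same endstate $U_\infty$, of class $C^1$ jointly in $(s,x)$, with $U^{\bar s}=\bar U$. Put $m(s)=(\mathcal H+s\mathcal Q)(U^s)$, where $$\mathcal H(v,u)=\int_{\mathbb R}\Big(\tfrac12(u-u_\infty)^2-\int_{v_\infty}^{v}(p(z)-p(v_\infty))\,dz+\tfrac12\kappa v_x^2\Big)dx,\qquad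 \mathcal Q(v,u)=\int_{\mathbb R}(u-u_\infty)(v-v_\infty)\,dx .$$ *Evans function.* Put $\alpha(x)=p'(\bar v(x))$. The linearized operator is $L=\mathcal J\mathcal L$, with $\mathcal J=\partial_x\begin{pmatrix}0&1\\1&0\end{pmatrix}$ and $\mathcal L(v,u)=(\delta^2\mathcal H+\bar s\,\delta^2\mathcal Q)(v,u)=(-\alpha v-\kappa v''+\bar su,\;u+\bar sv)$. Write the eigenvalue equation $(L-\lambda)(v,u)=0$ as a first-order system $W'=A(x,\lambda)W$ for $W=(u,v,v',v'')^{\rm tr}$. Let $c_\infty=\sqrt{-p'(v_\infty)}$ and let $a,b$ be nonzero real numbers (normalization factors). A normalized Evans basis on an open set $\Omega\subset\mathbb C$ containing $0$ (for example $\Omega=\{\mathrm{Re}\,\lambda>0\}\cup B(0,r)$) consists of solutions $W_1^+,W_2^+,W_3^-,W_4^-$ of this system, depending holomorphically on $\lambda\in\Omega$, such that for $\lambda\in\Omega$ with $\mathrm{Re}\,\lambda>0$ the pair $W_1^+,W_2^+$ (respectively $W_3^-,W_4^-$) is a basis of the space of solutions tending to $0$ at $+\infty$ (respectively $-\infty$),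 and such that at $\lambda=0$ $$W_1^+=W_4^-=\partial_x(\bar u,\bar v,\bar v',\bar v'')^{\rm tr},\qquad \lim_{x\to+\infty}W_2^+=a\,(c_\infty,-1,0,0)^{\rm tr},\qquad \lim_{x\to-\infty}W_3^-=b\,(c_\infty,1,0,0)^{\rm tr}.$$ Its Evans function is $D(\lambda)=\det(W_1^+,W_2^+,W_3^-,W_4^-)|_{x=0}$. **Theorem 1.1.** Wave families through $\bar U$ exist, and a normalized Evans basis exists on some disk $B(0,r)$, $r>0$. For every wave family through $\bar U$, the integrals defining $m(s)$ converge absolutely for $s$ near $\bar s$, $m$ is differentiable near $\bar s$ and twice differentiable at $\bar s$. For every normalized Evans basis on an open set $\Omega\ni0$, $D$ is holomorphic on $\Omega$ and $$D''(0)=c\,\frac{d^2m}{ds^2}(\bar s),\qquad c=-ab\,\frac{2C}{\kappa^2},\qquad C=2\sqrt{-p'(v_\infty)}\,\big(p'(v_\infty)+\bar s^2\big)<0 .$$ The constant $c$ is nonzero, and it is positive if $ab>0$. -/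

import Mathlib

open Filter Topology MeasureTheory

namespace Korteweg

noncomputable section

/-- `(v, u)` is the profile of a homoclinic traveling wave `(v, u)(x - s t)`, with endstate
`(vinf, uinf)`, of the system `v_t - u_x = 0`, `u_t + p(v)_x = -κ v_xxx`, the pressure law `p`
being considered on the set `I` of admissible specific volumes. -/
structure IsSolitaryWave (p : ℝ → ℝ) (I : Set ℝ) (κ s vinf uinf : ℝ) (v u : ℝ → ℝ) : Prop where
  contDiff_v : ContDiff ℝ 3 v
  contDiff_u : ContDiff ℝ 1 u
  mem : ∀ x, v x ∈ I
  eq_mass : ∀ x, -s * deriv v x - deriv u x = 0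
  eq_momentum : ∀ x,
    -s * deriv u x + deriv (fun y => p (v y)) x = -κ * iteratedDeriv 3 v x
  v_atTop : Tendsto v atTop (𝓝 vinf)
  v_atBot : Tendsto v atBot (𝓝 vinf)
  u_atTop : Tendsto u atTop (𝓝 uinf)
  u_atBot : Tendsto u atBot (𝓝 uinf)
  nontrivial : ∃ x, v x ≠ vinf

/-- `s ↦ (V s, U s)` is, for speeds `s` near `sbar`, a `C¹` one-parameter family of solitary waves
of speed `s` and with the fixed endstate `(vinf, uinf)`, passing through `(v, u)` at `sbar`. -/
structure IsWaveFamily (p : ℝ → ℝ) (I : Set ℝ) (κ sbar vinf uinf : ℝ) (v u : ℝ → ℝ)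
    (V U : ℝ → ℝ → ℝ) : Prop where
  v_eq : V sbar = v
  u_eq : U sbar = u
  exists_interval : ∃ δ > 0,
    (∀ s ∈ Set.Ioo (sbar - δ) (sbar + δ), IsSolitaryWave p I κ s vinf uinf (V s) (U s)) ∧
    ContDiffOn ℝ 1 (fun q : ℝ × ℝ => V q.1 q.2)
      (Set.Ioo (sbar - δ) (sbar + δ) ×ˢ Set.univ) ∧
    ContDiffOn ℝ 1 (fun q : ℝ × ℝ => U q.1 q.2)
      (Set.Ioo (sbar - δ) (sbar + δ) ×ˢ Set.univ)

/-- The density `H` of the relative total energy. -/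
def energyDensity (p : ℝ → ℝ) (κ vinf uinf : ℝ) (v u : ℝ → ℝ) (x : ℝ) : ℝ :=
  (1 / 2) * (u x - uinf) ^ 2 - (∫ z in vinf..(v x), (p z - p vinf)) + (1 / 2) * κ * deriv v x ^ 2

/-- The density of the relative generalized momentum. -/
def momentumDensity (vinf uinf : ℝ) (v u : ℝ → ℝ) (x : ℝ) : ℝ :=
  (u x - uinf) * (v x - vinf)

/-- The Hamiltonian `𝓗`. -/
def hamiltonian (p : ℝ → ℝ) (κ vinf uinf : ℝ) (v u : ℝ → ℝ) : ℝ :=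
  ∫ x, energyDensity p κ vinf uinf v u x

/-- The generalized momentum `𝓠`. -/
def momentum (vinf uinf : ℝ) (v u : ℝ → ℝ) : ℝ :=
  ∫ x, momentumDensity vinf uinf v u x

/-- The moment of instability `m(s) = (𝓗 + s 𝓠)(V s, U s)` of a family of waves. -/
def momentOfInstability (p : ℝ → ℝ) (κ vinf uinf : ℝ) (V U : ℝ → ℝ → ℝ) (s : ℝ) : ℝ :=
  hamiltonian p κ vinf uinf (V s) (U s) + s * momentum vinf uinf (V s) (U s)

/-- The constrained Hessian `𝓛 = δ²𝓗 + s δ²𝓠` at a wave with `α = p'(vbar)`,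
applied to a perturbation `(v, u)`. -/
def hessian (α : ℝ → ℝ) (κ s : ℝ) (U : (ℝ → ℂ) × (ℝ → ℂ)) : (ℝ → ℂ) × (ℝ → ℂ) :=
  (fun x => -(α x : ℂ) * U.1 x - κ * iteratedDeriv 2 U.1 x + s * U.2 x,
   fun x => U.2 x + s * U.1 x)

/-- The linearized operator `L = 𝒥𝓛`, where `𝒥 = ∂ₓ J` and `J` exchanges the two components. -/
def linearizedOp (α : ℝ → ℝ) (κ s : ℝ) (U : (ℝ → ℂ) × (ℝ → ℂ)) : (ℝ → ℂ) × (ℝ → ℂ) :=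
  (deriv (hessian α κ s U).2, deriv (hessian α κ s U).1)

/-- The coefficient matrix of the eigenvalue equation `(L - λ)(v, u) = 0`, written as a first order
system in the phase variables `W = (u, v, v', v'')`; see `eigen_iff_firstOrder`. -/
def evansMatrix (α : ℝ → ℝ) (κ s : ℝ) (lam : ℂ) (x : ℝ) : Matrix (Fin 4) (Fin 4) ℂ :=
  !![0, lam, -s, 0;
     0, 0, 1, 0;
     0, 0, 0, 1;
     -lam / κ, (s * lam - (deriv α x : ℝ)) / κ, -((α x : ℂ) + s ^ 2) / κ, 0]

/-- The eigenvalue equation of `L` is the first order system with matrix `evansMatrix`. -/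
theorem eigen_iff_firstOrder (α : ℝ → ℝ) (hα : Differentiable ℝ α) (κ s : ℝ) (hκ : 0 < κ)
    (lam : ℂ) (v u : ℝ → ℂ) (hv : ContDiff ℝ 3 v) (hu : ContDiff ℝ 1 u) :
    linearizedOp α κ s (v, u) = (fun x => lam * v x, fun x => lam * u x) ↔
      ∀ x, HasDerivAt (fun y => ![u y, v y, deriv v y, iteratedDeriv 2 v y])
        ((evansMatrix α κ s lam x).mulVec ![u x, v x, deriv v x, iteratedDeriv 2 v x]) x := by
  have hκ' : (κ : ℂ) ≠ 0 := by exact_mod_cast hκ.ne'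
  have d0 : ∀ x, HasDerivAt v (deriv v x) x := fun x =>
    (hv.differentiable (by norm_num) x).hasDerivAt
  have d1 : ∀ x, HasDerivAt (deriv v) (iteratedDeriv 2 v x) x := fun x => by
    have h := (hv.differentiable_iteratedDeriv 1 (by norm_num) x).hasDerivAt
    rwa [← iteratedDeriv_succ, iteratedDeriv_one] at h
  have d2 : ∀ x, HasDerivAt (iteratedDeriv 2 v) (iteratedDeriv 3 v x) x := fun x => by
    have h := (hv.differentiable_iteratedDeriv 2 (by norm_num) x).hasDerivAt
    rwa [← iteratedDeriv_succ] at h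
  have du : ∀ x, HasDerivAt u (deriv u x) x := fun x =>
    (hu.differentiable (by norm_num) x).hasDerivAt
  have dα : ∀ x, HasDerivAt (fun y => (α y : ℂ)) ((deriv α x : ℝ) : ℂ) x := fun x =>
    (hα x).hasDerivAt.ofReal_comp
  have e2 : ∀ x, deriv (hessian α κ s (v, u)).2 x = deriv u x + s * deriv v x := fun x =>
    ((du x).add ((d0 x).const_mul (s : ℂ))).deriv
  have e1 : ∀ x, deriv (hessian α κ s (v, u)).1 x =
      (-((deriv α x : ℝ) : ℂ) * v x + -(α x : ℂ) * deriv v x) - κ * iteratedDeriv 3 v x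
        + s * deriv u x := fun x =>
    ((((dα x).neg.mul (d0 x)).sub ((d2 x).const_mul (κ : ℂ))).add
      ((du x).const_mul (s : ℂ))).deriv
  have hW : ∀ x, HasDerivAt (fun y => ![u y, v y, deriv v y, iteratedDeriv 2 v y])
      ![deriv u x, deriv v x, iteratedDeriv 2 v x, iteratedDeriv 3 v x] x := fun x => by
    rw [hasDerivAt_pi]
    intro i
    fin_cases i
    · exact du x
    · exact d0 x
    · exact d1 x
    · exact d2 x
  have key : (∀ x, deriv (hessian α κ s (v, u)).2 x = lam * v x ∧
      deriv (hessian α κ s (v, u)).1 x = lam * u x) ↔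
      ∀ x, ![deriv u x, deriv v x, iteratedDeriv 2 v x, iteratedDeriv 3 v x] =
        (evansMatrix α κ s lam x).mulVec ![u x, v x, deriv v x, iteratedDeriv 2 v x] := by
    refine forall_congr' fun x => ?_
    rw [e1, e2]
    constructor
    · rintro ⟨h1, h2⟩
      ext i
      fin_cases i
      · simp [evansMatrix, Matrix.mulVec, dotProduct, Fin.sum_univ_four]
        linear_combination h1
      · simp [evansMatrix, Matrix.mulVec, dotProduct, Fin.sum_univ_four]
      · simp [evansMatrix, Matrix.mulVec, dotProduct, Fin.sum_univ_four]
      · simp [evansMatrix, Matrix.mulVec, dotProduct, Fin.sum_univ_four]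
        field_simp
        linear_combination s * h1 - h2
    · intro h
      have h0 := congrFun h 0
      have h3 := congrFun h 3
      simp [evansMatrix, Matrix.mulVec, dotProduct, Fin.sum_univ_four] at h0 h3
      field_simp at h3
      constructor
      · linear_combination h0
      · linear_combination s * h0 - h3
  constructor
  · intro h x
    have := key.1 (fun y => ⟨congrFun (congrArg Prod.fst h) y, congrFun (congrArg Prod.snd h) y⟩) x
    rw [← this]
    exact hW x
  · intro h
    have := key.2 fun x => (hW x).unique (h x)
    exact Prod.ext (funext fun x => (this x).1) (funext fun x => (this x).2)

/-- The space of solutions on `ℝ` of `W' = A(x) W` that tend to `0` along the filter `l`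
(`atTop` or `atBot`). -/
def decayingSolutions (A : ℝ → Matrix (Fin 4) (Fin 4) ℂ) (l : Filter ℝ) :
    Submodule ℂ (ℝ → Fin 4 → ℂ) where
  carrier := {W | (∀ x, HasDerivAt W ((A x).mulVec (W x)) x) ∧ Tendsto W l (𝓝 0)}
  zero_mem' := by
    refine ⟨fun x => ?_, tendsto_const_nhds⟩
    rw [Pi.zero_apply, Matrix.mulVec_zero]
    exact hasDerivAt_const x (0 : Fin 4 → ℂ)
  add_mem' := by
    rintro W W' ⟨h1, h2⟩ ⟨h3, h4⟩
    refine ⟨fun x => ?_, by simpa [Pi.add_def] using h2.add h4⟩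
    simpa [Matrix.mulVec_add] using (h1 x).add (h3 x)
  smul_mem' := by
    rintro c W ⟨h1, h2⟩
    refine ⟨fun x => ?_, by simpa [Pi.smul_def] using h2.const_smul c⟩
    simpa [Matrix.mulVec_smul] using (h1 x).const_smul c

/-- Normalized analytic Evans bases on an open set `Ω ∋ 0` of spectral parameters for the linearized
operator about the wave `(vbar, ubar)`: `W₁, W₂` (`W₃, W₄`) are solutions of the eigenvalue equation
that depend analytically on `λ ∈ Ω` and that, for `λ ∈ Ω` with `Re λ > 0`, form a basis of the space
of solutions that decay at `+∞` (at `-∞`). At `λ = 0`, the solutions `W₁` and `W₄` are the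
derivative of the wave, while `W₂` and `W₃` have limits that are multiples, by `a` and `b`, of
`(c, -1, 0, 0)` and `(c, 1, 0, 0)`, with `c = √(-p'(vinf))`. -/
structure EvansBasis (p : ℝ → ℝ) (κ s vinf : ℝ) (vbar ubar : ℝ → ℝ) (a b : ℝ) (Ω : Set ℂ) where
  W₁ : ℂ → ℝ → Fin 4 → ℂ
  W₂ : ℂ → ℝ → Fin 4 → ℂ
  W₃ : ℂ → ℝ → Fin 4 → ℂ
  W₄ : ℂ → ℝ → Fin 4 → ℂ
  solution : ∀ W ∈ ({W₁, W₂, W₃, W₄} : Set (ℂ → ℝ → Fin 4 → ℂ)), ∀ lam ∈ Ω, ∀ x,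
    HasDerivAt (W lam)
      ((evansMatrix (fun y => deriv p (vbar y)) κ s lam x).mulVec (W lam x)) x
  analytic : ∀ W ∈ ({W₁, W₂, W₃, W₄} : Set (ℂ → ℝ → Fin 4 → ℂ)), ∀ x,
    DifferentiableOn ℂ (fun lam => W lam x) Ω
  indep_plus : ∀ lam ∈ Ω, 0 < lam.re → LinearIndependent ℂ ![W₁ lam, W₂ lam]
  span_plus : ∀ lam ∈ Ω, 0 < lam.re → Submodule.span ℂ {W₁ lam, W₂ lam} =
    decayingSolutions (evansMatrix (fun y => deriv p (vbar y)) κ s lam) atTop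
  indep_minus : ∀ lam ∈ Ω, 0 < lam.re → LinearIndependent ℂ ![W₃ lam, W₄ lam]
  span_minus : ∀ lam ∈ Ω, 0 < lam.re → Submodule.span ℂ {W₃ lam, W₄ lam} =
    decayingSolutions (evansMatrix (fun y => deriv p (vbar y)) κ s lam) atBot
  W₁_zero : ∀ x, W₁ 0 x = ![((deriv ubar x : ℝ) : ℂ), ((deriv vbar x : ℝ) : ℂ),
    ((iteratedDeriv 2 vbar x : ℝ) : ℂ), ((iteratedDeriv 3 vbar x : ℝ) : ℂ)]
  W₄_zero : W₄ 0 = W₁ 0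
  W₂_zero : Tendsto (W₂ 0) atTop
    (𝓝 ((a : ℂ) • ![((√(-deriv p vinf) : ℝ) : ℂ), -1, 0, 0]))
  W₃_zero : Tendsto (W₃ 0) atBot
    (𝓝 ((b : ℂ) • ![((√(-deriv p vinf) : ℝ) : ℂ), 1, 0, 0]))

/-- The Evans function: the Wronskian of the four solutions at `x = 0`. -/
def EvansBasis.evans {p : ℝ → ℝ} {κ s vinf : ℝ} {vbar ubar : ℝ → ℝ} {a b : ℝ} {Ω : Set ℂ}
    (E : EvansBasis p κ s vinf vbar ubar a b Ω) (lam : ℂ) : ℂ :=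
  Matrix.det (Matrix.of ![E.W₁ lam 0, E.W₂ lam 0, E.W₃ lam 0, E.W₄ lam 0]).transpose

end

end Korteweg

namespace Korteweg
noncomputable section

section LinearODE

variable {F : Type*} [NormedAddCommGroup F] [NormedSpace ℝ F]

/-- Solutions of a linear equation on an interval are determined by one value. -/
theorem linear_ode_unique {A : ℝ → F →L[ℝ] F} {M : ℝ} (hM : ∀ x, ‖A x‖ ≤ M) {s t x₀ : ℝ}
    {f g : ℝ → F} (hx₀ : x₀ ∈ Set.Ioo s t) (hf : ∀ x ∈ Set.Ioo s t, HasDerivAt f (A x (f x)) x)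
    (hg : ∀ x ∈ Set.Ioo s t, HasDerivAt g (A x (g x)) x) (h : f x₀ = g x₀) :
    Set.EqOn f g (Set.Ioo s t) := by
  refine ODE_solution_unique_of_mem_Ioo (v := fun x w => A x w) (s := fun _ => Set.univ)
    (K := M.toNNReal) (fun x _ => ?_) hx₀ (fun x hx => ⟨hf x hx, trivial⟩)
    (fun x hx => ⟨hg x hx, trivial⟩) h
  refine (LipschitzWith.weaken (A x).lipschitz ?_).lipschitzOnWith
  rw [← NNReal.coe_le_coe, coe_nnnorm]
  exact (hM x).trans (Real.le_coe_toNNReal M)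

theorem linear_ode_unique_univ {A : ℝ → F →L[ℝ] F} {M : ℝ} (hM : ∀ x, ‖A x‖ ≤ M) {x₀ : ℝ}
    {f g : ℝ → F} (hf : ∀ x, HasDerivAt f (A x (f x)) x)
    (hg : ∀ x, HasDerivAt g (A x (g x)) x) (h : f x₀ = g x₀) : f = g := by
  ext x
  refine linear_ode_unique hM (s := min x x₀ - 1) (t := max x x₀ + 1) (x₀ := x₀) ?_
    (fun x _ => hf x) (fun x _ => hg x) h ?_ <;>
  constructor <;> grind

theorem abs_integral_exp_mul_abs {K : ℝ} (hK : 0 < K) (x : ℝ) :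
    |∫ y in (0 : ℝ)..x, Real.exp (K * |y|)| ≤ Real.exp (K * |x|) / K := by
  have key : ∀ z : ℝ, 0 ≤ z → ∫ y in (0 : ℝ)..z, Real.exp (K * |y|) = (Real.exp (K * z) - 1) / K := by
    intro z hz
    have h1 : ∫ y in (0 : ℝ)..z, Real.exp (K * |y|) = ∫ y in (0 : ℝ)..z, Real.exp (K * y) := by
      refine intervalIntegral.integral_congr fun y hy => ?_
      rw [Set.uIcc_of_le hz] at hy
      simp only [abs_of_nonneg hy.1]
    rw [h1, intervalIntegral.integral_comp_mul_left (fun y => Real.exp y) hK.ne']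
    simp [integral_exp, div_eq_inv_mul]
  have pos : ∀ z : ℝ, 0 ≤ z → |∫ y in (0 : ℝ)..z, Real.exp (K * |y|)| ≤ Real.exp (K * z) / K := by
    intro z hz
    rw [key z hz, abs_of_nonneg]
    · gcongr; linarith
    · have : 1 ≤ Real.exp (K * z) := Real.one_le_exp (by positivity)
      apply div_nonneg <;> linarith
  rcases le_total 0 x with hx | hx
  · rw [abs_of_nonneg hx]; exact pos x hx
  · have h2 : ∫ y in (0 : ℝ)..x, Real.exp (K * |y|) = - ∫ y in (0 : ℝ)..(-x), Real.exp (K * |y|) := by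
      have := intervalIntegral.integral_comp_neg (a := 0) (b := -x) (fun y => Real.exp (K * |y|))
      simp only [abs_neg, neg_neg, neg_zero] at this
      rw [this, intervalIntegral.integral_symm]
    rw [h2, abs_neg, abs_of_nonpos hx]
    exact pos (-x) (by linarith)

variable [CompleteSpace F]

theorem exists_linear_ode_zero {A : ℝ → F →L[ℝ] F} (hA : Continuous A) {M : ℝ}
    (hM : ∀ x, ‖A x‖ ≤ M) (w₀ : F) :
    ∃ W : ℝ → F, W 0 = w₀ ∧ ∀ x, HasDerivAt W (A x (W x)) x := by
  have hM0 : 0 ≤ M := (norm_nonneg _).trans (hM 0)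
  set K : ℝ := M + 1 with hKdef
  have hK : 0 < K := by positivity
  have hwt : Continuous fun y : ℝ => Real.exp (K * |y|) := by fun_prop
  have hcont : ∀ Z : BoundedContinuousFunction ℝ F,
      Continuous fun y => A y (Real.exp (K * |y|) • Z y) := fun Z =>
    hA.clm_apply (hwt.smul Z.continuous)
  have hbd : ∀ (Z : BoundedContinuousFunction ℝ F) (x : ℝ),
      ‖∫ y in (0 : ℝ)..x, A y (Real.exp (K * |y|) • Z y)‖ ≤ M / K * ‖Z‖ * Real.exp (K * |x|) := by
    intro Z x
    have h1 : ‖∫ y in (0 : ℝ)..x, A y (Real.exp (K * |y|) • Z y)‖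
        ≤ |∫ y in (0 : ℝ)..x, M * ‖Z‖ * Real.exp (K * |y|)| := by
      refine intervalIntegral.norm_integral_le_abs_of_norm_le ?_ ?_
      · refine Eventually.of_forall fun y => ?_
        calc ‖A y (Real.exp (K * |y|) • Z y)‖ ≤ M * (Real.exp (K * |y|) * ‖Z‖) := by
              refine (A y).le_of_opNorm_le_of_le (hM y) ?_
              rw [norm_smul, Real.norm_eq_abs, Real.abs_exp]
              gcongr
              exact Z.norm_coe_le_norm y
          _ = _ := by ring
      · exact (Continuous.intervalIntegrable (by fun_prop) _ _)
    refine h1.trans ?_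
    rw [intervalIntegral.integral_const_mul, abs_mul, abs_of_nonneg (by positivity)]
    calc M * ‖Z‖ * _ ≤ M * ‖Z‖ * (Real.exp (K * |x|) / K) := by
          gcongr; exact abs_integral_exp_mul_abs hK x
      _ = _ := by ring
  have hprim : ∀ Z : BoundedContinuousFunction ℝ F,
      Continuous fun x => ∫ y in (0 : ℝ)..x, A y (Real.exp (K * |y|) • Z y) := fun Z =>
    intervalIntegral.continuous_primitive (fun a b => (hcont Z).intervalIntegrable a b) 0
  have hcan : ∀ x : ℝ, Real.exp (-(K * |x|)) * Real.exp (K * |x|) = 1 := fun x => by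
    rw [← Real.exp_add]; simp
  let T : BoundedContinuousFunction ℝ F → BoundedContinuousFunction ℝ F := fun Z =>
    BoundedContinuousFunction.ofNormedAddCommGroup
      (fun x => Real.exp (-(K * |x|)) • (w₀ + ∫ y in (0 : ℝ)..x, A y (Real.exp (K * |y|) • Z y)))
      ((by fun_prop : Continuous fun x : ℝ => Real.exp (-(K * |x|))).smul
        (continuous_const.add (hprim Z))) (‖w₀‖ + M / K * ‖Z‖) (by
        intro x
        rw [norm_smul, Real.norm_eq_abs, Real.abs_exp]
        have h1 : Real.exp (-(K * |x|)) ≤ 1 := Real.exp_le_one_iff.2 (by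
          have : 0 ≤ K * |x| := by positivity
          linarith)
        calc _ ≤ Real.exp (-(K * |x|)) * (‖w₀‖ + M / K * ‖Z‖ * Real.exp (K * |x|)) := by
              gcongr
              exact (norm_add_le _ _).trans (by gcongr; exact hbd Z x)
          _ = Real.exp (-(K * |x|)) * ‖w₀‖ + M / K * ‖Z‖ *
              (Real.exp (-(K * |x|)) * Real.exp (K * |x|)) := by ring
          _ ≤ 1 * ‖w₀‖ + M / K * ‖Z‖ * 1 := by rw [hcan]; gcongr
          _ = _ := by ring)
  have hT : ContractingWith (M / K).toNNReal T := by
    have hMK : 0 ≤ M / K := by positivity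
    refine ⟨?_, ?_⟩
    · rw [← NNReal.coe_lt_coe, Real.coe_toNNReal _ hMK, NNReal.coe_one, div_lt_one hK]
      linarith
    · refine LipschitzWith.of_dist_le_mul fun Z Z' => ?_
      rw [Real.coe_toNNReal _ hMK, BoundedContinuousFunction.dist_le (by positivity)]
      intro x
      have hsub : (T Z) x - (T Z') x = Real.exp (-(K * |x|)) •
          ∫ y in (0 : ℝ)..x, A y (Real.exp (K * |y|) • (Z - Z') y) := by
        simp only [T, BoundedContinuousFunction.coe_ofNormedAddCommGroup]
        rw [← smul_sub, add_sub_add_left_eq_sub, ← intervalIntegral.integral_sub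
          ((hcont Z).intervalIntegrable _ _) ((hcont Z').intervalIntegrable _ _)]
        simp [smul_sub]
      rw [dist_eq_norm, hsub, norm_smul, Real.norm_eq_abs, Real.abs_exp, dist_eq_norm]
      calc _ ≤ Real.exp (-(K * |x|)) * (M / K * ‖Z - Z'‖ * Real.exp (K * |x|)) := by
            gcongr; exact hbd _ x
        _ = M / K * ‖Z - Z'‖ * (Real.exp (-(K * |x|)) * Real.exp (K * |x|)) := by ring
        _ = _ := by rw [hcan, mul_one]
  set Z := ContractingWith.fixedPoint T hT
  have hZ : T Z = Z := hT.fixedPoint_isFixedPt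
  have hW : ∀ x, Real.exp (K * |x|) • Z x =
      w₀ + ∫ y in (0 : ℝ)..x, A y (Real.exp (K * |y|) • Z y) := by
    intro x
    have h1 : Z x = (T Z) x := by rw [hZ]
    rw [h1]
    simp only [T, BoundedContinuousFunction.coe_ofNormedAddCommGroup]
    rw [smul_smul, mul_comm, hcan, one_smul]
  refine ⟨fun x => Real.exp (K * |x|) • Z x, by simpa using hW 0, fun x => ?_⟩
  have h2 := (intervalIntegral.integral_hasDerivAt_right ((hcont Z).intervalIntegrable 0 x)
    ((hcont Z).stronglyMeasurableAtFilter _ _) (hcont Z).continuousAt).const_add w₀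
  exact h2.congr_of_eventuallyEq (Eventually.of_forall hW)

/-- Global solvability of linear equations with bounded continuous coefficients. -/
theorem exists_linear_ode {A : ℝ → F →L[ℝ] F} (hA : Continuous A) {M : ℝ}
    (hM : ∀ x, ‖A x‖ ≤ M) (x₀ : ℝ) (w₀ : F) :
    ∃ W : ℝ → F, W x₀ = w₀ ∧ ∀ x, HasDerivAt W (A x (W x)) x := by
  obtain ⟨W, h0, h⟩ := exists_linear_ode_zero (A := fun x => A (x + x₀))
    (hA.comp (continuous_id.add continuous_const)) (fun x => hM _) w₀
  refine ⟨fun x => W (x - x₀), by simp [h0], fun x => ?_⟩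
  have := (h (x - x₀)).comp_sub_const x x₀
  simpa using this

end LinearODE

section HalfLine

variable {E : Type*} [NormedCommRing E] [NormedAlgebra ℝ E] [CompleteSpace E]

open NormedSpace

theorem exp_neg_smul_mul (m : E) (x : ℝ) : exp (x • m) * exp (-(x • m)) = 1 := by
  let : NormedAlgebra ℚ E := NormedAlgebra.restrictScalars ℚ ℝ E
  rw [← exp_add, add_neg_cancel, exp_zero]

theorem exp_sub_smul (m : E) (x y : ℝ) :
    exp ((x - y) • m) = exp (x • m) * exp (-(y • m)) := by
  let : NormedAlgebra ℚ E := NormedAlgebra.restrictScalars ℚ ℝ E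
  rw [← exp_add, sub_smul, sub_eq_add_neg]

theorem hasDerivAt_exp_mul_primitive (m : E) {f : ℝ → E} (hf : Continuous f) (X₀ : ℝ) (e : E)
    (x : ℝ) :
    HasDerivAt (fun x => exp (x • m) * ((∫ y in X₀..x, exp (-(y • m)) * f y) - e))
      (m * (exp (x • m) * ((∫ y in X₀..x, exp (-(y • m)) * f y) - e)) + f x) x := by
  let : NormedAlgebra ℚ E := NormedAlgebra.restrictScalars ℚ ℝ E
  have hc : Continuous fun y : ℝ => exp (-(y • m)) * f y :=
    (NormedSpace.exp_continuous.comp (by fun_prop)).mul hf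
  have h1 : HasDerivAt (fun u : ℝ => exp (u • m)) (exp (x • m) * m) x :=
    hasDerivAt_exp_smul_const m x
  have h2 := (intervalIntegral.integral_hasDerivAt_right (hc.intervalIntegrable X₀ x)
    (hc.stronglyMeasurableAtFilter _ _) hc.continuousAt).sub_const e
  refine (h1.mul h2).congr_deriv ?_
  linear_combination (f x) * exp_neg_smul_mul m x

theorem norm_exp_mul_integral_le {m : E} {f : ℝ → E} {μ : Measure ℝ} {η B x : ℝ} (hB : 0 ≤ B)
    (hf : ∀ᵐ y ∂μ, ‖exp ((x - y) • m) * f y‖ ≤ Real.exp (-(η / 2) * (x - y)) * (B * Real.exp (-η * y)))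
    (hi : Integrable (fun y => Real.exp (-(η / 2) * y)) μ) :
    ‖exp (x • m) * ∫ y, exp (-(y • m)) * f y ∂μ‖ ≤
      B * Real.exp (-(η / 2) * x) * ∫ y, Real.exp (-(η / 2) * y) ∂μ := by
  by_cases hint : Integrable (fun y => exp (-(y • m)) * f y) μ
  · rw [← integral_const_mul_of_integrable hint]
    rw [← integral_const_mul]
    refine norm_integral_le_of_norm_le (hi.const_mul _) ?_
    filter_upwards [hf] with y hy
    rw [← mul_assoc, ← exp_sub_smul]
    refine hy.trans (le_of_eq ?_)
    have : Real.exp (-(η / 2) * (x - y)) * Real.exp (-η * y) =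
        Real.exp (-(η / 2) * x) * Real.exp (-(η / 2) * y) := by
      rw [← Real.exp_add, ← Real.exp_add]; congr 1; ring
    linear_combination B * this
  · rw [integral_undef hint, mul_zero, norm_zero]
    have : 0 ≤ ∫ y, Real.exp (-(η / 2) * y) ∂μ := integral_nonneg fun _ => by positivity
    positivity

/-- The bounded solution operator of `y' = m y + f` on a half line for exponentially decaying `f`,
when `m` is either stable or unstable relative to the rate of decay. -/
theorem exists_halfLine_solution (m : E) {η : ℝ} (hη : 0 < η)
    (hm : (∀ t : ℝ, 0 ≤ t → ‖exp (t • m)‖ ≤ Real.exp (-(η / 2) * t)) ∨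
      (∀ t : ℝ, t ≤ 0 → ‖exp (t • m)‖ ≤ Real.exp (-(η / 2) * t))) {X₀ : ℝ} (hX₀ : 0 ≤ X₀) :
    ∃ Φ : (ℝ → E) → ℝ → E, ∀ f : ℝ → E, Continuous f → ∀ B : ℝ,
      (∀ y, X₀ ≤ y → ‖f y‖ ≤ B * Real.exp (-η * y)) →
      (∀ x, HasDerivAt (Φ f) (m * Φ f x + f x) x) ∧
      (∀ x, X₀ ≤ x → ‖Φ f x‖ ≤ 2 * B / η * Real.exp (-(η / 2) * x)) ∧
      (∀ g : ℝ → E, Continuous g → ∀ B' : ℝ, (∀ y, X₀ ≤ y → ‖g y‖ ≤ B' * Real.exp (-η * y)) →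
        ∀ x, Φ (fun y => f y - g y) x = Φ f x - Φ g x) := by
  let : NormedAlgebra ℚ E := NormedAlgebra.restrictScalars ℚ ℝ E
  have hη2 : -(η / 2) < 0 := by linarith
  have hc : ∀ f : ℝ → E, Continuous f → Continuous fun y : ℝ => exp (-(y • m)) * f y :=
    fun f hf => (NormedSpace.exp_continuous.comp (by fun_prop)).mul hf
  have hpos : ∀ (f : ℝ → E) (B : ℝ), (∀ y, X₀ ≤ y → ‖f y‖ ≤ B * Real.exp (-η * y)) → 0 ≤ B :=
    fun f B h => by
      have := (norm_nonneg _).trans (h X₀ le_rfl)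
      exact nonneg_of_mul_nonneg_left this (Real.exp_pos _)
  have hIoi : ∀ x : ℝ, IntegrableOn (fun y => Real.exp (-(η / 2) * y)) (Set.Ioi x) := fun x =>
    integrableOn_exp_mul_Ioi hη2 x
  have hval : ∀ x : ℝ, 0 ≤ x → ∫ y in Set.Ioi x, Real.exp (-(η / 2) * y) ≤ 2 / η := by
    intro x hx
    rw [integral_exp_mul_Ioi hη2]
    have h1 : Real.exp (-(η / 2) * x) ≤ 1 := Real.exp_le_one_iff.2 (by nlinarith)
    rw [neg_div_neg_eq]
    calc Real.exp (-(η / 2) * x) / (η / 2) ≤ 1 / (η / 2) := by gcongr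
      _ = 2 / η := by field_simp
  rcases hm with hm | hm
  · refine ⟨fun f x => exp (x • m) * ((∫ y in X₀..x, exp (-(y • m)) * f y) - 0),
      fun f hf B hB => ⟨fun x => hasDerivAt_exp_mul_primitive m hf X₀ 0 x, fun x hx => ?_,
        fun g hg B' hB' x => ?_⟩⟩
    · have hB0 := hpos f B hB
      simp only [sub_zero]
      rw [intervalIntegral.integral_of_le hx]
      refine (norm_exp_mul_integral_le (η := η) hB0 ?_
        ((hIoi X₀).mono_set Set.Ioc_subset_Ioi_self)).trans ?_
      · refine (ae_restrict_iff' measurableSet_Ioc).2 (Eventually.of_forall fun y hy => ?_)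
        exact (norm_mul_le _ _).trans (by
          gcongr
          · exact hm _ (by linarith [hy.2])
          · exact hB y hy.1.le)
      · have : ∫ y in Set.Ioc X₀ x, Real.exp (-(η / 2) * y) ≤ 2 / η :=
          (setIntegral_mono_set (hIoi X₀) (Eventually.of_forall fun _ => by positivity)
            Set.Ioc_subset_Ioi_self.eventuallyLE).trans (hval X₀ hX₀)
        calc _ ≤ B * Real.exp (-(η / 2) * x) * (2 / η) := by gcongr
          _ = _ := by ring
    · simp only [sub_zero, mul_sub]
      rw [intervalIntegral.integral_sub ((hc f hf).intervalIntegrable _ _)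
        ((hc g hg).intervalIntegrable _ _), mul_sub]
  · have hint : ∀ f : ℝ → E, Continuous f → ∀ B : ℝ,
        (∀ y, X₀ ≤ y → ‖f y‖ ≤ B * Real.exp (-η * y)) →
        IntegrableOn (fun y => exp (-(y • m)) * f y) (Set.Ioi X₀) := by
      intro f hf B hB
      have hB0 := hpos f B hB
      refine Integrable.mono' ((hIoi X₀).const_mul B) (hc f hf).aestronglyMeasurable.restrict ?_
      refine (ae_restrict_iff' measurableSet_Ioi).2 (Eventually.of_forall fun y hy => ?_)
      have hy' : X₀ ≤ y := le_of_lt hy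
      calc ‖exp (-(y • m)) * f y‖ ≤ ‖exp ((-y) • m)‖ * ‖f y‖ := by
            rw [neg_smul]; exact norm_mul_le _ _
        _ ≤ Real.exp (-(η / 2) * -y) * (B * Real.exp (-η * y)) := by
            gcongr
            · exact hm _ (by linarith)
            · exact hB y hy'
        _ = B * Real.exp (-(η / 2) * y) := by
            rw [mul_left_comm, ← Real.exp_add]; congr 2; ring
    refine ⟨fun f x => exp (x • m) * ((∫ y in X₀..x, exp (-(y • m)) * f y) -
        ∫ y in Set.Ioi X₀, exp (-(y • m)) * f y),
      fun f hf B hB => ⟨fun x => hasDerivAt_exp_mul_primitive m hf X₀ _ x, fun x hx => ?_,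
        fun g hg B' hB' x => ?_⟩⟩
    · have hB0 := hpos f B hB
      have h1 : (∫ y in X₀..x, exp (-(y • m)) * f y) - ∫ y in Set.Ioi X₀, exp (-(y • m)) * f y
          = - ∫ y in Set.Ioi x, exp (-(y • m)) * f y := by
        have := intervalIntegral.integral_Ioi_sub_Ioi (hint f hf B hB) hx
        rw [← this]; abel
      simp only [h1, mul_neg, norm_neg]
      refine (norm_exp_mul_integral_le (η := η) hB0 ?_ (hIoi x)).trans ?_
      · refine (ae_restrict_iff' measurableSet_Ioi).2 (Eventually.of_forall fun y hy => ?_)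
        have hy' : x < y := hy
        exact (norm_mul_le _ _).trans (by
          gcongr
          · exact hm _ (by linarith)
          · exact hB y (by linarith))
      · calc _ ≤ B * Real.exp (-(η / 2) * x) * (2 / η) := by
              gcongr; exact hval x (by linarith)
          _ = _ := by ring
    · simp only [mul_sub]
      rw [intervalIntegral.integral_sub ((hc f hf).intervalIntegrable _ _)
        ((hc g hg).intervalIntegrable _ _), integral_sub (hint f hf B hB) (hint g hg B' hB')]
      ring

/-- A diagonal constant coefficient system with an exponentially decaying perturbation has a
solution asymptotic to any of its constant solutions, provided that the decay dominates the
spectral spreading. -/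
theorem exists_asymptotic_solution {ι : Type*} [Fintype ι] [DecidableEq ι] (m : ι → E) (k : ι)
    (hk : m k = 0) {η b : ℝ} (hη : 0 < η)
    (hm : ∀ j, (∀ t : ℝ, 0 ≤ t → ‖exp (t • m j)‖ ≤ Real.exp (-(η / 2) * t)) ∨
      (∀ t : ℝ, t ≤ 0 → ‖exp (t • m j)‖ ≤ Real.exp (-(η / 2) * t)))
    {A : ℝ → (ι → E) →L[ℝ] (ι → E)} (hA : Continuous A)
    (hAb : ∀ y, 0 ≤ y → ‖A y‖ ≤ b * Real.exp (-η * y)) :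
    ∃ X₀ : ℝ, ∃ Y : ℝ → ι → E, (∀ x, X₀ < x → HasDerivAt Y (m * Y x + A x (Y x)) x) ∧
      Tendsto Y atTop (𝓝 (Pi.single k 1)) := by
  have hb : 0 ≤ b := by
    have := (norm_nonneg _).trans (hAb 0 le_rfl)
    simpa using this
  obtain ⟨X₀, hX₀, hX₁⟩ : ∃ X₀ : ℝ, 0 ≤ X₀ ∧ 2 * b / η * Real.exp (-(η / 2) * X₀) ≤ 1 / 2 := by
    have : Tendsto (fun x : ℝ => 2 * b / η * Real.exp (-(η / 2) * x)) atTop (𝓝 (2 * b / η * 0)) :=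
      (Real.tendsto_exp_atBot.comp
        (tendsto_id.const_mul_atTop_of_neg (by linarith : -(η / 2) < 0))).const_mul _
    rw [mul_zero] at this
    obtain ⟨X, h1, h2⟩ := ((this.eventually_le_const (by norm_num : (0 : ℝ) < 1 / 2)).and
      (eventually_ge_atTop 0)).exists
    exact ⟨X, h2, h1⟩
  choose Φ hΦ using fun j => exists_halfLine_solution (m j) hη (hm j) hX₀
  have hcont : ∀ (Z : BoundedContinuousFunction ℝ (ι → E)) (j : ι),
      Continuous fun y => (A y (Z y)) j := fun Z j =>
    (continuous_apply j).comp (hA.clm_apply Z.continuous)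
  have hbd : ∀ (Z : BoundedContinuousFunction ℝ (ι → E)) (j : ι) (y : ℝ), X₀ ≤ y →
      ‖(A y (Z y)) j‖ ≤ b * ‖Z‖ * Real.exp (-η * y) := by
    intro Z j y hy
    refine (norm_le_pi_norm _ j).trans ?_
    calc ‖A y (Z y)‖ ≤ b * Real.exp (-η * y) * ‖Z‖ :=
          (A y).le_of_opNorm_le_of_le (hAb y (hX₀.trans hy)) (Z.norm_coe_le_norm y)
      _ = _ := by ring
  let P : BoundedContinuousFunction ℝ (ι → E) → ℝ → ι → E := fun Z x j =>
    Φ j (fun y => (A y (Z y)) j) x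
  have hPd : ∀ Z x, HasDerivAt (P Z) (m * P Z x + A x (Z x)) x := fun Z x =>
    hasDerivAt_pi.2 fun j => ((hΦ j) _ (hcont Z j) _ (hbd Z j)).1 x
  have hPb : ∀ Z x, X₀ ≤ x → ‖P Z x‖ ≤ 2 * (b * ‖Z‖) / η * Real.exp (-(η / 2) * x) := by
    intro Z x hx
    refine (pi_norm_le_iff_of_nonneg (by positivity)).2 fun j => ?_
    exact ((hΦ j) _ (hcont Z j) _ (hbd Z j)).2.1 x hx
  have hPs : ∀ Z Z' x, P (Z - Z') x = P Z x - P Z' x := by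
    intro Z Z' x
    ext j
    have := ((hΦ j) _ (hcont Z j) _ (hbd Z j)).2.2 _ (hcont Z' j) _ (hbd Z' j) x
    simpa [P] using this
  have hPh : ∀ Z x, X₀ ≤ x → ‖P Z x‖ ≤ 1 / 2 * ‖Z‖ := by
    intro Z x hx
    refine (hPb Z x hx).trans ?_
    calc 2 * (b * ‖Z‖) / η * Real.exp (-(η / 2) * x)
        ≤ 2 * (b * ‖Z‖) / η * Real.exp (-(η / 2) * X₀) := by
          gcongr ?_ * Real.exp ?_
          nlinarith
      _ = (2 * b / η * Real.exp (-(η / 2) * X₀)) * ‖Z‖ := by ring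
      _ ≤ _ := by gcongr
  let T : BoundedContinuousFunction ℝ (ι → E) → BoundedContinuousFunction ℝ (ι → E) := fun Z =>
    BoundedContinuousFunction.ofNormedAddCommGroup (fun x => Pi.single k 1 + P Z (max x X₀))
      (continuous_const.add ((continuous_iff_continuousAt.2 fun x =>
        (hPd Z x).continuousAt).comp (continuous_id.max continuous_const)))
      (‖(Pi.single k 1 : ι → E)‖ + 1 / 2 * ‖Z‖)
      (fun x => (norm_add_le _ _).trans (by gcongr; exact hPh Z _ (le_max_right _ _)))
  have hT : ContractingWith (1 / 2) T := by
    refine ⟨by rw [← NNReal.coe_lt_coe]; norm_num, LipschitzWith.of_dist_le_mul fun Z Z' => ?_⟩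
    rw [BoundedContinuousFunction.dist_le (by positivity)]
    intro x
    have : (T Z) x - (T Z') x = P (Z - Z') (max x X₀) := by
      simp only [T, BoundedContinuousFunction.coe_ofNormedAddCommGroup, hPs]
      abel
    rw [dist_eq_norm, dist_eq_norm, this]
    simpa using hPh (Z - Z') _ (le_max_right x X₀)
  set Z := ContractingWith.fixedPoint T hT
  have hZ : T Z = Z := hT.fixedPoint_isFixedPt
  have hZx : ∀ x, X₀ ≤ x → Z x = Pi.single k 1 + P Z x := by
    intro x hx
    have h1 : Z x = (T Z) x := by rw [hZ]
    rw [h1]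
    simp only [T, BoundedContinuousFunction.coe_ofNormedAddCommGroup, max_eq_left hx]
  refine ⟨X₀, Z, fun x hx => ?_, ?_⟩
  · have h1 : HasDerivAt (fun x => Pi.single k 1 + P Z x) (m * P Z x + A x (Z x)) x :=
      (hPd Z x).const_add _
    have h2 : m * Z x = m * P Z x := by
      rw [hZx x hx.le, mul_add]
      have : m * Pi.single k 1 = 0 := by
        ext j
        rcases eq_or_ne j k with rfl | hj
        · simp [hk]
        · simp [Pi.single_eq_of_ne hj]
      rw [this, zero_add]
    rw [h2]
    exact h1.congr_of_eventuallyEq (by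
      filter_upwards [lt_mem_nhds hx] with y hy using hZx y hy.le)
  · have h0 : Tendsto (fun x : ℝ => 2 * (b * ‖Z‖) / η * Real.exp (-(η / 2) * x)) atTop (𝓝 0) := by
      have := (Real.tendsto_exp_atBot.comp
        (tendsto_id.const_mul_atTop_of_neg (by linarith : -(η / 2) < 0))).const_mul
          (2 * (b * ‖Z‖) / η)
      simpa using this
    have h1 : Tendsto (P Z) atTop (𝓝 0) := squeeze_zero_norm' (by
      filter_upwards [eventually_ge_atTop X₀] with x hx using hPb Z x hx) h0
    have h2 : Tendsto (fun x => Pi.single k 1 + P Z x) atTop (𝓝 (Pi.single k 1)) := by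
      simpa using h1.const_add (Pi.single k 1)
    exact h2.congr' (by
      filter_upwards [eventually_ge_atTop X₀] with x hx using (hZx x hx).symm)

end HalfLine
end
end Korteweg
namespace Korteweg
noncomputable section

open Metric

open Classical in
/-- Continuous functions on the closed disk of radius `r` that are holomorphic inside. -/
def discSubalgebra (r : ℝ) : Subalgebra ℂ C(closedBall (0 : ℂ) r, ℂ) where
  carrier := {f | DifferentiableOn ℂ (fun z => if h : z ∈ closedBall (0 : ℂ) r then f ⟨z, h⟩ else 0)
    (ball 0 r)}
  mul_mem' := by
    intro f g hf hg
    refine (hf.mul hg).congr fun z hz => ?_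
    simp [-mem_closedBall, ball_subset_closedBall hz]
  add_mem' := by
    intro f g hf hg
    refine (hf.add hg).congr fun z hz => ?_
    simp [-mem_closedBall, ball_subset_closedBall hz]
  algebraMap_mem' := by
    intro c
    refine (differentiableOn_const c).congr fun z hz => ?_
    simp [-mem_closedBall, ball_subset_closedBall hz]

open Classical in
theorem isClosed_discSubalgebra (r : ℝ) :
    IsClosed (discSubalgebra r : Set C(closedBall (0 : ℂ) r, ℂ)) := by
  refine isClosed_of_closure_subset fun f hf => ?_
  obtain ⟨u, hu, hlim⟩ := mem_closure_iff_seq_limit.1 hf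
  refine TendstoLocallyUniformlyOn.differentiableOn
    (F := fun n z => if h : z ∈ closedBall (0 : ℂ) r then u n ⟨z, h⟩ else 0) (φ := atTop)
    (TendstoUniformlyOn.tendstoLocallyUniformlyOn ?_) (Eventually.of_forall fun n => hu n)
    isOpen_ball
  rw [Metric.tendstoUniformlyOn_iff]
  intro ε hε
  filter_upwards [(Metric.tendsto_nhds.1 hlim) ε hε] with n hn z hz
  have h : z ∈ closedBall (0 : ℂ) r := ball_subset_closedBall hz
  simp only [h, dif_pos]
  rw [dist_comm]
  exact (ContinuousMap.dist_apply_le_dist _).trans_lt hn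

/-- The disc algebra. -/
def Disc (r : ℝ) : Type := discSubalgebra r

namespace Disc

variable {r : ℝ}

instance : NormedCommRing (Disc r) := inferInstanceAs (NormedCommRing (discSubalgebra r))
instance : NormedAlgebra ℂ (Disc r) := inferInstanceAs (NormedAlgebra ℂ (discSubalgebra r))
instance : CompleteSpace (Disc r) :=
  (isClosed_discSubalgebra r).completeSpace_coe

/-- Evaluation at a point of the closed disk, as a morphism of algebras. -/
def evalHom {z : ℂ} (hz : z ∈ closedBall (0 : ℂ) r) : Disc r →ₐ[ℂ] ℂ :=
  (ContinuousMap.evalAlgHom ℂ ℂ (⟨z, hz⟩ : closedBall (0 : ℂ) r)).comp (discSubalgebra r).val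

theorem norm_evalHom_le {z : ℂ} (hz : z ∈ closedBall (0 : ℂ) r) (f : Disc r) :
    ‖evalHom hz f‖ ≤ ‖f‖ :=
  ContinuousMap.norm_coe_le_norm (f : discSubalgebra r).1 _

open Classical in
/-- Evaluation at a point, with value zero outside of the closed disk. -/
def eval (z : ℂ) : Disc r →L[ℂ] ℂ :=
  if hz : z ∈ closedBall (0 : ℂ) r then
    (evalHom hz).toLinearMap.mkContinuous 1 (fun f => by simpa using norm_evalHom_le hz f) else 0

theorem eval_eq {z : ℂ} (hz : z ∈ closedBall (0 : ℂ) r) (f : Disc r) :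
    eval z f = evalHom hz f := by
  rw [eval, dif_pos hz]; rfl

theorem eval_mul {z : ℂ} (hz : z ∈ closedBall (0 : ℂ) r) (f g : Disc r) :
    eval z (f * g) = eval z f * eval z g := by
  simp [eval_eq hz]

theorem eval_one {z : ℂ} (hz : z ∈ closedBall (0 : ℂ) r) : eval z (1 : Disc r) = 1 := by
  simp [eval_eq hz]

theorem eval_smul_real (z : ℂ) (t : ℝ) (f : Disc r) :
    eval z (t • f) = t * eval z f := by
  rw [← Complex.coe_smul, map_smul, smul_eq_mul]

theorem eval_exp {z : ℂ} (hz : z ∈ closedBall (0 : ℂ) r) (f : Disc r) :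
    eval z (NormedSpace.exp f) = Complex.exp (eval z f) := by
  let : NormedAlgebra ℚ (Disc r) := NormedAlgebra.restrictScalars ℚ ℂ (Disc r)
  have hc : Continuous (evalHom hz) := by
    have : (evalHom hz : Disc r → ℂ) = eval z := funext fun f => (eval_eq hz f).symm
    rw [this]
    exact (eval z).continuous
  rw [eval_eq hz, eval_eq hz, Complex.exp_eq_exp_ℂ]
  exact NormedSpace.map_exp (evalHom hz) hc f

theorem norm_eval_le (z : ℂ) (f : Disc r) : ‖eval z f‖ ≤ ‖f‖ := by
  by_cases hz : z ∈ closedBall (0 : ℂ) r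
  · rw [eval_eq hz]; exact norm_evalHom_le hz f
  · simp [eval, dif_neg hz, -mem_closedBall]

theorem norm_le {f : Disc r} {C : ℝ} (hC : 0 ≤ C)
    (h : ∀ z ∈ closedBall (0 : ℂ) r, ‖eval z f‖ ≤ C) : ‖f‖ ≤ C := by
  refine (ContinuousMap.norm_le (f : discSubalgebra r).1 hC).2 fun z => ?_
  have := h z.1 z.2
  rwa [eval_eq z.2] at this

theorem ext {f g : Disc r} (h : ∀ z ∈ closedBall (0 : ℂ) r, eval z f = eval z g) : f = g := by
  refine Subtype.ext (ContinuousMap.ext fun z => ?_)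
  have := h z.1 z.2
  rwa [eval_eq z.2, eval_eq z.2] at this

open Classical in
theorem eval_eq_dite (f : Disc r) (z : ℂ) : eval z f =
    if h : z ∈ closedBall (0 : ℂ) r then (f : discSubalgebra r).1 ⟨z, h⟩ else 0 := by
  by_cases hz : z ∈ closedBall (0 : ℂ) r
  · rw [eval_eq hz, dif_pos hz]; rfl
  · simp [eval, dif_neg hz, -mem_closedBall]

theorem differentiableOn_eval (f : Disc r) :
    DifferentiableOn ℂ (fun z => eval z f) (ball 0 r) := by
  simp only [eval_eq_dite]
  exact (f : discSubalgebra r).2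

theorem continuousOn_eval (f : Disc r) :
    ContinuousOn (fun z => eval z f) (closedBall 0 r) := by
  rw [continuousOn_iff_continuous_domRestrict]
  refine (f : discSubalgebra r).1.continuous.congr fun z => ?_
  rw [Set.domRestrict_apply, eval_eq z.2]; rfl

/-- A function that is holomorphic near the closed disk, as an element of the disc algebra. -/
def ofFun (f : ℂ → ℂ) (hf : ∀ z ∈ closedBall (0 : ℂ) r, DifferentiableAt ℂ f z) : Disc r :=
  (⟨⟨fun z => f z.1, continuous_iff_continuousAt.2 fun z =>
      ContinuousAt.comp (hf z.1 z.2).continuousAt continuous_subtype_val.continuousAt⟩, by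
    refine DifferentiableOn.congr (f := f)
      (fun z hz => (hf z (ball_subset_closedBall hz)).differentiableWithinAt) fun z hz => ?_
    simp [-mem_closedBall, ball_subset_closedBall hz]⟩ : discSubalgebra r)

theorem eval_ofFun {f : ℂ → ℂ} (hf : ∀ z ∈ closedBall (0 : ℂ) r, DifferentiableAt ℂ f z) {z : ℂ}
    (hz : z ∈ closedBall (0 : ℂ) r) : eval z (ofFun f hf) = f z := by
  rw [eval_eq hz]; rfl

/-- The coordinate function. -/
def lam : Disc r := ofFun id fun _ _ => differentiableAt_id

theorem eval_lam {z : ℂ} (hz : z ∈ closedBall (0 : ℂ) r) : eval z (lam : Disc r) = z :=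
  eval_ofFun _ hz

variable [Fact (0 < r)]

theorem zero_mem : (0 : ℂ) ∈ closedBall (0 : ℂ) r := by
  simpa using (Fact.out : 0 < r).le

theorem diffContOnCl_eval (f : Disc r) : DiffContOnCl ℂ (fun z => eval z f) (ball 0 r) :=
  ⟨differentiableOn_eval f, by
    rw [closure_ball _ (Fact.out : 0 < r).ne']
    exact continuousOn_eval f⟩

theorem analyticAt_eval (f : Disc r) : AnalyticAt ℂ (fun z => eval z f) 0 :=
  (differentiableOn_eval f).analyticAt (ball_mem_nhds _ Fact.out)

theorem eval_mul_eventuallyEq (f g : Disc r) :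
    (fun z => eval z (f * g)) =ᶠ[𝓝 0] fun z => eval z f * eval z g := by
  filter_upwards [closedBall_mem_nhds (0 : ℂ) (Fact.out : 0 < r)] with z hz using eval_mul hz f g

/-- The derivative at the center. -/
def derivZero : Disc r →L[ℂ] ℂ :=
  LinearMap.mkContinuous
    { toFun := fun f => deriv (fun z => eval z f) 0
      map_add' := fun f g => by
        simp only [map_add]
        exact deriv_fun_add (analyticAt_eval f).differentiableAt (analyticAt_eval g).differentiableAt
      map_smul' := fun c f => by
        simp only [map_smul, smul_eq_mul, RingHom.id_apply]
        exact deriv_const_mul c (analyticAt_eval f).differentiableAt } r⁻¹ (fun f => by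
      have := Complex.norm_deriv_le_of_forall_mem_sphere_norm_le (Fact.out : 0 < r)
        (diffContOnCl_eval f) (C := ‖f‖) (fun z _ => norm_eval_le z f)
      rw [mul_comm, ← div_eq_mul_inv]
      exact this)

theorem derivZero_apply (f : Disc r) : derivZero f = deriv (fun z => eval z f) 0 := rfl

theorem contDiffAt_eval (f : Disc r) : ContDiffAt ℂ (2 : ℕ) (fun z => eval z f) 0 :=
  (analyticAt_eval f).contDiffAt

/-- The second derivative at the center. -/
def derivTwoZero : Disc r →L[ℂ] ℂ :=
  LinearMap.mkContinuous
    { toFun := fun f => iteratedDeriv 2 (fun z => eval z f) 0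
      map_add' := fun f g => by
        simp only [map_add]
        exact iteratedDeriv_fun_add (contDiffAt_eval f) (contDiffAt_eval g)
      map_smul' := fun c f => by
        simp only [map_smul, smul_eq_mul, RingHom.id_apply]
        exact iteratedDeriv_const_mul_field c _ } (2 / r ^ 2) (fun f => by
      have := Complex.norm_iteratedDeriv_le_of_forall_mem_sphere_norm_le 2 (Fact.out : 0 < r)
        (diffContOnCl_eval f) (C := ‖f‖) (fun z _ => norm_eval_le z f)
      refine this.trans (le_of_eq ?_)
      simp [Nat.factorial]; ring)

theorem derivTwoZero_apply (f : Disc r) :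
    derivTwoZero f = deriv (deriv (fun z => eval z f)) 0 := by
  change iteratedDeriv 2 (fun z => eval z f) 0 = _
  rw [iteratedDeriv_succ, iteratedDeriv_one]

theorem derivZero_lam_mul (f : Disc r) : derivZero (lam * f) = eval 0 f := by
  rw [derivZero_apply]
  have h : (fun z => eval z (lam * f)) =ᶠ[𝓝 0] fun z => z * eval z f := by
    filter_upwards [closedBall_mem_nhds (0 : ℂ) (Fact.out : 0 < r)] with z hz
    rw [eval_mul hz, eval_lam hz]
  rw [h.deriv_eq]
  have := (hasDerivAt_id' (0 : ℂ)).fun_mul (analyticAt_eval f).differentiableAt.hasDerivAt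
  simpa using this.deriv

theorem derivTwoZero_lam_mul (f : Disc r) : derivTwoZero (lam * f) = 2 * derivZero f := by
  rw [derivTwoZero_apply, derivZero_apply]
  have h : deriv (fun z => eval z (lam * f)) =ᶠ[𝓝 0]
      fun z => eval z f + z * deriv (fun z => eval z f) z := by
    filter_upwards [(isOpen_ball (x := (0 : ℂ)) (ε := r)).mem_nhds (by simpa using! (Fact.out : 0 < r))]
      with z hz
    have h1 : (fun z => eval z (lam * f)) =ᶠ[𝓝 z] fun z => z * eval z f := by
      filter_upwards [isOpen_ball.mem_nhds hz] with w hw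
      have hw' := ball_subset_closedBall hw
      rw [eval_mul hw', eval_lam hw']
    rw [h1.deriv_eq]
    have := (hasDerivAt_id' z).fun_mul
      ((differentiableOn_eval f).differentiableAt (isOpen_ball.mem_nhds hz)).hasDerivAt
    simpa using this.deriv
  rw [h.deriv_eq]
  have h2 := (analyticAt_eval f).differentiableAt.hasDerivAt.fun_add
    ((hasDerivAt_id' (0 : ℂ)).fun_mul (analyticAt_eval f).deriv.differentiableAt.hasDerivAt)
  have := h2.deriv
  simp only [zero_mul, one_mul, add_zero] at this
  rw [two_mul]
  exact this

end Disc
end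
end Korteweg
namespace Korteweg
noncomputable section

section Branches

/-- The map whose level sets are the pairs of an eigenvalue `μ` of the constant coefficient system
and the ratio `σ = λ / μ`. -/
def charMap (κ s : ℝ) (q : ℂ × ℂ) : ℂ × ℂ := (q.1 * q.2, κ * q.2 ^ 2 + (q.1 - s) ^ 2)

/-- The derivative of `charMap`. -/
def charDeriv (κ s : ℝ) (q : ℂ × ℂ) : (ℂ × ℂ) →L[ℂ] (ℂ × ℂ) :=
  (q.1 • ContinuousLinearMap.snd ℂ ℂ ℂ + q.2 • ContinuousLinearMap.fst ℂ ℂ ℂ).prod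
    ((2 * κ * q.2) • ContinuousLinearMap.snd ℂ ℂ ℂ + (2 * (q.1 - s)) • ContinuousLinearMap.fst ℂ ℂ ℂ)

/-- The inverse of the derivative of `charMap`. -/
def charDerivInv (κ s : ℝ) (q : ℂ × ℂ) : (ℂ × ℂ) →L[ℂ] (ℂ × ℂ) :=
  (2 * q.1 * (q.1 - s) - 2 * κ * q.2 ^ 2)⁻¹ •
  ((q.1 • ContinuousLinearMap.snd ℂ ℂ ℂ - (2 * κ * q.2) • ContinuousLinearMap.fst ℂ ℂ ℂ).prod
    ((2 * (q.1 - s)) • ContinuousLinearMap.fst ℂ ℂ ℂ - q.2 • ContinuousLinearMap.snd ℂ ℂ ℂ))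

theorem hasStrictFDerivAt_charMap (κ s : ℝ) (q : ℂ × ℂ) :
    HasStrictFDerivAt (charMap κ s) (charDeriv κ s q) q := by
  have hf : HasStrictFDerivAt (fun q : ℂ × ℂ => q.1) (ContinuousLinearMap.fst ℂ ℂ ℂ) q :=
    hasStrictFDerivAt_fst
  have hs : HasStrictFDerivAt (fun q : ℂ × ℂ => q.2) (ContinuousLinearMap.snd ℂ ℂ ℂ) q :=
    hasStrictFDerivAt_snd
  have h := (hf.mul hs).prodMk (((hs.pow 2).const_mul (κ : ℂ)).add ((hf.sub_const (s : ℂ)).pow 2))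
  refine h.congr_fderiv ?_
  ext <;> (simp [charDeriv]; try ring)

theorem exists_branch (κ s : ℝ) {d σ₀ μ₀ : ℂ} (h₀ : σ₀ * μ₀ = 0)
    (h₁ : κ * μ₀ ^ 2 + (σ₀ - s) ^ 2 = d) (h₂ : 2 * σ₀ * (σ₀ - s) - 2 * κ * μ₀ ^ 2 ≠ 0) :
    ∃ σ μ : ℂ → ℂ, σ 0 = σ₀ ∧ μ 0 = μ₀ ∧ AnalyticAt ℂ σ 0 ∧ AnalyticAt ℂ μ 0 ∧
      ∀ᶠ z in 𝓝 0, σ z * μ z = z ∧ κ * μ z ^ 2 + (σ z - s) ^ 2 = d := by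
  set q₀ : ℂ × ℂ := (σ₀, μ₀) with hq₀
  let e : (ℂ × ℂ) ≃L[ℂ] (ℂ × ℂ) := ContinuousLinearEquiv.equivOfInverse
    (charDeriv κ s q₀) (charDerivInv κ s q₀)
    (by
      rintro ⟨a, b⟩
      have hi := inv_mul_cancel₀ h₂
      simp only [charDeriv, charDerivInv, hq₀]
      generalize (2 * σ₀ * (σ₀ - s) - 2 * κ * μ₀ ^ 2)⁻¹ = i at *
      ext
      · simp
        linear_combination a * hi
      · simp
        linear_combination b * hi)
    (by
      rintro ⟨a, b⟩
      have hi := inv_mul_cancel₀ h₂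
      simp only [charDeriv, charDerivInv, hq₀]
      generalize (2 * σ₀ * (σ₀ - s) - 2 * κ * μ₀ ^ 2)⁻¹ = i at *
      ext
      · simp
        linear_combination a * hi
      · simp
        linear_combination b * hi)
  have hd : HasStrictFDerivAt (charMap κ s) (e : (ℂ × ℂ) →L[ℂ] (ℂ × ℂ)) q₀ :=
    hasStrictFDerivAt_charMap κ s q₀
  have hC : ContDiffAt ℂ 1 (charMap κ s) q₀ := by
    unfold charMap; fun_prop
  have hval : charMap κ s q₀ = (0, d) := by simp [charMap, hq₀, h₀, h₁]
  have hinv := hC.to_localInverse hd.hasFDerivAt (by norm_num)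
  set g := hC.localInverse hd.hasFDerivAt (by norm_num) with hg
  have hg0 : g (0, d) = q₀ := by
    rw [← hval]; exact hC.localInverse_apply_image hd.hasFDerivAt (by norm_num)
  rw [hval] at hinv
  have hline : ContDiffAt ℂ 1 (fun z : ℂ => g (z, d)) 0 :=
    ContDiffAt.comp (f := fun z : ℂ => (z, d)) (0 : ℂ) hinv (by fun_prop)
  have han : AnalyticAt ℂ (fun z : ℂ => g (z, d)) 0 := by
    rw [Complex.analyticAt_iff_eventually_differentiableAt]
    filter_upwards [hline.eventually (by simp)] with z hz
      using hz.differentiableAt (by simp)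
  refine ⟨fun z => (g (z, d)).1, fun z => (g (z, d)).2, by simp [hg0, hq₀], by simp [hg0, hq₀],
    analyticAt_fst.comp han, analyticAt_snd.comp han, ?_⟩
  have hright : ∀ᶠ y in 𝓝 (charMap κ s q₀), charMap κ s (g y) = y :=
    hd.eventually_right_inverse
  rw [hval] at hright
  have ht : Tendsto (fun z : ℂ => (z, d)) (𝓝 0) (𝓝 (0, d)) :=
    (Continuous.prodMk_left d).tendsto 0
  filter_upwards [ht.eventually hright] with z hz
  simp only [charMap, Prod.mk.injEq] at hz
  exact hz

/-- The eigenvectors of the constant coefficient system, as columns. -/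
def eigenMatrix {R : Type*} [CommRing R] (s : R) (σ μ : Fin 4 → R) : Matrix (Fin 4) (Fin 4) R :=
  Matrix.of ![fun j => σ j - s, fun _ => 1, fun j => μ j, fun j => μ j ^ 2]

theorem analyticAt_det_eigenMatrix {s : ℂ} {σ μ : Fin 4 → ℂ → ℂ} (hσ : ∀ j, AnalyticAt ℂ (σ j) 0)
    (hμ : ∀ j, AnalyticAt ℂ (μ j) 0) :
    AnalyticAt ℂ (fun z => (eigenMatrix s (fun j => σ j z) (fun j => μ j z)).det) 0 := by
  simp only [Matrix.det_apply']
  refine Finset.analyticAt_fun_sum _ fun p _ => ?_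
  refine analyticAt_const.mul ?_
  refine Finset.analyticAt_fun_prod _ fun i _ => ?_
  generalize p i = j
  have h0 := hσ i
  have h1 := hμ i
  fin_cases j <;> simp [eigenMatrix] <;> fun_prop

/-- The four branches of eigenvalues of the constant coefficient system near `λ = 0`: fast stable,
slow stable, slow unstable, fast unstable. -/
theorem exists_branches {κ s c ν : ℝ} (hκ : 0 < κ) (hsc : s ^ 2 < c ^ 2) (hc : 0 < c)
    (hν : 0 < ν) (hν2 : κ * ν ^ 2 = c ^ 2 - s ^ 2) :
    ∃ σ μ : Fin 4 → ℂ → ℂ, (∀ j, μ j 0 = ((![-ν, 0, 0, ν] j : ℝ) : ℂ)) ∧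
      (∀ j, σ j 0 = ((![0, s - c, s + c, 0] j : ℝ) : ℂ)) ∧
      (∀ j, AnalyticAt ℂ (σ j) 0) ∧ (∀ j, AnalyticAt ℂ (μ j) 0) ∧
      ∀ᶠ z in 𝓝 (0 : ℂ), (∀ j, σ j z * μ j z = z ∧ κ * μ j z ^ 2 + (σ j z - s) ^ 2 = (c : ℂ) ^ 2) ∧
        (eigenMatrix (s : ℂ) (fun j => σ j z) (fun j => μ j z)).det ≠ 0 ∧
        (0 < z.re → (μ 0 z).re < 0 ∧ (μ 1 z).re < 0 ∧ 0 < (μ 2 z).re ∧ 0 < (μ 3 z).re) := by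
  have habs : |s| < c := abs_lt_of_sq_lt_sq hsc hc.le
  obtain ⟨hs1, hs2⟩ := abs_lt.1 habs
  have hν2' : (κ : ℂ) * ν ^ 2 = c ^ 2 - s ^ 2 := by exact_mod_cast hν2
  have hne : (κ : ℂ) * ν ^ 2 ≠ 0 := by
    have : κ * ν ^ 2 ≠ 0 := by positivity
    exact_mod_cast this
  have hex : ∀ j : Fin 4, ∃ σ μ : ℂ → ℂ, σ 0 = ((![0, s - c, s + c, 0] j : ℝ) : ℂ) ∧
      μ 0 = ((![-ν, 0, 0, ν] j : ℝ) : ℂ) ∧ AnalyticAt ℂ σ 0 ∧ AnalyticAt ℂ μ 0 ∧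
      ∀ᶠ z in 𝓝 0, σ z * μ z = z ∧ κ * μ z ^ 2 + (σ z - s) ^ 2 = (c : ℂ) ^ 2 := by
    have hc1 : (s - c) * c ≠ 0 := mul_ne_zero (by linarith) hc.ne'
    have hc2 : (s + c) * c ≠ 0 := mul_ne_zero (by linarith) hc.ne'
    have hc1' : ((s : ℂ) - c) * c ≠ 0 := by exact_mod_cast hc1
    have hc2' : ((s : ℂ) + c) * c ≠ 0 := by exact_mod_cast hc2
    intro j
    refine exists_branch κ s ?_ ?_ ?_
    · fin_cases j <;> simp
    · fin_cases j <;> simp <;> linear_combination hν2'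
    · fin_cases j
      · intro h; apply hne; simp at h; simp [h]
      · intro h; apply hc1'; simp at h; simp [h]
      · intro h; apply hc2'; simp at h; simp [h]
      · intro h; apply hne; simp at h; simp [h]
  choose σ μ hσ0 hμ0 hσ hμ hrel using hex
  refine ⟨σ, μ, hμ0, hσ0, hσ, hμ, ?_⟩
  have hdet : ∀ᶠ z in 𝓝 (0 : ℂ), (eigenMatrix (s : ℂ) (fun j => σ j z) (fun j => μ j z)).det ≠ 0 := by
    refine (analyticAt_det_eigenMatrix hσ hμ).continuousAt.eventually_ne ?_
    simp only [hσ0, hμ0]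
    have hcv : c * ν ^ 3 ≠ 0 := by positivity
    have hcv' : (c : ℂ) * ν ^ 3 ≠ 0 := by exact_mod_cast hcv
    have h4 : (4 : ℂ) * (c * ν ^ 3) ≠ 0 := mul_ne_zero (by norm_num) hcv'
    convert h4 using 1
    simp [Matrix.det_succ_row_zero, Fin.sum_univ_succ, Fin.succAbove, eigenMatrix]
    ring
  have hre : ∀ j : Fin 4, Tendsto (fun z => (μ j z).re) (𝓝 0) (𝓝 (![-ν, 0, 0, ν] j)) := fun j => by
    have := (Complex.continuous_re.continuousAt.comp (hμ j).continuousAt).tendsto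
    simpa [hμ0, Function.comp_def] using this
  have hres : ∀ j : Fin 4, Tendsto (fun z => (σ j z - s).re) (𝓝 0)
      (𝓝 (![0, s - c, s + c, 0] j - s)) := fun j => by
    have := (Complex.continuous_re.continuousAt.comp ((hσ j).continuousAt.sub
      (continuousAt_const (y := (s : ℂ))))).tendsto
    simpa [hσ0, Function.comp_def] using this
  have key : ∀ (σ μ z : ℂ), σ * μ = z → κ * μ ^ 2 + (σ - s) ^ 2 = (c : ℂ) ^ 2 →
      z.re * (σ - s).re = μ.re * (s * (σ - s).re + (σ - s).re ^ 2 + κ * μ.im ^ 2) := by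
    intro σ μ z h1 h2
    have h3 := congrArg Complex.im h2
    have h4 := congrArg Complex.re h1
    simp [pow_two] at h3 h4
    simp
    linear_combination (-(σ.re - s)) * h4 + (-μ.im / 2) * h3
  have e0 := (hre 0).eventually_lt_const (show (![-ν, 0, 0, ν] 0) < 0 by simpa using hν)
  have e3 := (hre 3).eventually_const_lt (show 0 < (![-ν, 0, 0, ν] 3) by simpa using hν)
  have e1 := (hres 1).eventually_lt_const (show (![0, s - c, s + c, 0] 1 - s) < -|s| by
    simpa using habs)
  have e2 := (hres 2).eventually_const_lt (show |s| < (![0, s - c, s + c, 0] 2 - s) by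
    simpa using habs)
  filter_upwards [eventually_all.2 hrel, hdet, e0, e1, e2, e3] with z h1 h2 h3 h4 h5 h6
  refine ⟨h1, h2, fun hz => ⟨h3, ?_, ?_, h6⟩⟩
  · have k := key _ _ _ (h1 1).1 (h1 1).2
    generalize (σ 1 z - s).re = t at *
    have ht : t < 0 := h4.trans_le (by simp)
    have : 0 < s * t + t ^ 2 + κ * (μ 1 z).im ^ 2 := by
      have : 0 < t * (t + s) := mul_pos_of_neg_of_neg ht (by linarith [neg_abs_le s, le_abs_self s])
      nlinarith [mul_nonneg hκ.le (sq_nonneg (μ 1 z).im)]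
    have h7 : (μ 1 z).re * (s * t + t ^ 2 + κ * (μ 1 z).im ^ 2) < 0 := by
      rw [← k]; exact mul_neg_of_pos_of_neg hz ht
    by_contra hcon
    exact absurd h7 (not_lt.2 (mul_nonneg (not_lt.1 hcon) this.le))
  · have k := key _ _ _ (h1 2).1 (h1 2).2
    generalize (σ 2 z - s).re = t at *
    have ht : 0 < t := (abs_nonneg s).trans_lt h5
    have : 0 < s * t + t ^ 2 + κ * (μ 2 z).im ^ 2 := by
      have : 0 < t * (t + s) := mul_pos ht (by linarith [neg_abs_le s])
      nlinarith [mul_nonneg hκ.le (sq_nonneg (μ 2 z).im)]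
    have h7 : 0 < (μ 2 z).re * (s * t + t ^ 2 + κ * (μ 2 z).im ^ 2) := by
      rw [← k]; positivity
    exact pos_of_mul_pos_left h7 this.le

end Branches
end
end Korteweg
namespace Korteweg
noncomputable section

section Lift

variable {E : Type*} [NormedCommRing E] [NormedAlgebra ℝ E]

/-- Multiplication by a matrix as a continuous linear map. -/
def mulVecCLM (M : Matrix (Fin 4) (Fin 4) E) : (Fin 4 → E) →L[ℝ] (Fin 4 → E) :=
  ContinuousLinearMap.pi fun i =>
    ∑ j, (ContinuousLinearMap.mul ℝ E (M i j)).comp (ContinuousLinearMap.proj j)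

@[simp]
theorem mulVecCLM_apply (M : Matrix (Fin 4) (Fin 4) E) (v : Fin 4 → E) :
    mulVecCLM M v = M.mulVec v := by
  ext i
  simp [mulVecCLM, Matrix.mulVec, dotProduct]

/-- The part of the coefficient matrix of the eigenvalue equation that does not depend on the
profile. -/
def evansConst (κ s : ℝ) (lam : E) : Matrix (Fin 4) (Fin 4) E :=
  !![0, lam, -algebraMap ℝ E s, 0;
     0, 0, 1, 0;
     0, 0, 0, 1;
     -(lam * algebraMap ℝ E κ⁻¹), algebraMap ℝ E s * lam * algebraMap ℝ E κ⁻¹,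
       -(algebraMap ℝ E s ^ 2 * algebraMap ℝ E κ⁻¹), 0]

/-- The matrix whose only nonzero entry is `-κ⁻¹`, in the last row and in column `j`. -/
def evansPert (κ : ℝ) (j : Fin 4) : Matrix (Fin 4) (Fin 4) E :=
  Matrix.single 3 j (-algebraMap ℝ E κ⁻¹)

/-- The coefficient matrix of the eigenvalue equation over a real algebra. -/
def evansGen (κ s : ℝ) (lam : E) (a a' : ℝ) : Matrix (Fin 4) (Fin 4) E :=
  evansConst κ s lam + a • evansPert κ 2 + a' • evansPert κ 1

theorem mulVecCLM_evansGen (κ s : ℝ) (lam : E) (a a' : ℝ) :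
    mulVecCLM (evansGen κ s lam a a') = mulVecCLM (evansConst κ s lam) +
      a • mulVecCLM (evansPert κ 2) + a' • mulVecCLM (evansPert κ 1) := by
  ext v
  simp [evansGen, Matrix.add_mulVec, Matrix.smul_mulVec]

theorem continuous_mulVecCLM_evansGen (κ s : ℝ) (lam : E) {α α' : ℝ → ℝ} (hα : Continuous α)
    (hα' : Continuous α') :
    Continuous fun x => mulVecCLM (evansGen κ s lam (α x) (α' x)) := by
  simp only [mulVecCLM_evansGen]
  fun_prop

theorem norm_mulVecCLM_evansGen_le (κ s : ℝ) (lam : E) {M a a' : ℝ} (ha : |a| ≤ M)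
    (ha' : |a'| ≤ M) :
    ‖mulVecCLM (evansGen κ s lam a a')‖ ≤ ‖mulVecCLM (evansConst κ s lam)‖ +
      M * ‖mulVecCLM (evansPert κ 2 : Matrix (Fin 4) (Fin 4) E)‖ +
      M * ‖mulVecCLM (evansPert κ 1 : Matrix (Fin 4) (Fin 4) E)‖ := by
  rw [mulVecCLM_evansGen]
  refine (norm_add_le _ _).trans (add_le_add ((norm_add_le _ _).trans
    (add_le_add le_rfl ?_)) ?_) <;>
  · rw [norm_smul, Real.norm_eq_abs]; gcongr

theorem evansGen_eq (κ s : ℝ) (lam : E) (a a' : ℝ) :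
    evansGen κ s lam a a' =
      !![0, lam, -algebraMap ℝ E s, 0;
         0, 0, 1, 0;
         0, 0, 0, 1;
         -(lam * algebraMap ℝ E κ⁻¹),
           algebraMap ℝ E s * lam * algebraMap ℝ E κ⁻¹ - algebraMap ℝ E a' * algebraMap ℝ E κ⁻¹,
           -(algebraMap ℝ E s ^ 2 * algebraMap ℝ E κ⁻¹) - algebraMap ℝ E a * algebraMap ℝ E κ⁻¹,
           0] := by
  ext i j
  simp only [evansGen, Matrix.add_apply, Matrix.smul_apply, evansPert, Matrix.single_apply]
  fin_cases i <;> fin_cases j <;> simp [evansConst, sub_eq_add_neg, Algebra.smul_def]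

theorem evansGen_mul_eigenMatrix {κ s c : ℝ} (hκ : κ ≠ 0) {lam : E} {σ μ : Fin 4 → E}
    (h1 : ∀ j, σ j * μ j = lam)
    (h2 : ∀ j, algebraMap ℝ E κ * μ j ^ 2 + (σ j - algebraMap ℝ E s) ^ 2 = algebraMap ℝ E c ^ 2) :
    evansGen κ s lam (-c ^ 2) 0 * eigenMatrix (algebraMap ℝ E s) σ μ =
      eigenMatrix (algebraMap ℝ E s) σ μ * Matrix.diagonal μ := by
  have hk : algebraMap ℝ E κ * algebraMap ℝ E κ⁻¹ = 1 := by
    rw [← map_mul, mul_inv_cancel₀ hκ, map_one]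
  rw [evansGen_eq]
  ext i j
  have e1 := h1 j
  have e2 := h2 j
  rw [Matrix.mul_diagonal, Matrix.mul_apply]
  fin_cases i
  · simp [Fin.sum_univ_four, eigenMatrix]
    linear_combination -e1
  · simp [Fin.sum_univ_four, eigenMatrix]
  · simp [Fin.sum_univ_four, eigenMatrix]
    ring
  · simp [Fin.sum_univ_four, eigenMatrix]
    linear_combination (algebraMap ℝ E κ⁻¹) * (σ j - 2 * algebraMap ℝ E s) * e1
      - algebraMap ℝ E κ⁻¹ * μ j * e2 + μ j ^ 3 * hk

variable [CompleteSpace E]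

theorem exists_halfLine_basis {κ s c η B M : ℝ} (hκ : κ ≠ 0) (hη : 0 < η) {α α' : ℝ → ℝ}
    (hα : Continuous α) (hα' : Continuous α') (hM : ∀ x, |α x| ≤ M) (hM' : ∀ x, |α' x| ≤ M)
    (hd : ∀ x, 0 ≤ x → |α x + c ^ 2| ≤ B * Real.exp (-η * x))
    (hd' : ∀ x, 0 ≤ x → |α' x| ≤ B * Real.exp (-η * x)) {lam : E} {σ μ : Fin 4 → E}
    (h1 : ∀ j, σ j * μ j = lam)
    (h2 : ∀ j, algebraMap ℝ E κ * μ j ^ 2 + (σ j - algebraMap ℝ E s) ^ 2 = algebraMap ℝ E c ^ 2)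
    (hdet : IsUnit (eigenMatrix (algebraMap ℝ E s) σ μ).det)
    (hspec : ∀ j k,
      (∀ t : ℝ, 0 ≤ t → ‖NormedSpace.exp (t • (μ j - μ k))‖ ≤ Real.exp (-(η / 2) * t)) ∨
      (∀ t : ℝ, t ≤ 0 → ‖NormedSpace.exp (t • (μ j - μ k))‖ ≤ Real.exp (-(η / 2) * t))) (k : Fin 4) :
    ∃ W : ℝ → Fin 4 → E,
      (∀ x, HasDerivAt W ((evansGen κ s lam (α x) (α' x)).mulVec (W x)) x) ∧
      Tendsto (fun x i => NormedSpace.exp (-(x • μ k)) * W x i) atTop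
        (𝓝 fun i => eigenMatrix (algebraMap ℝ E s) σ μ i k) := by
  set R := eigenMatrix (algebraMap ℝ E s) σ μ with hR
  have hRR : R * R⁻¹ = 1 := Matrix.mul_nonsing_inv R hdet
  set C₁ := mulVecCLM (R⁻¹ * evansPert κ 2 * R) with hC₁
  set C₂ := mulVecCLM (R⁻¹ * evansPert κ 1 * R) with hC₂
  have hB : 0 ≤ B := by
    have := (abs_nonneg _).trans (hd 0 le_rfl)
    simpa using this
  obtain ⟨X₀, Y, hY, hYlim⟩ := exists_asymptotic_solution (fun j => μ j - μ k) k (sub_self _) hη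
    (fun j => hspec j k) (A := fun x => (α x + c ^ 2) • C₁ + α' x • C₂)
    (b := B * ‖C₁‖ + B * ‖C₂‖) (by fun_prop) (fun y hy => by
      refine (norm_add_le _ _).trans ?_
      rw [norm_smul, norm_smul, Real.norm_eq_abs, Real.norm_eq_abs]
      calc _ ≤ B * Real.exp (-η * y) * ‖C₁‖ + B * Real.exp (-η * y) * ‖C₂‖ := by
            gcongr
            · exact hd y hy
            · exact hd' y hy
        _ = _ := by ring)
  let V : ℝ → Fin 4 → E := fun x i => NormedSpace.exp (x • μ k) * (R.mulVec (Y x)) i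
  have hV : ∀ x, X₀ < x → HasDerivAt V ((evansGen κ s lam (α x) (α' x)).mulVec (V x)) x := by
    intro x hx
    let : NormedAlgebra ℚ E := NormedAlgebra.restrictScalars ℚ ℝ E
    have hRY : HasDerivAt (fun x => R.mulVec (Y x)) (R.mulVec ((fun j => μ j - μ k) * Y x +
        ((α x + c ^ 2) • C₁ + α' x • C₂) (Y x))) x := by
      have := (mulVecCLM R).hasFDerivAt.comp_hasDerivAt x (hY x hx)
      simpa [Function.comp_def] using this
    have hexp : HasDerivAt (fun u : ℝ => NormedSpace.exp (u • μ k))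
        (NormedSpace.exp (x • μ k) * μ k) x := hasDerivAt_exp_smul_const (μ k) x
    have hcomm : evansGen κ s lam (α x) (α' x) = evansGen κ s lam (-c ^ 2) 0
        + ((α x + c ^ 2) • evansPert κ 2 + α' x • evansPert κ 1) := by
      simp only [evansGen]
      module
    have hA : R.mulVec ((fun j => μ j - μ k) * Y x +
        ((α x + c ^ 2) • C₁ + α' x • C₂) (Y x)) =
        (evansGen κ s lam (α x) (α' x)).mulVec (R.mulVec (Y x)) - μ k • R.mulVec (Y x) := by
      have t1 : R.mulVec ((fun j => μ j - μ k) * Y x) =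
          (evansGen κ s lam (-c ^ 2) 0).mulVec (R.mulVec (Y x)) - μ k • R.mulVec (Y x) := by
        rw [Matrix.mulVec_mulVec, evansGen_mul_eigenMatrix hκ h1 h2, ← Matrix.mulVec_mulVec,
          ← Matrix.mulVec_smul, ← Matrix.mulVec_sub]
        congr 1
        ext j
        simp [Matrix.mulVec_diagonal, sub_mul]
      have t2 : ∀ P : Matrix (Fin 4) (Fin 4) E,
          R.mulVec ((R⁻¹ * P * R).mulVec (Y x)) = P.mulVec (R.mulVec (Y x)) := by
        intro P
        rw [Matrix.mulVec_mulVec, Matrix.mulVec_mulVec, ← mul_assoc, ← mul_assoc, hRR, one_mul]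
      rw [Matrix.mulVec_add, t1, hcomm, Matrix.add_mulVec]
      simp only [add_apply, smul_apply, hC₁, hC₂,
        mulVecCLM_apply, Matrix.mulVec_add, Matrix.mulVec_smul, t2, Matrix.add_mulVec,
        Matrix.smul_mulVec]
      abel
    refine hasDerivAt_pi.2 fun i => ?_
    refine (hexp.mul (hasDerivAt_pi.1 hRY i)).congr_deriv ?_
    have hV' : (evansGen κ s lam (α x) (α' x)).mulVec (V x) i = NormedSpace.exp (x • μ k) *
        (evansGen κ s lam (α x) (α' x)).mulVec (R.mulVec (Y x)) i := by
      have : V x = NormedSpace.exp (x • μ k) • R.mulVec (Y x) := rfl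
      rw [this, Matrix.mulVec_smul]; rfl
    rw [hV', hA]
    simp only [Pi.sub_apply, Pi.smul_apply, smul_eq_mul]
    ring
  have hbd := fun x => norm_mulVecCLM_evansGen_le κ s lam (hM x) (hM' x)
  obtain ⟨W, hW0, hW⟩ := exists_linear_ode (continuous_mulVecCLM_evansGen κ s lam hα hα') hbd
    (X₀ + 1) (V (X₀ + 1))
  have hWV : ∀ x, X₀ < x → W x = V x := by
    intro x hx
    refine linear_ode_unique hbd (s := X₀) (t := max x (X₀ + 1) + 1) (x₀ := X₀ + 1)
      ⟨by linarith, by linarith [le_max_right x (X₀ + 1)]⟩ (fun y _ => hW y)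
      (fun y hy => by simpa using hV y hy.1) hW0 ⟨hx, by linarith [le_max_left x (X₀ + 1)]⟩
  refine ⟨W, fun x => by simpa using hW x, ?_⟩
  have hlim : Tendsto (fun x => R.mulVec (Y x)) atTop (𝓝 (R.mulVec (Pi.single k 1))) := by
    have := ((mulVecCLM R).continuous.tendsto _).comp hYlim
    simpa [Function.comp_def] using this
  have hcol : R.mulVec (Pi.single k 1) = fun i => R i k := by
    rw [Matrix.mulVec_single_one]; rfl
  rw [hcol] at hlim
  refine hlim.congr' ?_
  filter_upwards [eventually_gt_atTop X₀] with x hx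
  ext i
  rw [hWV x hx]
  simp only [V]
  rw [← mul_assoc, mul_comm (NormedSpace.exp (-(x • μ k))), exp_neg_smul_mul, one_mul]

end Lift

namespace Disc

variable {r : ℝ}

theorem isUnit_of_forall_ne_zero {f : Disc r} (h : ∀ z ∈ Metric.closedBall (0 : ℂ) r, eval z f ≠ 0) :
    IsUnit f := by
  classical
  let g : C(Metric.closedBall (0 : ℂ) r, ℂ) :=
    ⟨fun z => (eval z.1 f)⁻¹, by
      refine Continuous.inv₀ ?_ fun z => h z.1 z.2
      exact continuousOn_iff_continuous_domRestrict.1 (continuousOn_eval f)⟩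
  have hg : g ∈ discSubalgebra r := by
    refine ((differentiableOn_eval f).fun_inv
      fun z hz => h z (Metric.ball_subset_closedBall hz)).congr fun z hz => ?_
    rw [dif_pos (Metric.ball_subset_closedBall hz)]
    rfl
  let G : Disc r := (⟨g, hg⟩ : discSubalgebra r)
  refine IsUnit.of_mul_eq_one G (ext fun z hz => ?_)
  rw [eval_mul hz, eval_one hz]
  have : eval z G = (eval z f)⁻¹ := by rw [eval_eq hz]; rfl
  rw [this, mul_inv_cancel₀ (h z hz)]

theorem norm_exp_smul_le {m : Disc r} {η t : ℝ}
    (h : ∀ z ∈ Metric.closedBall (0 : ℂ) r, t * (eval z m).re ≤ -(η / 2) * t) :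
    ‖NormedSpace.exp (t • m)‖ ≤ Real.exp (-(η / 2) * t) := by
  refine norm_le (by positivity) fun z hz => ?_
  rw [eval_exp hz, Complex.norm_exp, Real.exp_le_exp, eval_smul_real]
  simpa using h z hz

end Disc
end
end Korteweg
namespace Korteweg
noncomputable section

/-- The coefficient `α = p'(v̄)` of the linearization, with limit `-c ^ 2` at both ends. -/
structure IsLocalizedCoeff (α : ℝ → ℝ) (c η B : ℝ) : Prop where
  differentiable : Differentiable ℝ α
  continuous_deriv : Continuous (deriv α)
  decay : ∀ x, |α x + c ^ 2| ≤ B * Real.exp (-η * |x|)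
  decay_deriv : ∀ x, |deriv α x| ≤ B * Real.exp (-η * |x|)

namespace IsLocalizedCoeff

variable {α : ℝ → ℝ} {c η B : ℝ}

theorem nonneg (h : IsLocalizedCoeff α c η B) : 0 ≤ B := by
  have := (abs_nonneg _).trans (h.decay 0)
  simpa using this

theorem exp_le_one (hη : 0 < η) (x : ℝ) : Real.exp (-η * |x|) ≤ 1 :=
  Real.exp_le_one_iff.2 (by nlinarith [abs_nonneg x])

theorem bound (h : IsLocalizedCoeff α c η B) (hη : 0 < η) (x : ℝ) : |α x| ≤ c ^ 2 + B := by
  have h1 := (h.decay x).trans (mul_le_of_le_one_right h.nonneg (exp_le_one hη x))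
  rw [abs_le] at h1 ⊢
  constructor <;> nlinarith [sq_nonneg c]

theorem bound_deriv (h : IsLocalizedCoeff α c η B) (hη : 0 < η) (x : ℝ) :
    |deriv α x| ≤ c ^ 2 + B := by
  have h1 := (h.decay_deriv x).trans (mul_le_of_le_one_right h.nonneg (exp_le_one hη x))
  nlinarith [sq_nonneg c]

theorem deriv_comp_neg {α : ℝ → ℝ} (x : ℝ) : deriv (fun y => α (-y)) x = -deriv α (-x) :=
  _root_.deriv_comp_neg α x

theorem comp_neg (h : IsLocalizedCoeff α c η B) : IsLocalizedCoeff (fun x => α (-x)) c η B where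
  differentiable := h.differentiable.comp differentiable_neg
  continuous_deriv := by
    have : deriv (fun y => α (-y)) = fun x => -deriv α (-x) := funext deriv_comp_neg
    rw [this]
    exact (h.continuous_deriv.comp continuous_neg).neg
  decay x := by simpa using h.decay (-x)
  decay_deriv x := by
    rw [deriv_comp_neg]
    simpa using h.decay_deriv (-x)

end IsLocalizedCoeff

theorem evansMatrix_eq_evansGen (α : ℝ → ℝ) (κ s : ℝ) (z : ℂ) (x : ℝ) :
    evansMatrix α κ s z x = evansGen κ s z (α x) (deriv α x) := by
  rw [evansGen_eq]
  ext i j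
  fin_cases i <;> fin_cases j <;> simp [evansMatrix] <;> ring

variable {α : ℝ → ℝ} {κ s c η B : ℝ}

/-- Solutions of the eigenvalue equation are determined by one value. -/
theorem IsLocalizedCoeff.unique (hα : IsLocalizedCoeff α c η B) (hη : 0 < η) {z : ℂ} {x₀ : ℝ}
    {V W : ℝ → Fin 4 → ℂ} (hV : ∀ x, HasDerivAt V ((evansMatrix α κ s z x).mulVec (V x)) x)
    (hW : ∀ x, HasDerivAt W ((evansMatrix α κ s z x).mulVec (W x)) x) (h : V x₀ = W x₀) :
    V = W := by
  have hb := fun x => norm_mulVecCLM_evansGen_le κ s z (hα.bound hη x) (hα.bound_deriv hη x)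
  simp only [← evansMatrix_eq_evansGen] at hb
  exact linear_ode_unique_univ (A := fun x => mulVecCLM (evansMatrix α κ s z x)) hb
    (fun x => by simpa using hV x) (fun x => by simpa using hW x) h

theorem hasDerivAt_sum_smul {ι : Type*} [Fintype ι] {A : ℝ → Matrix (Fin 4) (Fin 4) ℂ}
    {W : ι → ℝ → Fin 4 → ℂ} (hW : ∀ k x, HasDerivAt (W k) ((A x).mulVec (W k x)) x) (a : ι → ℂ)
    (x : ℝ) : HasDerivAt (fun x => ∑ k, a k • W k x) ((A x).mulVec (∑ k, a k • W k x)) x := by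
  refine (HasDerivAt.fun_sum fun k _ => (hW k x).fun_const_smul (a k)).congr_deriv ?_
  rw [Matrix.mulVec_sum]
  exact Finset.sum_congr rfl fun k _ => (Matrix.mulVec_smul _ _ _).symm

section Asymptotics

variable {W : Fin 4 → ℝ → Fin 4 → ℂ} {μ : Fin 4 → ℂ} {R : Matrix (Fin 4) (Fin 4) ℂ}

theorem tendsto_zero_of_asymptotic {V : ℝ → Fin 4 → ℂ} {m : ℂ} {w : Fin 4 → ℂ}
    (hV : Tendsto (fun (x : ℝ) i => Complex.exp (-(x * m)) * V x i) atTop (𝓝 w)) (hm : m.re < 0) :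
    Tendsto V atTop (𝓝 0) := by
  have h1 : Tendsto (fun x : ℝ => Complex.exp (x * m)) atTop (𝓝 0) := by
    rw [tendsto_zero_iff_norm_tendsto_zero]
    simp only [Complex.norm_exp]
    refine Real.tendsto_exp_atBot.comp ?_
    simpa using tendsto_id.atTop_mul_const_of_neg hm
  have h2 := h1.smul hV
  rw [zero_smul] at h2
  refine h2.congr fun x => ?_
  ext i
  simp only [Pi.smul_apply, smul_eq_mul]
  rw [← mul_assoc, ← Complex.exp_add, add_neg_cancel, Complex.exp_zero, one_mul]

theorem coeff_eq_zero_of_dominant (hR : IsUnit R.det)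
    (hW : ∀ k, Tendsto (fun (x : ℝ) i => Complex.exp (-(x * μ k)) * W k x i) atTop (𝓝 fun i => R i k))
    {a : Fin 4 → ℂ} {k : Fin 4} (hk : ∀ j, a j ≠ 0 → (μ j).re ≤ (μ k).re)
    (h : Tendsto (fun x : ℝ => Complex.exp (-(x * μ k)) • ∑ j, a j • W j x) atTop (𝓝 0)) : a k = 0 := by
  have hproj : ∀ v : ℝ → Fin 4 → ℂ, ∀ w, Tendsto v atTop (𝓝 w) →
      Tendsto (fun x => (R⁻¹.mulVec (v x)) k) atTop (𝓝 ((R⁻¹.mulVec w) k)) := by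
    intro v w hv
    have := (((mulVecCLM R⁻¹).continuous.tendsto w).comp hv)
    have h2 := (continuous_apply k).continuousAt.tendsto.comp this
    simpa [Function.comp_def] using h2
  have h1 := hproj _ _ h
  rw [Matrix.mulVec_zero, Pi.zero_apply] at h1
  have hcol : ∀ j, R⁻¹.mulVec (fun i => R i j) k = if k = j then 1 else 0 := by
    intro j
    have := congrFun (congrFun (Matrix.nonsing_inv_mul R hR) k) j
    rw [Matrix.one_apply] at this
    rw [← this]
    rfl
  have h2 : Tendsto (fun x : ℝ => ∑ j, (a j * Complex.exp (x * (μ j - μ k))) *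
      (R⁻¹.mulVec (fun i => Complex.exp (-(x * μ j)) * W j x i)) k) atTop
      (𝓝 (∑ j, if k = j then a j else 0)) := by
    refine tendsto_finsetSum _ fun j _ => ?_
    have h3 := hproj _ _ (hW j)
    rw [hcol] at h3
    by_cases hj : k = j
    · subst hj
      simp only [sub_self, mul_zero, Complex.exp_zero, mul_one, if_true] at h3 ⊢
      simpa using h3.const_mul (a k)
    · simp only [hj, if_false] at h3 ⊢
      by_cases ha : a j = 0
      · simp [ha]
      · rw [tendsto_zero_iff_norm_tendsto_zero] at h3 ⊢
        have h4 := h3.const_mul ‖a j‖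
        rw [mul_zero] at h4
        refine squeeze_zero' (Eventually.of_forall fun _ => norm_nonneg _) ?_ h4
        filter_upwards [eventually_ge_atTop 0] with x hx
        rw [norm_mul, norm_mul, Complex.norm_exp]
        have : Real.exp ((x : ℂ) * (μ j - μ k)).re ≤ 1 := by
          rw [Real.exp_le_one_iff]
          simp only [Complex.mul_re, Complex.ofReal_re, Complex.ofReal_im, zero_mul, sub_zero,
            Complex.sub_re]
          exact mul_nonpos_of_nonneg_of_nonpos hx (by linarith [hk j ha])
        exact mul_le_mul_of_nonneg_right (mul_le_of_le_one_right (norm_nonneg _) this)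
          (norm_nonneg _)
  have h5 : (fun x : ℝ => R⁻¹.mulVec (Complex.exp (-(x * μ k)) • ∑ j, a j • W j x) k) =
      fun x : ℝ => ∑ j, (a j * Complex.exp (x * (μ j - μ k))) *
      (R⁻¹.mulVec (fun i => Complex.exp (-(x * μ j)) * W j x i)) k := by
    ext x
    rw [Matrix.mulVec_smul, Matrix.mulVec_sum, Pi.smul_apply, Finset.sum_apply, smul_eq_mul,
      Finset.mul_sum]
    refine Finset.sum_congr rfl fun j _ => ?_
    have : (fun i => Complex.exp (-(x * μ j)) * W j x i) = Complex.exp (-(x * μ j)) • W j x := rfl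
    rw [this, Matrix.mulVec_smul, Matrix.mulVec_smul, Pi.smul_apply, Pi.smul_apply, smul_eq_mul,
      smul_eq_mul, show -((x : ℂ) * μ k) = x * (μ j - μ k) + -(x * μ j) by ring, Complex.exp_add]
    ring
  rw [h5] at h1
  have := tendsto_nhds_unique h1 h2
  simpa using this.symm

theorem coeff_eq_zero_of_sum_eq_zero (hR : IsUnit R.det)
    (hW : ∀ k, Tendsto (fun (x : ℝ) i => Complex.exp (-(x * μ k)) * W k x i) atTop (𝓝 fun i => R i k))
    {a : Fin 4 → ℂ} (h : ∀ x, ∑ j, a j • W j x = 0) : a = 0 := by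
  by_contra hne
  obtain ⟨j₀, hj₀⟩ := Function.ne_iff.1 hne
  obtain ⟨k, hk, hmax⟩ := Finset.exists_max_image (Finset.univ.filter fun j => a j ≠ 0)
    (fun j => (μ j).re) ⟨j₀, by simpa using hj₀⟩
  simp only [Finset.mem_filter, Finset.mem_univ, true_and] at hk hmax
  exact hk (coeff_eq_zero_of_dominant hR hW hmax (by simp [h]))

theorem re_neg_of_tendsto_zero (hR : IsUnit R.det)
    (hW : ∀ k, Tendsto (fun (x : ℝ) i => Complex.exp (-(x * μ k)) * W k x i) atTop (𝓝 fun i => R i k))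
    {a : Fin 4 → ℂ} (h : Tendsto (fun x => ∑ j, a j • W j x) atTop (𝓝 0)) {j : Fin 4}
    (hj : a j ≠ 0) : (μ j).re < 0 := by
  obtain ⟨k, hk, hmax⟩ := Finset.exists_max_image (Finset.univ.filter fun j => a j ≠ 0)
    (fun j => (μ j).re) ⟨j, by simpa using hj⟩
  simp only [Finset.mem_filter, Finset.mem_univ, true_and] at hk hmax
  refine (hmax j hj).trans_lt ?_
  by_contra hneg
  refine hk (coeff_eq_zero_of_dominant hR hW hmax ?_)
  rw [tendsto_zero_iff_norm_tendsto_zero] at h ⊢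
  refine squeeze_zero' (Eventually.of_forall fun _ => norm_nonneg _) ?_ h
  filter_upwards [eventually_ge_atTop 0] with x hx
  rw [norm_smul, Complex.norm_exp]
  refine mul_le_of_le_one_left (norm_nonneg _) (Real.exp_le_one_iff.2 ?_)
  simp only [Complex.neg_re, Complex.mul_re, Complex.ofReal_re, Complex.ofReal_im, zero_mul,
    sub_zero]
  nlinarith

theorem exists_coeff (hα : IsLocalizedCoeff α c η B) (hη : 0 < η) {z : ℂ} (hR : IsUnit R.det)
    (hWd : ∀ k x, HasDerivAt (W k) ((evansMatrix α κ s z x).mulVec (W k x)) x)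
    (hW : ∀ k, Tendsto (fun (x : ℝ) i => Complex.exp (-(x * μ k)) * W k x i) atTop (𝓝 fun i => R i k))
    {V : ℝ → Fin 4 → ℂ} (hV : ∀ x, HasDerivAt V ((evansMatrix α κ s z x).mulVec (V x)) x) :
    ∃ a : Fin 4 → ℂ, V = fun x => ∑ j, a j • W j x := by
  have hli : LinearIndependent ℂ fun k => W k 0 := by
    rw [Fintype.linearIndependent_iff]
    intro a ha
    have h0 : (fun x => ∑ j, a j • W j x) = 0 := by
      refine hα.unique hη (x₀ := 0) (fun x => hasDerivAt_sum_smul hWd a x) (fun x => ?_) ha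
      rw [Pi.zero_apply, Matrix.mulVec_zero]
      exact hasDerivAt_const x (0 : Fin 4 → ℂ)
    exact congrFun (coeff_eq_zero_of_sum_eq_zero hR hW (congrFun h0))
  have hspan := hli.span_eq_top_of_card_eq_finrank' (by simp)
  have hmem : V 0 ∈ Submodule.span ℂ (Set.range fun k => W k 0) := by rw [hspan]; trivial
  obtain ⟨a, ha⟩ := (Submodule.mem_span_range_iff_exists_fun ℂ).1 hmem
  exact ⟨a, hα.unique hη (x₀ := 0) hV (fun x => hasDerivAt_sum_smul hWd a x) ha.symm⟩

end Asymptotics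

/-- The evaluation at a spectral parameter of a function with values in the disc algebra. -/
def evalFun {r : ℝ} (z : ℂ) (W : ℝ → Fin 4 → Disc r) : ℝ → Fin 4 → ℂ :=
  fun x i => Disc.eval z (W x i)

/-- `W₁, W₂` depend analytically on the spectral parameter and are a basis of the solutions that
decay in the direction `l` when the real part of that parameter is positive; `W₁` decays
exponentially and `W₂` tends to `w` at the origin. -/
structure IsHalfLineBasis (κ s : ℝ) (α : ℝ → ℝ) (r : ℝ) (l : Filter ℝ) (w : Fin 4 → ℂ)
    (W₁ W₂ : ℝ → Fin 4 → Disc r) : Prop where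
  ode₁ : ∀ x, HasDerivAt W₁ ((evansGen κ s Disc.lam (α x) (deriv α x)).mulVec (W₁ x)) x
  ode₂ : ∀ x, HasDerivAt W₂ ((evansGen κ s Disc.lam (α x) (deriv α x)).mulVec (W₂ x)) x
  decay : ∃ C γ : ℝ, 0 < γ ∧ ∀ᶠ x in l, ‖W₁ x‖ ≤ C * Real.exp (-γ * |x|)
  lim : Tendsto (evalFun 0 W₂) l (𝓝 w)
  indep : ∀ z ∈ Metric.closedBall (0 : ℂ) r, 0 < z.re →
    LinearIndependent ℂ ![evalFun z W₁, evalFun z W₂]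
  span : ∀ z ∈ Metric.closedBall (0 : ℂ) r, 0 < z.re →
    Submodule.span ℂ {evalFun z W₁, evalFun z W₂} = decayingSolutions (evansMatrix α κ s z) l
  zero : ∀ V ∈ decayingSolutions (evansMatrix α κ s 0) l, ∃ a : ℂ, V = a • evalFun 0 W₁

theorem hasDerivAt_evalFun {r : ℝ} {z : ℂ} (hz : z ∈ Metric.closedBall (0 : ℂ) r)
    {W : ℝ → Fin 4 → Disc r} {x : ℝ}
    (hW : HasDerivAt W ((evansGen κ s Disc.lam (α x) (deriv α x)).mulVec (W x)) x) :
    HasDerivAt (evalFun z W) ((evansMatrix α κ s z x).mulVec (evalFun z W x)) x := by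
  refine hasDerivAt_pi.2 fun i => ?_
  have h1 := (((Disc.eval z : Disc r →L[ℂ] ℂ).restrictScalars ℝ).hasFDerivAt).comp_hasDerivAt x
    (hasDerivAt_pi.1 hW i)
  refine h1.congr_deriv ?_
  have hmap : ∀ t : ℝ, Disc.eval z (algebraMap ℝ (Disc r) t) = t := fun t => by
    rw [Algebra.algebraMap_eq_smul_one, Disc.eval_smul_real, Disc.eval_one hz, mul_one]
  rw [evansMatrix_eq_evansGen, evansGen_eq, evansGen_eq]
  fin_cases i <;>
    simp [Matrix.mulVec, dotProduct, Fin.sum_univ_four, Disc.eval_mul hz, Disc.eval_lam hz, hmap,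
      evalFun, pow_two]

end
end Korteweg
namespace Korteweg
noncomputable section

theorem IsLocalizedCoeff.mono {α : ℝ → ℝ} {c η η' B : ℝ} (h : IsLocalizedCoeff α c η B)
    (hη : η' ≤ η) : IsLocalizedCoeff α c η' B where
  differentiable := h.differentiable
  continuous_deriv := h.continuous_deriv
  decay x := (h.decay x).trans (mul_le_mul_of_nonneg_left (Real.exp_le_exp.2 (by
    nlinarith [abs_nonneg x])) h.nonneg)
  decay_deriv x := (h.decay_deriv x).trans (mul_le_mul_of_nonneg_left (Real.exp_le_exp.2 (by
    nlinarith [abs_nonneg x])) h.nonneg)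

theorem Disc.eval_algebraMap_real {r : ℝ} {z : ℂ} (hz : z ∈ Metric.closedBall (0 : ℂ) r) (t : ℝ) :
    Disc.eval z (algebraMap ℝ (Disc r) t) = t := by
  rw [Algebra.algebraMap_eq_smul_one, Disc.eval_smul_real, Disc.eval_one hz, mul_one]

theorem Disc.eval_det {r : ℝ} {z : ℂ} (hz : z ∈ Metric.closedBall (0 : ℂ) r)
    (M : Matrix (Fin 4) (Fin 4) (Disc r)) :
    Disc.eval z M.det = (Matrix.of fun i j => Disc.eval z (M i j)).det := by
  rw [Disc.eval_eq hz, AlgHom.map_det]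
  congr 1
  ext i j
  simp [Disc.eval_eq hz]

theorem mem_decayingSolutions {A : ℝ → Matrix (Fin 4) (Fin 4) ℂ} {l : Filter ℝ}
    {W : ℝ → Fin 4 → ℂ} : W ∈ decayingSolutions A l ↔
      (∀ x, HasDerivAt W ((A x).mulVec (W x)) x) ∧ Tendsto W l (𝓝 0) := Iff.rfl

theorem exists_basis_atTop {α : ℝ → ℝ} {κ s c η B : ℝ} (hκ : 0 < κ) (hsc : s ^ 2 < c ^ 2)
    (hc : 0 < c) (hη₀ : 0 < η) (hα₀ : IsLocalizedCoeff α c η B) :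
    ∃ ε > 0, ∀ r, 0 < r → r < ε → ∃ W₁ W₂ : ℝ → Fin 4 → Disc r,
      IsHalfLineBasis κ s α r atTop ![-(c : ℂ), 1, 0, 0] W₁ W₂ := by
  obtain ⟨ν, hν, hν2⟩ : ∃ ν : ℝ, 0 < ν ∧ κ * ν ^ 2 = c ^ 2 - s ^ 2 := by
    have : 0 < (c ^ 2 - s ^ 2) / κ := div_pos (by linarith) hκ
    exact ⟨√((c ^ 2 - s ^ 2) / κ), Real.sqrt_pos.2 this, by
      rw [Real.sq_sqrt this.le]; field_simp⟩
  wlog hην : η ≤ ν generalizing η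
  · exact this (η := min η ν) (lt_min hη₀ hν) (hα₀.mono (min_le_left _ _)) (min_le_right _ _)
  obtain ⟨σ, μ, hμ0, hσ0, hσ, hμ, hev⟩ := exists_branches hκ hsc hc hν hν2
  have hdiff : ∀ᶠ z in 𝓝 (0 : ℂ), ∀ j, DifferentiableAt ℂ (σ j) z ∧ DifferentiableAt ℂ (μ j) z :=
    eventually_all.2 fun j => by
      filter_upwards [(hσ j).eventually_analyticAt, (hμ j).eventually_analyticAt] with z h1 h2
        using ⟨h1.differentiableAt, h2.differentiableAt⟩
  have hre : ∀ᶠ z in 𝓝 (0 : ℂ), ∀ j, |(μ j z).re - ![-ν, 0, 0, ν] j| ≤ η / 4 :=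
    eventually_all.2 fun j => by
      have h1 := (Complex.continuous_re.continuousAt.comp (hμ j).continuousAt).tendsto
      simp only [Function.comp_apply, hμ0, Complex.ofReal_re] at h1
      have h2 : Tendsto (fun z => |(μ j z).re - ![-ν, 0, 0, ν] j|) (𝓝 0) (𝓝 0) := by
        simpa [Function.comp_def] using (h1.sub_const (![-ν, 0, 0, ν] j)).abs
      exact h2.eventually_le_const (by positivity)
  obtain ⟨ε, hε, hball⟩ := Metric.eventually_nhds_iff_ball.1 (hev.and (hdiff.and hre))
  refine ⟨ε, hε, fun r hr hrε => ?_⟩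
  have hall : ∀ z ∈ Metric.closedBall (0 : ℂ) r, _ := fun z hz =>
    hball z (Metric.closedBall_subset_ball hrε hz)
  clear hball hev hdiff hre
  let σE : Fin 4 → Disc r := fun j => Disc.ofFun (σ j) fun z hz => ((hall z hz).2.1 j).1
  let μE : Fin 4 → Disc r := fun j => Disc.ofFun (μ j) fun z hz => ((hall z hz).2.1 j).2
  have eσ : ∀ j, ∀ z ∈ Metric.closedBall (0 : ℂ) r, Disc.eval z (σE j) = σ j z := fun j z hz =>
    Disc.eval_ofFun _ hz
  have eμ : ∀ j, ∀ z ∈ Metric.closedBall (0 : ℂ) r, Disc.eval z (μE j) = μ j z := fun j z hz =>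
    Disc.eval_ofFun _ hz
  have h1 : ∀ j, σE j * μE j = Disc.lam := fun j => Disc.ext fun z hz => by
    rw [Disc.eval_mul hz, eσ j z hz, eμ j z hz, Disc.eval_lam hz, ((hall z hz).1.1 j).1]
  have h2 : ∀ j, algebraMap ℝ (Disc r) κ * μE j ^ 2 + (σE j - algebraMap ℝ (Disc r) s) ^ 2 =
      algebraMap ℝ (Disc r) c ^ 2 := fun j => Disc.ext fun z hz => by
    simp only [pow_two, map_add, map_sub, Disc.eval_mul hz, eσ j z hz, eμ j z hz,
      Disc.eval_algebraMap_real hz]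
    have := ((hall z hz).1.1 j).2
    simpa only [pow_two] using this
  have heig : ∀ z ∈ Metric.closedBall (0 : ℂ) r, (Matrix.of fun i j => Disc.eval z
      (eigenMatrix (algebraMap ℝ (Disc r) s) σE μE i j)) =
      eigenMatrix (s : ℂ) (fun j => σ j z) (fun j => μ j z) := fun z hz => by
    ext i j
    fin_cases i <;> simp [eigenMatrix, pow_two, Disc.eval_mul hz, Disc.eval_one hz, eσ j z hz,
      eμ j z hz, Disc.eval_algebraMap_real hz]
  have hdet : IsUnit (eigenMatrix (algebraMap ℝ (Disc r) s) σE μE).det :=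
    Disc.isUnit_of_forall_ne_zero fun z hz => by
      rw [Disc.eval_det hz, heig z hz]
      exact (hall z hz).1.2.1
  have hspec : ∀ j k,
      (∀ t : ℝ, 0 ≤ t → ‖NormedSpace.exp (t • (μE j - μE k))‖ ≤ Real.exp (-(η / 2) * t)) ∨
      (∀ t : ℝ, t ≤ 0 → ‖NormedSpace.exp (t • (μE j - μE k))‖ ≤ Real.exp (-(η / 2) * t)) := by
    intro j k
    have hgap : ![-ν, 0, 0, ν] j - ![-ν, 0, 0, ν] k ≤ -ν ∨
        0 ≤ ![-ν, 0, 0, ν] j - ![-ν, 0, 0, ν] k := by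
      fin_cases j <;> fin_cases k <;> simp <;> first | (left; linarith) | (right; linarith)
    have hdiff : ∀ z ∈ Metric.closedBall (0 : ℂ) r, |(Disc.eval z (μE j - μE k)).re -
        (![-ν, 0, 0, ν] j - ![-ν, 0, 0, ν] k)| ≤ η / 2 := fun z hz => by
      have a1 := (abs_le.1 ((hall z hz).2.2 j))
      have a2 := (abs_le.1 ((hall z hz).2.2 k))
      rw [map_sub, eμ j z hz, eμ k z hz, Complex.sub_re, abs_le]
      constructor <;> linarith [a1.1, a1.2, a2.1, a2.2]
    rcases hgap with hgap | hgap
    · left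
      intro t ht
      refine Disc.norm_exp_smul_le fun z hz => ?_
      have := (abs_le.1 (hdiff z hz)).2
      nlinarith
    · right
      intro t ht
      refine Disc.norm_exp_smul_le fun z hz => ?_
      have := (abs_le.1 (hdiff z hz)).1
      nlinarith
  choose W hWd hW using exists_halfLine_basis hκ.ne' hη₀ hα₀.differentiable.continuous
    hα₀.continuous_deriv (hα₀.bound hη₀) (hα₀.bound_deriv hη₀)
    (fun x hx => by simpa [abs_of_nonneg hx] using hα₀.decay x)
    (fun x hx => by simpa [abs_of_nonneg hx] using hα₀.decay_deriv x) h1 h2 hdet hspec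
  have hWz : ∀ z ∈ Metric.closedBall (0 : ℂ) r, ∀ k x,
      HasDerivAt (evalFun z (W k)) ((evansMatrix α κ s z x).mulVec (evalFun z (W k) x)) x :=
    fun z hz k x => hasDerivAt_evalFun hz (hWd k x)
  have hlim : ∀ z ∈ Metric.closedBall (0 : ℂ) r, ∀ k,
      Tendsto (fun (x : ℝ) i => Complex.exp (-(x * μ k z)) * evalFun z (W k) x i) atTop
        (𝓝 fun i => eigenMatrix (s : ℂ) (fun j => σ j z) (fun j => μ j z) i k) := by
    intro z hz k
    refine tendsto_pi_nhds.2 fun i => ?_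
    have h3 := ((Disc.eval z : Disc r →L[ℂ] ℂ).continuous.tendsto _).comp
      (tendsto_pi_nhds.1 (hW k) i)
    have h4 := congrFun (congrFun (heig z hz) i) k
    rw [Matrix.of_apply] at h4
    rw [h4] at h3
    refine h3.congr fun x => ?_
    simp only [Function.comp_apply]
    rw [Disc.eval_mul hz, Disc.eval_exp hz, map_neg, Disc.eval_smul_real, eμ k z hz]
    rfl
  have hR : ∀ z ∈ Metric.closedBall (0 : ℂ) r,
      IsUnit (eigenMatrix (s : ℂ) (fun j => σ j z) (fun j => μ j z)).det := fun z hz =>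
    isUnit_iff_ne_zero.2 (hall z hz).1.2.1
  have h0 : (0 : ℂ) ∈ Metric.closedBall (0 : ℂ) r := by simpa using hr.le
  refine ⟨W 0, W 1, hWd 0, hWd 1, ?_, ?_, fun z hz hzr => ?_, fun z hz hzr => ?_, fun V hV => ?_⟩
  · have hb := (hW 0).norm.eventually_le_const (lt_add_one _)
    set K := ‖fun i => eigenMatrix (algebraMap ℝ (Disc r) s) σE μE i 0‖ + 1 with hK
    have hK0 : 0 ≤ K := by positivity
    refine ⟨K, ν / 2, by positivity, ?_⟩
    filter_upwards [hb, eventually_ge_atTop 0] with x hx hx0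
    refine (pi_norm_le_iff_of_nonneg (by positivity)).2 fun i => ?_
    have e1 : W 0 x i = NormedSpace.exp (x • μE 0) * (NormedSpace.exp (-(x • μE 0)) * W 0 x i) := by
      rw [← mul_assoc, exp_neg_smul_mul, one_mul]
    rw [e1]
    refine (norm_mul_le _ _).trans ?_
    rw [mul_comm]
    gcongr
    · exact (norm_le_pi_norm (fun i => NormedSpace.exp (-(x • μE 0)) * W 0 x i) i).trans hx
    · rw [abs_of_nonneg hx0]
      refine Disc.norm_exp_smul_le fun z hz => ?_
      have := (abs_le.1 ((hall z hz).2.2 0)).2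
      simp at this
      rw [eμ 0 z hz]
      nlinarith
  · have := hlim 0 h0 1
    simp only [hμ0, hσ0] at this
    convert this using 1
    · ext x i; simp
    · congr 1; ext i; fin_cases i <;> simp [eigenMatrix]
  · rw [LinearIndependent.pair_iff]
    intro a b hab
    have := coeff_eq_zero_of_sum_eq_zero (hR z hz) (hlim z hz) (a := ![a, b, 0, 0]) (fun x => by
      have := congrFun hab x
      simpa [Fin.sum_univ_four] using this)
    exact ⟨by simpa using congrFun this 0, by simpa using congrFun this 1⟩
  · obtain ⟨g0, g1, g2, g3⟩ := (hall z hz).1.2.2 hzr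
    refine le_antisymm ?_ fun V hV => ?_
    · rw [Submodule.span_le]
      rintro f (rfl | rfl)
      · exact ⟨hWz z hz 0, tendsto_zero_of_asymptotic (hlim z hz 0) g0⟩
      · exact ⟨hWz z hz 1, tendsto_zero_of_asymptotic (hlim z hz 1) g1⟩
    · obtain ⟨hVd, hVl⟩ := mem_decayingSolutions.1 hV
      obtain ⟨a, rfl⟩ := exists_coeff hα₀ hη₀ (hR z hz) (hWz z hz) (hlim z hz) hVd
      have a2 : a 2 = 0 := by
        by_contra h
        exact absurd (re_neg_of_tendsto_zero (hR z hz) (hlim z hz) hVl h) (not_lt.2 g2.le)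
      have a3 : a 3 = 0 := by
        by_contra h
        exact absurd (re_neg_of_tendsto_zero (hR z hz) (hlim z hz) hVl h) (not_lt.2 g3.le)
      refine Submodule.mem_span_pair.2 ⟨a 0, a 1, ?_⟩
      ext x i
      simp [Fin.sum_univ_four, a2, a3]
  · obtain ⟨hVd, hVl⟩ := mem_decayingSolutions.1 hV
    obtain ⟨a, rfl⟩ := exists_coeff hα₀ hη₀ (hR 0 h0) (hWz 0 h0) (hlim 0 h0) hVd
    have hz : ∀ j, 0 ≤ ![-ν, 0, 0, ν] j → a j = 0 := by
      intro j hj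
      by_contra h
      have := re_neg_of_tendsto_zero (hR 0 h0) (hlim 0 h0) hVl h
      rw [hμ0, Complex.ofReal_re] at this
      exact absurd this (not_lt.2 hj)
    refine ⟨a 0, ?_⟩
    ext x i
    have a1 := hz 1 (by simp)
    have a2 := hz 2 (by simp)
    have a3 := hz 3 (by simpa using hν.le)
    simp [Fin.sum_univ_four, a1, a2, a3]

end
end Korteweg
namespace Korteweg
noncomputable section

/-- The action of the reflection `x ↦ -x` on the phase variables. -/
def reflect {M : Type*} [AddCommGroup M] (W : ℝ → Fin 4 → M) : ℝ → Fin 4 → M :=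
  fun x => ![-W (-x) 0, W (-x) 1, -W (-x) 2, W (-x) 3]

theorem reflect_reflect {M : Type*} [AddCommGroup M] (W : ℝ → Fin 4 → M) :
    reflect (reflect W) = W := by
  ext x i
  fin_cases i <;> simp [reflect]

/-- `reflect` as a linear equivalence. -/
def reflectEquiv : (ℝ → Fin 4 → ℂ) ≃ₗ[ℂ] (ℝ → Fin 4 → ℂ) where
  toFun := reflect
  invFun := reflect
  left_inv := reflect_reflect
  right_inv := reflect_reflect
  map_add' V W := by
    ext x i
    fin_cases i <;> simp [reflect] <;> ring
  map_smul' a V := by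
    ext x i
    fin_cases i <;> simp [reflect]

theorem reflectEquiv_apply (W : ℝ → Fin 4 → ℂ) : reflectEquiv W = reflect W := rfl

theorem evalFun_reflect {r : ℝ} (z : ℂ) (W : ℝ → Fin 4 → Disc r) :
    evalFun z (reflect W) = reflect (evalFun z W) := by
  ext x i
  fin_cases i <;> simp [reflect, evalFun]

theorem hasDerivAt_reflect {E : Type*} [NormedCommRing E] [NormedAlgebra ℝ E] {κ s a a' : ℝ}
    {lam : E} {W : ℝ → Fin 4 → E} {x : ℝ}
    (hW : HasDerivAt W ((evansGen κ (-s) lam a (-a')).mulVec (W (-x))) (-x)) :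
    HasDerivAt (reflect W) ((evansGen κ s lam a a').mulVec (reflect W x)) x := by
  have h : ∀ i, HasDerivAt (fun y => W (-y) i)
      (-((evansGen κ (-s) lam a (-a')).mulVec (W (-x)) i)) x := fun i => by
    have := (hasDerivAt_pi.1 hW i).scomp x (hasDerivAt_neg x)
    simpa [Function.comp_def] using this
  refine hasDerivAt_pi.2 fun i => ?_
  rw [evansGen_eq] at *
  fin_cases i
  · refine (h 0).neg.congr_deriv ?_
    simp [Matrix.mulVec, dotProduct, Fin.sum_univ_four, reflect]
  · refine (h 1).congr_deriv ?_
    simp [Matrix.mulVec, dotProduct, Fin.sum_univ_four, reflect]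
  · refine (h 2).neg.congr_deriv ?_
    simp [Matrix.mulVec, dotProduct, Fin.sum_univ_four, reflect]
  · refine (h 3).congr_deriv ?_
    simp [Matrix.mulVec, dotProduct, Fin.sum_univ_four, reflect]
    ring

theorem tendsto_reflect {l l' : Filter ℝ} (hl : Tendsto (fun x : ℝ => -x) l' l)
    {V : ℝ → Fin 4 → ℂ} {w : Fin 4 → ℂ} (hV : Tendsto V l (𝓝 w)) :
    Tendsto (reflect V) l' (𝓝 ![-w 0, w 1, -w 2, w 3]) := by
  have h := fun i => (tendsto_pi_nhds.1 (hV.comp hl) i)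
  refine tendsto_pi_nhds.2 fun i => ?_
  fin_cases i
  · exact (h 0).neg
  · exact h 1
  · exact (h 2).neg
  · exact h 3

variable {α : ℝ → ℝ} {κ s r : ℝ}

theorem reflect_mem_decayingSolutions {l l' : Filter ℝ} (hl : Tendsto (fun x : ℝ => -x) l' l)
    {z : ℂ} {V : ℝ → Fin 4 → ℂ}
    (hV : V ∈ decayingSolutions (evansMatrix (fun x => α (-x)) κ (-s) z) l) :
    reflect V ∈ decayingSolutions (evansMatrix α κ s z) l' := by
  obtain ⟨h1, h2⟩ := mem_decayingSolutions.1 hV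
  refine mem_decayingSolutions.2 ⟨fun x => ?_, ?_⟩
  · rw [evansMatrix_eq_evansGen]
    refine hasDerivAt_reflect ?_
    have := h1 (-x)
    rwa [evansMatrix_eq_evansGen, deriv_comp_neg α, neg_neg] at this
  · have := tendsto_reflect hl h2
    convert this using 2
    ext i
    fin_cases i <;> simp

theorem decayingSolutions_reflect (α : ℝ → ℝ) (κ s : ℝ) (z : ℂ) :
    decayingSolutions (evansMatrix α κ s z) atBot =
      (decayingSolutions (evansMatrix (fun x => α (-x)) κ (-s) z) atTop).map
        reflectEquiv.toLinearMap := by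
  ext V
  constructor
  · intro hV
    refine ⟨reflect V, ?_, reflect_reflect V⟩
    refine reflect_mem_decayingSolutions (l := atBot) tendsto_neg_atTop_atBot ?_
    simpa using hV
  · rintro ⟨V, hV, rfl⟩
    exact reflect_mem_decayingSolutions tendsto_neg_atBot_atTop hV

theorem IsHalfLineBasis.reflect {w : Fin 4 → ℂ} {W₁ W₂ : ℝ → Fin 4 → Disc r}
    (h : IsHalfLineBasis κ (-s) (fun x => α (-x)) r atTop w W₁ W₂) :
    IsHalfLineBasis κ s α r atBot ![-w 0, w 1, -w 2, w 3] (reflect W₁) (reflect W₂) where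
  ode₁ x := hasDerivAt_reflect (by
    have := h.ode₁ (-x)
    rwa [deriv_comp_neg α, neg_neg] at this)
  ode₂ x := hasDerivAt_reflect (by
    have := h.ode₂ (-x)
    rwa [deriv_comp_neg α, neg_neg] at this)
  decay := by
    obtain ⟨C, γ, hγ, hd⟩ := h.decay
    refine ⟨C, γ, hγ, ?_⟩
    filter_upwards [tendsto_neg_atBot_atTop.eventually hd] with x hx
    rw [abs_neg] at hx
    refine ((pi_norm_le_iff_of_nonneg (norm_nonneg _)).2 fun i => ?_).trans hx
    fin_cases i
    · simpa [Korteweg.reflect] using norm_le_pi_norm (W₁ (-x)) 0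
    · simpa [Korteweg.reflect] using norm_le_pi_norm (W₁ (-x)) 1
    · simpa [Korteweg.reflect] using norm_le_pi_norm (W₁ (-x)) 2
    · simpa [Korteweg.reflect] using norm_le_pi_norm (W₁ (-x)) 3
  lim := by
    rw [evalFun_reflect]
    exact tendsto_reflect tendsto_neg_atBot_atTop h.lim
  indep z hz hzr := by
    have := (h.indep z hz hzr).map' reflectEquiv.toLinearMap reflectEquiv.ker
    have e : reflectEquiv.toLinearMap ∘ ![evalFun z W₁, evalFun z W₂] =
        ![evalFun z (Korteweg.reflect W₁), evalFun z (Korteweg.reflect W₂)] := by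
      ext i : 1
      fin_cases i <;> simp [evalFun_reflect, reflectEquiv_apply]
    rwa [e] at this
  span z hz hzr := by
    rw [decayingSolutions_reflect, ← h.span z hz hzr, Submodule.map_span, Set.image_pair,
      evalFun_reflect, evalFun_reflect]
    rfl
  zero V hV := by
    rw [decayingSolutions_reflect] at hV
    obtain ⟨V', hV', rfl⟩ := hV
    obtain ⟨a, rfl⟩ := h.zero V' hV'
    refine ⟨a, ?_⟩
    rw [evalFun_reflect]
    exact map_smul reflectEquiv a _

theorem evalFun_smul (z a : ℂ) (W : ℝ → Fin 4 → Disc r) :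
    evalFun z (a • W) = a • evalFun z W := by
  ext x i
  simp [evalFun]

theorem IsHalfLineBasis.smul {l : Filter ℝ} {w : Fin 4 → ℂ} {W₁ W₂ : ℝ → Fin 4 → Disc r}
    (h : IsHalfLineBasis κ s α r l w W₁ W₂) {a b : ℂ} (ha : a ≠ 0) (hb : b ≠ 0) :
    IsHalfLineBasis κ s α r l (b • w) (a • W₁) (b • W₂) where
  ode₁ x := ((h.ode₁ x).const_smul a).congr_deriv (by
    rw [Pi.smul_apply, Matrix.mulVec_smul])
  ode₂ x := ((h.ode₂ x).const_smul b).congr_deriv (by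
    rw [Pi.smul_apply, Matrix.mulVec_smul])
  decay := by
    obtain ⟨C, γ, hγ, hd⟩ := h.decay
    refine ⟨‖a‖ * C, γ, hγ, ?_⟩
    filter_upwards [hd] with x hx
    rw [Pi.smul_apply, norm_smul, mul_assoc]
    gcongr
  lim := by
    rw [evalFun_smul]
    exact h.lim.const_smul b
  indep z hz hzr := by
    have := h.indep z hz hzr
    rw [LinearIndependent.pair_iff] at this ⊢
    intro x y hxy
    rw [evalFun_smul, evalFun_smul, smul_smul, smul_smul] at hxy
    obtain ⟨h1, h2⟩ := this _ _ hxy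
    exact ⟨(mul_eq_zero.1 h1).resolve_right ha, (mul_eq_zero.1 h2).resolve_right hb⟩
  span z hz hzr := by
    rw [← h.span z hz hzr, evalFun_smul, evalFun_smul]
    refine le_antisymm (Submodule.span_le.2 ?_) (Submodule.span_le.2 ?_)
    · rintro f (rfl | rfl)
      · exact Submodule.smul_mem _ _ (Submodule.subset_span (by simp))
      · exact Submodule.smul_mem _ _ (Submodule.subset_span (by simp))
    · rintro f (rfl | rfl)
      · exact Submodule.mem_span_pair.2 ⟨a⁻¹, 0, by simp [smul_smul, ha]⟩
      · exact Submodule.mem_span_pair.2 ⟨0, b⁻¹, by simp [smul_smul, hb]⟩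
  zero V hV := by
    obtain ⟨t, rfl⟩ := h.zero V hV
    exact ⟨t * a⁻¹, by rw [evalFun_smul, smul_smul, mul_assoc, inv_mul_cancel₀ ha, mul_one]⟩

/-- Normalized analytic bases exist on both half lines. -/
theorem exists_bases {c η B : ℝ} (hκ : 0 < κ) (hsc : s ^ 2 < c ^ 2) (hc : 0 < c)
    (hη : 0 < η) (hα : IsLocalizedCoeff α c η B) {a b : ℂ} (ha : a ≠ 0) (hb : b ≠ 0)
    {V : ℝ → Fin 4 → ℂ} (hV : ∀ x, HasDerivAt V ((evansMatrix α κ s 0 x).mulVec (V x)) x)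
    (hV₀ : V ≠ 0) (hVt : Tendsto V atTop (𝓝 0)) (hVb : Tendsto V atBot (𝓝 0)) :
    ∃ r > 0, ∃ W₁ W₂ W₃ W₄ : ℝ → Fin 4 → Disc r,
      IsHalfLineBasis κ s α r atTop (a • ![(c : ℂ), -1, 0, 0]) W₁ W₂ ∧
      IsHalfLineBasis κ s α r atBot (b • ![(c : ℂ), 1, 0, 0]) W₄ W₃ ∧
      evalFun 0 W₁ = V ∧ evalFun 0 W₄ = V := by
  obtain ⟨ε₁, hε₁, h₁⟩ := exists_basis_atTop hκ hsc hc hη hα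
  obtain ⟨ε₂, hε₂, h₂⟩ := exists_basis_atTop (s := -s) hκ (by simpa using hsc) hc hη hα.comp_neg
  have hr : 0 < min ε₁ ε₂ / 2 := by positivity
  set r := min ε₁ ε₂ / 2 with hrdef
  obtain ⟨W₁, W₂, hW⟩ := h₁ r hr (by linarith [min_le_left ε₁ ε₂, lt_min hε₁ hε₂])
  obtain ⟨W₄, W₃, hW'⟩ := h₂ r hr (by linarith [min_le_right ε₁ ε₂, lt_min hε₁ hε₂])
  have hW'' := hW'.reflect
  obtain ⟨t, ht⟩ := hW.zero V ⟨hV, hVt⟩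
  obtain ⟨t', ht'⟩ := hW''.zero V ⟨hV, hVb⟩
  have ht0 : t ≠ 0 := by rintro rfl; exact hV₀ (by simpa using ht)
  have ht'0 : t' ≠ 0 := by rintro rfl; exact hV₀ (by simpa using ht')
  refine ⟨r, hr, t • W₁, (-a) • W₂, b • reflect W₃, t' • reflect W₄, ?_, ?_, ?_, ?_⟩
  · have := hW.smul ht0 (neg_ne_zero.2 ha)
    convert this using 1
    ext i; fin_cases i <;> simp
  · have := hW''.smul ht'0 hb
    convert this using 1
    ext i; fin_cases i <;> simp
  · rw [evalFun_smul, ht]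
  · rw [evalFun_smul, ht']

end
end Korteweg
namespace Korteweg
noncomputable section

section Calculus

/-- A function with a limit whose second derivative has a limit has derivatives tending to zero. -/
theorem tendsto_deriv_of_tendsto {v v' v'' : ℝ → ℝ} {a b : ℝ} (h1 : ∀ x, HasDerivAt v (v' x) x)
    (h2 : ∀ x, HasDerivAt v' (v'' x) x) (ha : Tendsto v atTop (𝓝 a))
    (hb : Tendsto v'' atTop (𝓝 b)) : b = 0 ∧ Tendsto v' atTop (𝓝 0) := by
  have mvt1 : ∀ x, ∃ y ∈ Set.Ioo x (x + 1), v' y = v (x + 1) - v x := fun x => by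
    obtain ⟨y, hy, h⟩ := exists_hasDerivAt_eq_slope v v' (lt_add_one x)
      (fun y _ => (h1 y).continuousAt.continuousWithinAt) (fun y _ => h1 y)
    exact ⟨y, hy, by rw [h]; simp⟩
  choose y hy hv'y using mvt1
  have hlim : Tendsto (fun x => v' (y x)) atTop (𝓝 0) := by
    simp only [hv'y]
    simpa using (ha.comp (tendsto_atTop_add_const_right _ 1 tendsto_id)).sub ha
  have mvt2 : ∀ x, ∃ z, x ≤ z ∧ v' (y (x + 2)) - v' (y x) = v'' z * (y (x + 2) - y x) := fun x => by
    have hlt : y x < y (x + 2) := by linarith [(hy x).2, (hy (x + 2)).1]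
    obtain ⟨z, hz, h⟩ := exists_hasDerivAt_eq_slope v' v'' hlt
      (fun y _ => (h2 y).continuousAt.continuousWithinAt) (fun y _ => h2 y)
    refine ⟨z, by linarith [hz.1, (hy x).1], ?_⟩
    rw [h, div_mul_cancel₀]
    linarith
  choose z hz hv''z using mvt2
  have hzt : Tendsto z atTop atTop := tendsto_atTop_mono hz tendsto_id
  have hb0 : b = 0 := by
    have h3 : Tendsto (fun x => v' (y (x + 2)) - v' (y x)) atTop (𝓝 0) := by
      simpa using (hlim.comp (tendsto_atTop_add_const_right _ 2 tendsto_id)).sub hlim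
    have h4 : Tendsto (fun x => v'' (z x)) atTop (𝓝 0) := by
      refine squeeze_zero_norm (fun x => ?_) (by simpa using h3.norm)
      rw [hv''z, Real.norm_eq_abs, abs_mul]
      refine le_mul_of_one_le_right (abs_nonneg _) ?_
      exact le_trans (by linarith [(hy x).2, (hy (x + 2)).1]) (le_abs_self _)
    exact tendsto_nhds_unique (hb.comp hzt) h4
  refine ⟨hb0, ?_⟩
  subst hb0
  have mvt3 : ∀ x, ∃ t, x ≤ t ∧ v' x = v' (y x) - v'' t * (y x - x) := fun x => by
    have hlt := (hy x).1
    obtain ⟨t, ht, h⟩ := exists_hasDerivAt_eq_slope v' v'' hlt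
      (fun y _ => (h2 y).continuousAt.continuousWithinAt) (fun y _ => h2 y)
    refine ⟨t, ht.1.le, ?_⟩
    rw [h, div_mul_cancel₀]
    · ring
    · linarith
  choose t ht hv't using mvt3
  have h5 : Tendsto (fun x => v'' (t x) * (y x - x)) atTop (𝓝 0) := by
    refine squeeze_zero_norm (fun x => ?_)
      (by simpa using (hb.comp (tendsto_atTop_mono ht tendsto_id)).norm)
    rw [norm_mul]
    refine mul_le_of_le_one_right (norm_nonneg _) ?_
    rw [Real.norm_eq_abs, abs_le]
    constructor <;> linarith [(hy x).1, (hy x).2]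
  have h6 := hlim.sub h5
  rw [sub_zero] at h6
  exact h6.congr fun x => (hv't x).symm

/-- Trajectories of a `C¹` vector field are determined by one point. -/
theorem autonomous_unique {F : Type*} [NormedAddCommGroup F] [NormedSpace ℝ F] {X : F → F}
    {f g : ℝ → F} (hX : ∀ t, ContDiffAt ℝ 1 X (f t)) (hf : ∀ t, HasDerivAt f (X (f t)) t)
    (hg : ∀ t, HasDerivAt g (X (g t)) t) {t₀ : ℝ} (h : f t₀ = g t₀) : f = g := by
  have hfc : Continuous f := continuous_iff_continuousAt.2 fun t => (hf t).continuousAt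
  have hgc : Continuous g := continuous_iff_continuousAt.2 fun t => (hg t).continuousAt
  have hclopen : IsClopen {t | f t = g t} := by
    refine ⟨isClosed_eq hfc hgc, isOpen_iff_mem_nhds.2 fun t (ht : f t = g t) => ?_⟩
    obtain ⟨K, S, hS, hL⟩ := (hX t).exists_lipschitzOnWith
    have h1 : ∀ᶠ x in 𝓝 t, f x ∈ S := hfc.continuousAt.eventually hS
    have h2 : ∀ᶠ x in 𝓝 t, g x ∈ S := hgc.continuousAt.eventually (ht ▸ hS)
    exact ODE_solution_unique_of_eventually (v := fun _ => X) (s := fun _ => S) (K := K)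
      (Eventually.of_forall fun _ => hL) (h1.mono fun x hx => ⟨hf x, hx⟩)
      (h2.mono fun x hx => ⟨hg x, hx⟩) ht
  have := hclopen.eq_univ ⟨t₀, h⟩
  exact funext fun t => by
    have : t ∈ {t | f t = g t} := by rw [this]; trivial
    exact this

theorem exists_bound_of_eventually {g : ℝ → ℝ} (hg : Continuous g) {C C' : ℝ}
    (h1 : ∀ᶠ x in atTop, |g x| ≤ C) (h2 : ∀ᶠ x in atBot, |g x| ≤ C') : ∃ B, ∀ x, |g x| ≤ B := by
  obtain ⟨X, hX⟩ := eventually_atTop.1 h1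
  obtain ⟨Y, hY⟩ := eventually_atBot.1 h2
  obtain ⟨D, hD⟩ := (isCompact_Icc (a := Y) (b := X)).exists_bound_of_continuousOn hg.continuousOn
  refine ⟨max (max C C') D, fun x => ?_⟩
  rcases le_total X x with h | h
  · exact (hX x h).trans ((le_max_left _ _).trans (le_max_left _ _))
  rcases le_total x Y with h' | h'
  · exact (hY x h').trans ((le_max_right _ _).trans (le_max_left _ _))
  · exact (hD x ⟨h', h⟩).trans (le_max_right _ _)

end Calculus

/-- Minus the force in the equation `κ v'' = -force` of the profile. -/
def force (p : ℝ → ℝ) (vinf s v : ℝ) : ℝ := p v - p vinf + s ^ 2 * (v - vinf)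

/-- The primitive of `force` that vanishes at the endstate. -/
def potential (p : ℝ → ℝ) (vinf s v : ℝ) : ℝ :=
  (∫ z in vinf..v, (p z - p vinf)) + s ^ 2 / 2 * (v - vinf) ^ 2

@[simp] theorem force_self (p : ℝ → ℝ) (vinf s : ℝ) : force p vinf s vinf = 0 := by simp [force]

@[simp] theorem potential_self (p : ℝ → ℝ) (vinf s : ℝ) : potential p vinf s vinf = 0 := by
  simp [potential]

section Potential

variable {p : ℝ → ℝ} {I : Set ℝ} {vinf s v : ℝ}

theorem hasDerivAt_primitive (hI : IsOpen I) (hp : ContinuousOn p I) (hv : Set.uIcc vinf v ⊆ I) :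
    HasDerivAt (fun v => ∫ z in vinf..v, (p z - p vinf)) (p v - p vinf) v := by
  have hc : ContinuousOn (fun z => p z - p vinf) I := hp.sub continuousOn_const
  have hvI : v ∈ I := hv Set.right_mem_uIcc
  exact intervalIntegral.integral_hasDerivAt_right (hc.mono hv).intervalIntegrable
    (hc.stronglyMeasurableAtFilter hI v hvI) (hc.continuousAt (hI.mem_nhds hvI))

theorem hasDerivAt_potential (hI : IsOpen I) (hp : ContinuousOn p I) (hv : Set.uIcc vinf v ⊆ I) :
    HasDerivAt (potential p vinf s) (force p vinf s v) v := by
  have h2 : HasDerivAt (fun v => s ^ 2 / 2 * (v - vinf) ^ 2) (s ^ 2 * (v - vinf)) v := by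
    refine ((((hasDerivAt_id v).sub_const vinf).pow 2).const_mul (s ^ 2 / 2)).congr_deriv ?_
    simp; ring
  exact (hasDerivAt_primitive hI hp hv).add h2

/-- Near the endstate, the primitive of the pressure is quadratic to leading order. -/
theorem exists_potential_bound (hI : IsOpen I) (hp : ContinuousOn p I) (hvinf : vinf ∈ I)
    (hd : DifferentiableAt ℝ p vinf) {δ : ℝ} (hδ : 0 < δ) :
    ∃ ε > 0, (∀ v, |v - vinf| ≤ ε → v ∈ I) ∧
      ∀ v, |v - vinf| ≤ ε →
        |(∫ z in vinf..v, (p z - p vinf)) - deriv p vinf / 2 * (v - vinf) ^ 2| ≤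
          δ * (v - vinf) ^ 2 := by
  have h1 := hd.hasDerivAt.isLittleO.def hδ
  obtain ⟨ε, hε, h⟩ := Metric.eventually_nhds_iff_ball.1 (h1.and (hI.mem_nhds hvinf))
  have hmem : ∀ v, |v - vinf| ≤ ε / 2 → v ∈ Metric.ball vinf ε := fun v hv => by
    rw [Metric.mem_ball, Real.dist_eq]; linarith
  refine ⟨ε / 2, by positivity, fun v hv => (h v (hmem v hv)).2, fun v hv => ?_⟩
  have hball : ∀ z ∈ Set.uIcc vinf v, |z - vinf| ≤ |v - vinf| := fun z hz =>
    Set.abs_sub_left_of_mem_uIcc hz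
  have hI' : Set.uIcc vinf v ⊆ I := fun z hz => (h z (hmem z ((hball z hz).trans hv))).2
  have e : ∫ z in vinf..v, (p z - p vinf - deriv p vinf * (z - vinf)) =
      (∫ z in vinf..v, (p z - p vinf)) - deriv p vinf / 2 * (v - vinf) ^ 2 := by
    rw [intervalIntegral.integral_sub (f := fun z => p z - p vinf)
      ((hp.mono hI').sub continuousOn_const).intervalIntegrable
      (Continuous.intervalIntegrable (by fun_prop) _ _), intervalIntegral.integral_const_mul,
      intervalIntegral.integral_sub (f := fun z => z)
      (Continuous.intervalIntegrable (by fun_prop) _ _) (Continuous.intervalIntegrable (by fun_prop) _ _)]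
    simp only [integral_id, intervalIntegral.integral_const, smul_eq_mul]
    ring
  rw [← e, ← Real.norm_eq_abs]
  refine (intervalIntegral.norm_integral_le_of_norm_le_const (C := δ * |v - vinf|)
    fun z hz => ?_).trans (le_of_eq ?_)
  · have hz' := Set.uIoc_subset_uIcc hz
    have := (h z (hmem z ((hball z hz').trans hv))).1
    rw [smul_eq_mul, Real.norm_eq_abs (z - vinf), mul_comm (z - vinf)] at this
    exact this.trans (mul_le_mul_of_nonneg_left (hball z hz') hδ.le)
  · rw [mul_assoc, ← pow_two, sq_abs]

end Potential

namespace IsSolitaryWave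

variable {p : ℝ → ℝ} {I : Set ℝ} {κ s vinf uinf : ℝ} {v u : ℝ → ℝ}

theorem comp_neg (hw : IsSolitaryWave p I κ s vinf uinf v u) :
    IsSolitaryWave p I κ s vinf uinf (fun x => v (-x)) (fun x => u (-x)) where
  contDiff_v := hw.contDiff_v.comp contDiff_neg
  contDiff_u := hw.contDiff_u.comp contDiff_neg
  mem x := hw.mem _
  eq_mass x := by
    have := hw.eq_mass (-x)
    rw [deriv_comp_neg v, deriv_comp_neg u]
    linarith
  eq_momentum x := by
    have := hw.eq_momentum (-x)
    rw [deriv_comp_neg u, deriv_comp_neg (fun y => p (v y)), iteratedDeriv_comp_neg]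
    simp only [smul_eq_mul]
    linear_combination -this
  v_atTop := hw.v_atBot.comp tendsto_neg_atTop_atBot
  v_atBot := hw.v_atTop.comp tendsto_neg_atBot_atTop
  u_atTop := hw.u_atBot.comp tendsto_neg_atTop_atBot
  u_atBot := hw.u_atTop.comp tendsto_neg_atBot_atTop
  nontrivial := by
    obtain ⟨x, hx⟩ := hw.nontrivial
    exact ⟨-x, by simpa using hx⟩

theorem hasDerivAt_v (hw : IsSolitaryWave p I κ s vinf uinf v u) (x : ℝ) :
    HasDerivAt v (deriv v x) x :=
  (hw.contDiff_v.differentiable (by norm_num) x).hasDerivAt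

theorem hasDerivAt_u (hw : IsSolitaryWave p I κ s vinf uinf v u) (x : ℝ) :
    HasDerivAt u (deriv u x) x :=
  (hw.contDiff_u.differentiable (by norm_num) x).hasDerivAt

theorem hasDerivAt_deriv (hw : IsSolitaryWave p I κ s vinf uinf v u) (x : ℝ) :
    HasDerivAt (deriv v) (iteratedDeriv 2 v x) x := by
  have h := (hw.contDiff_v.differentiable_iteratedDeriv 1 (by norm_num) x).hasDerivAt
  rwa [← iteratedDeriv_succ, iteratedDeriv_one] at h

theorem hasDerivAt_deriv_two (hw : IsSolitaryWave p I κ s vinf uinf v u) (x : ℝ) :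
    HasDerivAt (iteratedDeriv 2 v) (iteratedDeriv 3 v x) x := by
  have h := (hw.contDiff_v.differentiable_iteratedDeriv 2 (by norm_num) x).hasDerivAt
  rwa [← iteratedDeriv_succ] at h

theorem continuous_v (hw : IsSolitaryWave p I κ s vinf uinf v u) : Continuous v :=
  hw.contDiff_v.continuous

theorem continuous_deriv (hw : IsSolitaryWave p I κ s vinf uinf v u) : Continuous (deriv v) :=
  continuous_iff_continuousAt.2 fun x => (hw.hasDerivAt_deriv x).continuousAt

theorem deriv_u (hw : IsSolitaryWave p I κ s vinf uinf v u) (x : ℝ) :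
    deriv u x = -s * deriv v x := by linarith [hw.eq_mass x]

theorem u_eq (hw : IsSolitaryWave p I κ s vinf uinf v u) (x : ℝ) :
    u x - uinf = -s * (v x - vinf) := by
  have hd : ∀ x, HasDerivAt (fun x => u x + s * v x) 0 x := fun x => by
    refine ((hw.hasDerivAt_u x).add ((hw.hasDerivAt_v x).const_mul s)).congr_deriv ?_
    rw [hw.deriv_u]; ring
  have hconst : ∀ y, u y + s * v y = u x + s * v x := fun y =>
    is_const_of_deriv_eq_zero (fun x => (hd x).differentiableAt) (fun x => (hd x).deriv) y x
  have hlim : Tendsto (fun y => u y + s * v y) atTop (𝓝 (uinf + s * vinf)) :=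
    hw.u_atTop.add (hw.v_atTop.const_mul s)
  have := tendsto_nhds_unique (hlim.congr hconst) tendsto_const_nhds
  linarith

theorem mem_range (hw : IsSolitaryWave p I κ s vinf uinf v u) {x y : ℝ}
    (hy : y ∈ Set.uIcc vinf (v x)) (hne : y ≠ vinf) : y ∈ Set.range v := by
  rcases Set.mem_uIcc.1 hy with h | h
  · obtain ⟨x', hx'⟩ := (hw.v_atTop.eventually_lt_const (lt_of_le_of_ne h.1 hne.symm)).exists
    exact mem_range_of_exists_le_of_exists_ge hw.continuous_v ⟨x', hx'.le⟩ ⟨x, h.2⟩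
  · obtain ⟨x', hx'⟩ := (hw.v_atTop.eventually_const_lt (lt_of_le_of_ne h.2 hne)).exists
    exact mem_range_of_exists_le_of_exists_ge hw.continuous_v ⟨x, h.1⟩ ⟨x', hx'.le⟩

theorem uIcc_subset (hw : IsSolitaryWave p I κ s vinf uinf v u) (hvinf : vinf ∈ I) (x : ℝ) :
    Set.uIcc vinf (v x) ⊆ I := by
  intro y hy
  rcases eq_or_ne y vinf with rfl | hne
  · exact hvinf
  obtain ⟨x', rfl⟩ := hw.mem_range hy hne
  exact hw.mem x'

end IsSolitaryWave

/-- A solitary wave whose endstate is a saddle. -/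
structure IsSaddleWave (p : ℝ → ℝ) (I : Set ℝ) (κ s vinf uinf : ℝ) (v u : ℝ → ℝ) : Prop where
  isOpen : IsOpen I
  contDiffOn : ContDiffOn ℝ 2 p I
  pos : 0 < κ
  mem_inf : vinf ∈ I
  saddle : s ^ 2 + deriv p vinf < 0
  wave : IsSolitaryWave p I κ s vinf uinf v u

namespace IsSaddleWave

variable {p : ℝ → ℝ} {I : Set ℝ} {κ s vinf uinf : ℝ} {v u : ℝ → ℝ}

theorem comp_neg (h : IsSaddleWave p I κ s vinf uinf v u) :
    IsSaddleWave p I κ s vinf uinf (fun x => v (-x)) (fun x => u (-x)) :=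
  { h with wave := h.wave.comp_neg }

theorem contDiffAt (h : IsSaddleWave p I κ s vinf uinf v u) {y : ℝ} (hy : y ∈ I) :
    ContDiffAt ℝ 2 p y := h.contDiffOn.contDiffAt (h.isOpen.mem_nhds hy)

theorem hasDerivAt_p (h : IsSaddleWave p I κ s vinf uinf v u) {y : ℝ} (hy : y ∈ I) :
    HasDerivAt p (deriv p y) y :=
  ((h.contDiffAt hy).differentiableAt (by norm_num)).hasDerivAt

theorem contDiffOn_deriv (h : IsSaddleWave p I κ s vinf uinf v u) : ContDiffOn ℝ 1 (deriv p) I :=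
  h.contDiffOn.deriv_of_isOpen h.isOpen (by norm_num)

theorem hasDerivAt_deriv_p (h : IsSaddleWave p I κ s vinf uinf v u) {y : ℝ} (hy : y ∈ I) :
    HasDerivAt (deriv p) (deriv (deriv p) y) y :=
  ((h.contDiffOn_deriv.contDiffAt (h.isOpen.mem_nhds hy)).differentiableAt
    (by norm_num)).hasDerivAt

theorem continuousOn_deriv_two (h : IsSaddleWave p I κ s vinf uinf v u) :
    ContinuousOn (deriv (deriv p)) I :=
  (h.contDiffOn_deriv.deriv_of_isOpen (m := 0) h.isOpen (by norm_num)).continuousOn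

theorem hasDerivAt_comp_p (h : IsSaddleWave p I κ s vinf uinf v u) (x : ℝ) :
    HasDerivAt (fun y => p (v y)) (deriv p (v x) * deriv v x) x :=
  (h.hasDerivAt_p (h.wave.mem x)).comp x (h.wave.hasDerivAt_v x)

theorem hasDerivAt_force (h : IsSaddleWave p I κ s vinf uinf v u) {y : ℝ} (hy : y ∈ I) :
    HasDerivAt (force p vinf s) (deriv p y + s ^ 2) y := by
  refine (((h.hasDerivAt_p hy).sub_const _).add
    (((hasDerivAt_id y).sub_const vinf).const_mul (s ^ 2))).congr_deriv ?_
  simp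

theorem profile_aux (h : IsSaddleWave p I κ s vinf uinf v u) :
    (∀ x, κ * iteratedDeriv 2 v x = -force p vinf s (v x)) ∧
      Tendsto (deriv v) atTop (𝓝 0) := by
  have hw := h.wave
  have hd : ∀ x, HasDerivAt (fun x => κ * iteratedDeriv 2 v x + force p vinf s (v x)) 0 x := by
    intro x
    refine (((hw.hasDerivAt_deriv_two x).const_mul κ).add
      ((h.hasDerivAt_force (hw.mem x)).comp x (hw.hasDerivAt_v x))).congr_deriv ?_
    have := hw.eq_momentum x
    rw [(h.hasDerivAt_comp_p x).deriv, hw.deriv_u] at this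
    linear_combination this
  obtain ⟨K, hK⟩ : ∃ K, ∀ x, κ * iteratedDeriv 2 v x + force p vinf s (v x) = K :=
    ⟨_, fun y => is_const_of_deriv_eq_zero (fun x => (hd x).differentiableAt)
      (fun x => (hd x).deriv) y 0⟩
  have hF : Tendsto (fun x => force p vinf s (v x)) atTop (𝓝 0) := by
    have := (h.hasDerivAt_force h.mem_inf).continuousAt.tendsto.comp hw.v_atTop
    simpa [Function.comp_def] using this
  have h2 : ∀ x, iteratedDeriv 2 v x = (K - force p vinf s (v x)) / κ := fun x => by
    rw [eq_div_iff h.pos.ne']; linarith [hK x]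
  have hlim : Tendsto (iteratedDeriv 2 v) atTop (𝓝 (K / κ)) := by
    rw [funext h2]
    simpa using (hF.const_sub K).div_const κ
  obtain ⟨hz, hv'⟩ := tendsto_deriv_of_tendsto hw.hasDerivAt_v hw.hasDerivAt_deriv hw.v_atTop hlim
  refine ⟨fun x => ?_, hv'⟩
  have hK0 : K = 0 := by
    rcases div_eq_zero_iff.1 hz with hz | hz
    · exact hz
    · exact absurd hz h.pos.ne'
  linarith [hK x]

theorem profile (h : IsSaddleWave p I κ s vinf uinf v u) (x : ℝ) :
    κ * iteratedDeriv 2 v x = -force p vinf s (v x) := h.profile_aux.1 x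

theorem hasDerivAt_deriv (h : IsSaddleWave p I κ s vinf uinf v u) (x : ℝ) :
    HasDerivAt (deriv v) (-force p vinf s (v x) / κ) x := by
  rw [← h.profile x, mul_div_cancel_left₀ _ h.pos.ne']
  exact h.wave.hasDerivAt_deriv x

theorem deriv_atTop (h : IsSaddleWave p I κ s vinf uinf v u) : Tendsto (deriv v) atTop (𝓝 0) :=
  h.profile_aux.2

theorem hasDerivAt_potential (h : IsSaddleWave p I κ s vinf uinf v u) (x : ℝ) :
    HasDerivAt (potential p vinf s) (force p vinf s (v x)) (v x) :=
  Korteweg.hasDerivAt_potential h.isOpen h.contDiffOn.continuousOn (h.wave.uIcc_subset h.mem_inf x)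

/-- Conservation of energy along the profile. -/
theorem energy (h : IsSaddleWave p I κ s vinf uinf v u) (x : ℝ) :
    κ / 2 * deriv v x ^ 2 + potential p vinf s (v x) = 0 := by
  have hd : ∀ x, HasDerivAt (fun x => κ / 2 * deriv v x ^ 2 + potential p vinf s (v x)) 0 x := by
    intro x
    refine ((((h.hasDerivAt_deriv x).pow 2).const_mul (κ / 2)).add
      ((h.hasDerivAt_potential x).comp x (h.wave.hasDerivAt_v x))).congr_deriv ?_
    have := h.pos.ne'
    simp
    field_simp
    ring
  have hconst : ∀ y, κ / 2 * deriv v y ^ 2 + potential p vinf s (v y) =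
      κ / 2 * deriv v x ^ 2 + potential p vinf s (v x) := fun y =>
    is_const_of_deriv_eq_zero (fun x => (hd x).differentiableAt) (fun x => (hd x).deriv) y x
  have hG : ContinuousAt (potential p vinf s) vinf :=
    (Korteweg.hasDerivAt_potential h.isOpen h.contDiffOn.continuousOn
      (by simpa using h.mem_inf)).continuousAt
  have hlim : Tendsto (fun y => κ / 2 * deriv v y ^ 2 + potential p vinf s (v y)) atTop (𝓝 0) := by
    have := ((h.deriv_atTop.pow 2).const_mul (κ / 2)).add (hG.tendsto.comp h.wave.v_atTop)
    simpa using this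
  exact (tendsto_nhds_unique (hlim.congr hconst) tendsto_const_nhds).symm

/-- Waves with a common value and a common slope coincide. -/
theorem eq_of_eq (h : IsSaddleWave p I κ s vinf uinf v u) {v₂ v₂' : ℝ → ℝ}
    (h1 : ∀ x, HasDerivAt v₂ (v₂' x) x)
    (h2 : ∀ x, HasDerivAt v₂' (-force p vinf s (v₂ x) / κ) x) {x₀ : ℝ} (hv : v x₀ = v₂ x₀)
    (hv' : deriv v x₀ = v₂' x₀) : v = v₂ := by
  have := autonomous_unique (X := fun q : ℝ × ℝ => (q.2, -force p vinf s q.1 / κ))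
    (f := fun x => (v x, deriv v x)) (g := fun x => (v₂ x, v₂' x)) (t₀ := x₀) (fun t => ?_)
    (fun t => (h.wave.hasDerivAt_v t).prodMk (h.hasDerivAt_deriv t))
    (fun t => (h1 t).prodMk (h2 t)) (by simp [hv, hv'])
  · funext x
    exact congrArg Prod.fst (congrFun this x)
  · have hp : ContDiffAt ℝ 1 (fun q : ℝ × ℝ => p q.1) (v t, deriv v t) :=
      ((h.contDiffAt (h.wave.mem t)).of_le (by norm_num)).comp (v t, deriv v t) contDiffAt_fst
    exact contDiffAt_snd.prodMk (((hp.sub contDiffAt_const).add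
      (contDiffAt_const.mul (contDiffAt_fst.sub contDiffAt_const))).neg.div_const κ)

theorem force_ne_zero (h : IsSaddleWave p I κ s vinf uinf v u) {x₀ : ℝ}
    (hv' : deriv v x₀ = 0) : force p vinf s (v x₀) ≠ 0 := by
  intro hF
  have := h.eq_of_eq (v₂ := fun _ => v x₀) (v₂' := fun _ => 0) (x₀ := x₀)
    (fun x => hasDerivAt_const x _) (fun x => by
      rw [hF, neg_zero, zero_div]; exact hasDerivAt_const x _) rfl hv'
  have hlim := h.wave.v_atTop
  rw [this] at hlim
  have h3 := tendsto_nhds_unique hlim tendsto_const_nhds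
  obtain ⟨x, hx⟩ := h.wave.nontrivial
  exact hx (by rw [this]; exact h3.symm)

theorem ne_inf (h : IsSaddleWave p I κ s vinf uinf v u) (x : ℝ) : v x ≠ vinf := by
  intro hx
  have he := h.energy x
  rw [hx, potential_self, add_zero] at he
  have h0 : deriv v x = 0 := by
    have hk : κ / 2 ≠ 0 := by have := h.pos; positivity
    exact pow_eq_zero_iff (two_ne_zero) |>.1 ((mul_eq_zero.1 he).resolve_left hk)
  exact h.force_ne_zero h0 (by rw [hx, force_self])

end IsSaddleWave
end
end Korteweg
namespace Korteweg
noncomputable section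

section Tail

variable {w w' : ℝ → ℝ} {ε g X₀ : ℝ}

theorem neg_of_continuous_ne_zero {f : ℝ → ℝ} (hf : Continuous f) {X : ℝ} (hX : f X < 0)
    (hne : ∀ x, X ≤ x → f x ≠ 0) {x : ℝ} (hx : X ≤ x) : f x < 0 := by
  by_contra hcon
  obtain ⟨y, hy, h0⟩ := intermediate_value_Icc hx hf.continuousOn ⟨hX.le, not_lt.1 hcon⟩
  exact hne y hy.1 h0

theorem mul_ne_zero_of_le {a b g : ℝ} (hg : 0 < g) (ha : a ≠ 0) (h : g ^ 2 * a ^ 2 ≤ b ^ 2) :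
    a * b ≠ 0 := by
  refine mul_ne_zero ha ?_
  rintro rfl
  have : 0 < g ^ 2 * a ^ 2 := by positivity
  simp at h
  linarith

/-- An orbit of a saddle that points towards the saddle and is close to it remains so, and decays
exponentially. -/
theorem tail_trapped (hg : 0 < g) (hw : ∀ x, HasDerivAt w (w' x) x) (hw' : Continuous w')
    (hne : ∀ x, w x ≠ 0) (hs : ∀ x, |w x| ≤ ε → g ^ 2 * w x ^ 2 ≤ w' x ^ 2) (h1 : |w X₀| < ε)
    (h2 : w X₀ * w' X₀ < 0) {x : ℝ} (hx : X₀ ≤ x) :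
    |w x| < ε ∧ w x * w' x < 0 ∧ |w x| ≤ |w X₀| * Real.exp (-g * (x - X₀)) := by
  have hwc : Continuous w := continuous_iff_continuousAt.2 fun x => (hw x).continuousAt
  have hsq : ∀ x, HasDerivAt (fun x => w x ^ 2) (2 * (w x * w' x)) x := fun x => by
    refine ((hw x).pow 2).congr_deriv ?_
    simp; ring
  have hneg : ∀ x, X₀ ≤ x → w x * w' x < 0 := by
    by_contra! hcon
    let S := {x | X₀ ≤ x ∧ 0 ≤ w x * w' x}
    have hSc : IsClosed S := isClosed_Ici.inter (isClosed_le continuous_const (hwc.mul hw'))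
    have hSb : BddBelow S := ⟨X₀, fun x hx => hx.1⟩
    obtain ⟨y, hy⟩ := hcon
    have hmem : sInf S ∈ S := hSc.csInf_mem ⟨y, hy⟩ hSb
    set x₁ := sInf S
    have hbefore : ∀ z, X₀ ≤ z → z < x₁ → w z * w' z < 0 := fun z hz hz1 => by
      by_contra hh
      exact absurd (csInf_le hSb (show z ∈ S from ⟨hz, not_lt.1 hh⟩)) (not_le.2 hz1)
    have hanti : AntitoneOn (fun x => w x ^ 2) (Set.Icc X₀ x₁) := by
      refine antitoneOn_of_deriv_nonpos (convex_Icc _ _) (by fun_prop)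
        (fun z _ => (hsq z).differentiableAt.differentiableWithinAt) fun z hz => ?_
      rw [interior_Icc] at hz
      rw [(hsq z).deriv]
      linarith [hbefore z hz.1.le hz.2]
    have hle : w x₁ ^ 2 ≤ w X₀ ^ 2 := hanti ⟨le_rfl, hmem.1⟩ ⟨hmem.1, le_rfl⟩ hmem.1
    have hle' : |w x₁| < ε := (sq_le_sq.1 hle).trans_lt h1
    have hx1 : X₀ < x₁ := lt_of_le_of_ne hmem.1 (by
      intro he
      have := hmem.2
      rw [← he] at this
      linarith)
    have hlim : w x₁ * w' x₁ ≤ 0 := by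
      have ht : Tendsto (fun z => w z * w' z) (𝓝[<] x₁) (𝓝 (w x₁ * w' x₁)) :=
        ((hwc.mul hw').tendsto x₁).mono_left nhdsWithin_le_nhds
      refine le_of_tendsto ht ?_
      filter_upwards [Ioo_mem_nhdsLT hx1] with z hz using (hbefore z hz.1.le hz.2).le
    exact mul_ne_zero_of_le hg (hne x₁) (hs x₁ hle'.le) (le_antisymm hlim hmem.2)
  have hlt : ∀ x, X₀ ≤ x → |w x| < ε := fun x hx => by
    have hanti : AntitoneOn (fun x => w x ^ 2) (Set.Icc X₀ x) := by
      refine antitoneOn_of_deriv_nonpos (convex_Icc _ _) (by fun_prop)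
        (fun z _ => (hsq z).differentiableAt.differentiableWithinAt) fun z hz => ?_
      rw [interior_Icc] at hz
      rw [(hsq z).deriv]
      linarith [hneg z hz.1.le]
    have hle : w x ^ 2 ≤ w X₀ ^ 2 := hanti ⟨le_rfl, hx⟩ ⟨hx, le_rfl⟩ hx
    exact (sq_le_sq.1 hle).trans_lt h1
  refine ⟨hlt x hx, hneg x hx, ?_⟩
  have hE : ∀ x, HasDerivAt (fun x => w x ^ 2 * Real.exp (2 * g * (x - X₀)))
      (2 * (w x * w' x + g * w x ^ 2) * Real.exp (2 * g * (x - X₀))) x := fun x => by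
    have he : HasDerivAt (fun x => Real.exp (2 * g * (x - X₀)))
        (Real.exp (2 * g * (x - X₀)) * (2 * g)) x := by
      simpa using (((hasDerivAt_id x).sub_const X₀).const_mul (2 * g)).exp
    refine ((hsq x).mul he).congr_deriv ?_
    ring
  have hanti : AntitoneOn (fun x => w x ^ 2 * Real.exp (2 * g * (x - X₀))) (Set.Icc X₀ x) := by
    refine antitoneOn_of_deriv_nonpos (convex_Icc _ _) (by fun_prop)
      (fun z _ => (hE z).differentiableAt.differentiableWithinAt) fun z hz => ?_
    rw [interior_Icc] at hz
    rw [(hE z).deriv]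
    have h3 := hs z (hlt z hz.1.le).le
    have h4 := hneg z hz.1.le
    have h5 : g * w z ^ 2 ≤ -(w z * w' z) := by
      refine le_of_sq_le_sq ?_ (by linarith)
      nlinarith [mul_le_mul_of_nonneg_left h3 (sq_nonneg (w z))]
    have : 0 < Real.exp (2 * g * (z - X₀)) := Real.exp_pos _
    nlinarith
  have hle : w x ^ 2 * Real.exp (2 * g * (x - X₀)) ≤ w X₀ ^ 2 := by
    simpa using hanti ⟨le_rfl, hx⟩ ⟨hx, le_rfl⟩ hx
  refine abs_le_of_sq_le_sq ?_ (by positivity)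
  have e : Real.exp (-g * (x - X₀)) ^ 2 * Real.exp (2 * g * (x - X₀)) = 1 := by
    rw [← Real.exp_nat_mul, ← Real.exp_add]; simp; ring
  rw [mul_pow, sq_abs]
  have hpos : 0 ≤ Real.exp (-g * (x - X₀)) ^ 2 := by positivity
  calc w x ^ 2 = w x ^ 2 * Real.exp (2 * g * (x - X₀)) * Real.exp (-g * (x - X₀)) ^ 2 := by
        linear_combination (-(w x ^ 2)) * e
    _ ≤ _ := by gcongr

theorem eventually_pointing (hg : 0 < g) (hε : 0 < ε) (hw : ∀ x, HasDerivAt w (w' x) x)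
    (hw' : Continuous w') (hne : ∀ x, w x ≠ 0)
    (hs : ∀ x, |w x| ≤ ε → g ^ 2 * w x ^ 2 ≤ w' x ^ 2) (hlim : Tendsto w atTop (𝓝 0)) :
    ∀ᶠ x in atTop, |w x| < ε ∧ w x * w' x < 0 := by
  have hwc : Continuous w := continuous_iff_continuousAt.2 fun x => (hw x).continuousAt
  have habs : Tendsto (fun x => |w x|) atTop (𝓝 0) := by simpa using hlim.abs
  obtain ⟨X, hX⟩ := eventually_atTop.1 (habs.eventually_lt_const hε)
  filter_upwards [eventually_ge_atTop X] with y hy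
  refine ⟨hX y hy, ?_⟩
  have hnz : ∀ x, X ≤ x → w x * w' x ≠ 0 := fun x hx =>
    mul_ne_zero_of_le hg (hne x) (hs x (hX x hx).le)
  by_contra hcon
  have hpos : ∀ x, y ≤ x → 0 < w x * w' x := fun x hx => by
    have := neg_of_continuous_ne_zero (f := fun x => -(w x * w' x)) (hwc.mul hw').neg (X := y)
      (by simpa using lt_of_le_of_ne (not_lt.1 hcon) (hnz y hy).symm)
      (fun x hx => neg_ne_zero.2 (hnz x (hy.trans hx))) hx
    simpa using this
  have hsq : ∀ x, HasDerivAt (fun x => w x ^ 2) (2 * (w x * w' x)) x := fun x => by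
    refine ((hw x).pow 2).congr_deriv ?_
    simp; ring
  have hmono : MonotoneOn (fun x => w x ^ 2) (Set.Ici y) := by
    refine monotoneOn_of_deriv_nonneg (convex_Ici _) (by fun_prop)
      (fun z _ => (hsq z).differentiableAt.differentiableWithinAt) fun z hz => ?_
    rw [interior_Ici] at hz
    rw [(hsq z).deriv]
    linarith [hpos z (le_of_lt hz)]
  have h0 : Tendsto (fun x => w x ^ 2) atTop (𝓝 0) := by simpa using hlim.pow 2
  have : w y ^ 2 ≤ 0 := by
    refine ge_of_tendsto h0 ?_
    filter_upwards [eventually_ge_atTop y] with x hx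
    exact hmono (Set.mem_Ici.2 le_rfl) hx hx
  exact absurd this (not_le.2 (by have := hne y; positivity))

end Tail

/-- The profile equation near the endstate is a saddle, uniformly for nearby speeds. -/
theorem exists_saddle_bounds {p : ℝ → ℝ} {I : Set ℝ} {κ s₀ vinf : ℝ} (hI : IsOpen I)
    (hp : ContDiffOn ℝ 2 p I) (hκ : 0 < κ) (hvinf : vinf ∈ I) (hs : s₀ ^ 2 + deriv p vinf < 0) :
    ∃ ε > 0, ∃ g > 0, ∃ Γ > 0, (∀ y, |y - vinf| ≤ ε → y ∈ I) ∧ ∀ᶠ s in 𝓝 s₀,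
      s ^ 2 + deriv p vinf < 0 ∧ ∀ y, |y - vinf| ≤ ε →
        g ^ 2 * (y - vinf) ^ 2 ≤ -(2 / κ) * potential p vinf s y ∧
        -(2 / κ) * potential p vinf s y ≤ Γ ^ 2 * (y - vinf) ^ 2 := by
  set d := -(s₀ ^ 2 + deriv p vinf) with hd
  have hd0 : 0 < d := by linarith
  obtain ⟨ε, hε, hmem, hb⟩ := exists_potential_bound hI hp.continuousOn hvinf
    ((hp.contDiffAt (hI.mem_nhds hvinf)).differentiableAt (by norm_num)) (δ := d / 8) (by positivity)
  refine ⟨ε, hε, √(d / (4 * κ)), Real.sqrt_pos.2 (by positivity),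
    √((2 * |deriv p vinf| + d) / κ), Real.sqrt_pos.2 (by positivity), hmem, ?_⟩
  have hcont : ContinuousAt (fun s : ℝ => s ^ 2 + deriv p vinf) s₀ := by fun_prop
  filter_upwards [hcont.eventually_lt_const (show s₀ ^ 2 + deriv p vinf < -(d / 2) by linarith)]
    with s hs'
  refine ⟨by linarith, fun y hy => ?_⟩
  have h1 := abs_le.1 (hb y hy)
  rw [Real.sq_sqrt (by positivity), Real.sq_sqrt (by positivity)]
  have hsq := sq_nonneg (y - vinf)
  have e1 : -(2 / κ) * potential p vinf s y = (-(2 * potential p vinf s y)) / κ := by ring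
  have e2 : d / (4 * κ) * (y - vinf) ^ 2 = (d / 4 * (y - vinf) ^ 2) / κ := by
    field_simp
  have e3 : (2 * |deriv p vinf| + d) / κ * (y - vinf) ^ 2 =
      ((2 * |deriv p vinf| + d) * (y - vinf) ^ 2) / κ := by ring
  rw [e1, e2, e3, div_le_div_iff_of_pos_right hκ, div_le_div_iff_of_pos_right hκ]
  unfold potential
  constructor
  · nlinarith [h1.2]
  · nlinarith [h1.1, neg_abs_le (deriv p vinf), mul_nonneg (abs_nonneg (deriv p vinf)) hsq,
      mul_nonneg (sq_nonneg s) hsq]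

namespace IsSaddleWave

variable {p : ℝ → ℝ} {I : Set ℝ} {κ s vinf uinf : ℝ} {v u : ℝ → ℝ}

theorem deriv_sq (h : IsSaddleWave p I κ s vinf uinf v u) (x : ℝ) :
    deriv v x ^ 2 = -(2 / κ) * potential p vinf s (v x) := by
  have := h.energy x
  have hk := h.pos.ne'
  field_simp
  linarith

theorem hasDerivAt_sub (h : IsSaddleWave p I κ s vinf uinf v u) (x : ℝ) :
    HasDerivAt (fun x => v x - vinf) (deriv v x) x := (h.wave.hasDerivAt_v x).sub_const vinf

theorem tendsto_sub (h : IsSaddleWave p I κ s vinf uinf v u) :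
    Tendsto (fun x => v x - vinf) atTop (𝓝 0) := by
  simpa using h.wave.v_atTop.sub_const vinf

/-- Exponential decay of the profile. -/
theorem exists_decay_atTop (h : IsSaddleWave p I κ s vinf uinf v u) {ε g Γ : ℝ} (hε : 0 < ε)
    (hg : 0 < g) (hΓ : 0 < Γ) (hb : ∀ y, |y - vinf| ≤ ε →
        g ^ 2 * (y - vinf) ^ 2 ≤ -(2 / κ) * potential p vinf s y ∧
        -(2 / κ) * potential p vinf s y ≤ Γ ^ 2 * (y - vinf) ^ 2) :
    (fun x => v x - vinf) =O[atTop] (fun x => Real.exp (-g * |x|)) ∧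
      deriv v =O[atTop] (fun x => v x - vinf) := by
  have hs : ∀ x, |v x - vinf| ≤ ε → g ^ 2 * (v x - vinf) ^ 2 ≤ deriv v x ^ 2 := fun x hx => by
    rw [h.deriv_sq]; exact (hb _ hx).1
  have hne : ∀ x, v x - vinf ≠ 0 := fun x => sub_ne_zero.2 (h.ne_inf x)
  obtain ⟨X, hX, hX0⟩ := ((eventually_pointing hg hε h.hasDerivAt_sub h.wave.continuous_deriv hne hs
    h.tendsto_sub).and (eventually_ge_atTop 0)).exists
  have htail := fun x (hx : X ≤ x) => tail_trapped hg h.hasDerivAt_sub h.wave.continuous_deriv hne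
    hs hX.1 hX.2 hx
  constructor
  · refine Asymptotics.IsBigO.of_bound (|v X - vinf| * Real.exp (g * X)) ?_
    filter_upwards [eventually_ge_atTop X] with x hx
    refine (htail x hx).2.2.trans (le_of_eq ?_)
    rw [Real.norm_eq_abs, Real.abs_exp, mul_assoc, ← Real.exp_add, abs_of_nonneg (hX0.trans hx)]
    congr 2; ring
  · refine Asymptotics.IsBigO.of_bound Γ ?_
    filter_upwards [eventually_ge_atTop X] with x hx
    have h1 := (hb _ (htail x hx).1.le).2
    rw [← h.deriv_sq, ← mul_pow] at h1
    have h2 := sq_le_sq.1 h1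
    rwa [abs_mul, abs_of_pos hΓ] at h2

theorem exists_decay (h : IsSaddleWave p I κ s vinf uinf v u) :
    ∃ g > 0, (∀ l ∈ ({atTop, atBot} : Set (Filter ℝ)),
      (fun x => v x - vinf) =O[l] (fun x => Real.exp (-g * |x|)) ∧
      deriv v =O[l] (fun x => v x - vinf)) := by
  obtain ⟨ε, hε, g, hg, Γ, hΓ, -, hb⟩ := exists_saddle_bounds h.isOpen h.contDiffOn h.pos h.mem_inf
    h.saddle
  refine ⟨g, hg, ?_⟩
  rintro l (rfl | rfl)
  · exact h.exists_decay_atTop hε hg hΓ hb.self_of_nhds.2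
  · obtain ⟨h1, h2⟩ := h.comp_neg.exists_decay_atTop hε hg hΓ hb.self_of_nhds.2
    have h1' := h1.comp_tendsto tendsto_neg_atBot_atTop
    have h2' := h2.comp_tendsto tendsto_neg_atBot_atTop
    have e : deriv (fun x => v (-x)) = fun x => -deriv v (-x) := funext (deriv_comp_neg v)
    rw [e] at h2'
    simp only [Function.comp_def, neg_neg, abs_neg] at h1' h2'
    exact ⟨h1', by simpa using h2'⟩

end IsSaddleWave

theorem exists_exp_bound {f : ℝ → ℝ} (hf : Continuous f) {g : ℝ}
    (h1 : f =O[atTop] fun x => Real.exp (-g * |x|))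
    (h2 : f =O[atBot] fun x => Real.exp (-g * |x|)) :
    ∃ B, ∀ x, |f x| ≤ B * Real.exp (-g * |x|) := by
  have key : ∀ x : ℝ, Real.exp (g * |x|) * Real.exp (-g * |x|) = 1 := fun x => by
    rw [← Real.exp_add]; simp
  obtain ⟨C, hC⟩ := h1.bound
  obtain ⟨C', hC'⟩ := h2.bound
  have hb : ∀ (C x : ℝ), ‖f x‖ ≤ C * ‖Real.exp (-g * |x|)‖ → |f x * Real.exp (g * |x|)| ≤ C := by
    intro C x h
    rw [Real.norm_eq_abs, Real.norm_eq_abs, Real.abs_exp] at h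
    rw [abs_mul, Real.abs_exp]
    calc |f x| * Real.exp (g * |x|) ≤ C * Real.exp (-g * |x|) * Real.exp (g * |x|) := by gcongr
      _ = C := by linear_combination C * key x
  obtain ⟨B, hB⟩ := exists_bound_of_eventually (g := fun x => f x * Real.exp (g * |x|))
    (by fun_prop) (hC.mono fun x => hb C x) (hC'.mono fun x => hb C' x)
  refine ⟨B, fun x => ?_⟩
  have := hB x
  rw [abs_mul, Real.abs_exp] at this
  calc |f x| = |f x| * Real.exp (g * |x|) * Real.exp (-g * |x|) := by
        linear_combination (-|f x|) * key x
    _ ≤ _ := by gcongr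

namespace IsSaddleWave

variable {p : ℝ → ℝ} {I : Set ℝ} {κ s vinf uinf : ℝ} {v u : ℝ → ℝ}

theorem hasDerivAt_coeff (h : IsSaddleWave p I κ s vinf uinf v u) (x : ℝ) :
    HasDerivAt (fun y => deriv p (v y)) (deriv (deriv p) (v x) * deriv v x) x :=
  (h.hasDerivAt_deriv_p (h.wave.mem x)).comp x (h.wave.hasDerivAt_v x)

/-- The coefficient of the linearization about a wave is exponentially localized. -/
theorem exists_isLocalizedCoeff (h : IsSaddleWave p I κ s vinf uinf v u) :
    ∃ g > 0, ∃ B, IsLocalizedCoeff (fun y => deriv p (v y)) (√(-deriv p vinf)) g B ∧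
      (∀ x, |v x - vinf| ≤ B * Real.exp (-g * |x|)) ∧
      (∀ x, |deriv v x| ≤ B * Real.exp (-g * |x|)) := by
  obtain ⟨g, hg, hdec⟩ := h.exists_decay
  have hc2 : √(-deriv p vinf) ^ 2 = -deriv p vinf :=
    Real.sq_sqrt (by nlinarith [h.saddle, sq_nonneg s])
  have hd : deriv (fun y => deriv p (v y)) = fun x => deriv (deriv p) (v x) * deriv v x :=
    funext fun x => (h.hasDerivAt_coeff x).deriv
  have hcont1 : Continuous fun y => deriv p (v y) :=
    continuous_iff_continuousAt.2 fun x => (h.hasDerivAt_coeff x).continuousAt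
  have hcont2 : Continuous fun x => deriv (deriv p) (v x) * deriv v x :=
    (h.continuousOn_deriv_two.comp_continuous h.wave.continuous_v h.wave.mem).mul
      h.wave.continuous_deriv
  have hlim : ∀ l ∈ ({atTop, atBot} : Set (Filter ℝ)), Tendsto v l (𝓝 vinf) := by
    rintro l (rfl | rfl)
    exacts [h.wave.v_atTop, h.wave.v_atBot]
  have hO1 : ∀ l ∈ ({atTop, atBot} : Set (Filter ℝ)),
      (fun x => deriv p (v x) + √(-deriv p vinf) ^ 2) =O[l] fun x => Real.exp (-g * |x|) :=
    fun l hl => by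
      rw [hc2]
      have := ((h.hasDerivAt_deriv_p h.mem_inf).isBigO_sub.comp_tendsto (hlim l hl)).trans
        (hdec l hl).1
      simpa [Function.comp_def, sub_eq_add_neg] using this
  have hO3 : ∀ l ∈ ({atTop, atBot} : Set (Filter ℝ)),
      deriv v =O[l] fun x => Real.exp (-g * |x|) := fun l hl =>
    (hdec l hl).2.trans (hdec l hl).1
  have hO2 : ∀ l ∈ ({atTop, atBot} : Set (Filter ℝ)),
      (fun x => deriv (deriv p) (v x) * deriv v x) =O[l] fun x => Real.exp (-g * |x|) :=
    fun l hl => by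
      have h1 : Tendsto (fun x => deriv (deriv p) (v x)) l (𝓝 (deriv (deriv p) vinf)) :=
        (h.continuousOn_deriv_two.continuousAt
          (h.isOpen.mem_nhds h.mem_inf)).tendsto.comp (hlim l hl)
      simpa using (h1.isBigO_one ℝ).mul (hO3 l hl)
  have hT : atTop ∈ ({atTop, atBot} : Set (Filter ℝ)) := by simp
  have hB : atBot ∈ ({atTop, atBot} : Set (Filter ℝ)) := by simp
  obtain ⟨B₁, h1⟩ := exists_exp_bound (by fun_prop) (hO1 _ hT) (hO1 _ hB)
  obtain ⟨B₂, h2⟩ := exists_exp_bound hcont2 (hO2 _ hT) (hO2 _ hB)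
  obtain ⟨B₃, h3⟩ := exists_exp_bound h.wave.continuous_deriv (hO3 _ hT) (hO3 _ hB)
  obtain ⟨B₄, h4⟩ := exists_exp_bound (h.wave.continuous_v.sub continuous_const)
    (hdec _ hT).1 (hdec _ hB).1
  have hle : ∀ (b B e : ℝ), b ≤ B → ∀ x : ℝ, e ≤ b * Real.exp (-g * |x|) →
      e ≤ B * Real.exp (-g * |x|) := fun b B e hb x he =>
    he.trans (mul_le_mul_of_nonneg_right hb (Real.exp_pos _).le)
  refine ⟨g, hg, max (max B₁ B₂) (max B₃ B₄), ⟨fun x => (h.hasDerivAt_coeff x).differentiableAt,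
    hd ▸ hcont2, fun x => hle B₁ _ _ (by simp) x (h1 x), fun x => hle B₂ _ _ (by simp) x ?_⟩,
    fun x => hle B₄ _ _ (by simp) x (h4 x), fun x => hle B₃ _ _ (by simp) x (h3 x)⟩
  rw [hd]; exact h2 x

end IsSaddleWave
end
end Korteweg
namespace Korteweg
noncomputable section

/-- The derivative of the wave `(v, u)` in phase variables. -/
def waveDeriv (v u : ℝ → ℝ) (x : ℝ) : Fin 4 → ℂ :=
  ![((deriv u x : ℝ) : ℂ), ((deriv v x : ℝ) : ℂ), ((iteratedDeriv 2 v x : ℝ) : ℂ),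
    ((iteratedDeriv 3 v x : ℝ) : ℂ)]

namespace IsSaddleWave

variable {p : ℝ → ℝ} {I : Set ℝ} {κ s vinf uinf : ℝ} {v u : ℝ → ℝ}

theorem iteratedDeriv_three (h : IsSaddleWave p I κ s vinf uinf v u) (x : ℝ) :
    iteratedDeriv 3 v x = -((deriv p (v x) + s ^ 2) * deriv v x) / κ := by
  have h1 := h.wave.eq_momentum x
  rw [(h.hasDerivAt_comp_p x).deriv, h.wave.deriv_u] at h1
  rw [eq_div_iff h.pos.ne']
  linear_combination h1

theorem hasDerivAt_iteratedDeriv_three (h : IsSaddleWave p I κ s vinf uinf v u) (x : ℝ) :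
    HasDerivAt (iteratedDeriv 3 v) (-(deriv (fun y => deriv p (v y)) x * deriv v x +
      (deriv p (v x) + s ^ 2) * iteratedDeriv 2 v x) / κ) x := by
  rw [(funext h.iteratedDeriv_three : iteratedDeriv 3 v = _), (h.hasDerivAt_coeff x).deriv]
  exact (((h.hasDerivAt_coeff x).add_const (s ^ 2)).mul (h.wave.hasDerivAt_deriv x)).fun_neg.div_const κ

theorem hasDerivAt_waveDeriv (h : IsSaddleWave p I κ s vinf uinf v u) (x : ℝ) :
    HasDerivAt (waveDeriv v u)
      ((evansMatrix (fun y => deriv p (v y)) κ s 0 x).mulVec (waveDeriv v u x)) x := by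
  have h0 : HasDerivAt (deriv u) (-s * iteratedDeriv 2 v x) x := by
    rw [(funext h.wave.deriv_u : deriv u = _)]
    exact (h.wave.hasDerivAt_deriv x).const_mul (-s)
  refine hasDerivAt_pi.2 fun i => ?_
  fin_cases i
  · refine h0.ofReal_comp.congr_deriv ?_
    simp [evansMatrix, Matrix.mulVec, dotProduct, Fin.sum_univ_four, waveDeriv]
  · refine (h.wave.hasDerivAt_deriv x).ofReal_comp.congr_deriv ?_
    simp [evansMatrix, Matrix.mulVec, dotProduct, Fin.sum_univ_four, waveDeriv]
  · refine (h.wave.hasDerivAt_deriv_two x).ofReal_comp.congr_deriv ?_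
    simp [evansMatrix, Matrix.mulVec, dotProduct, Fin.sum_univ_four, waveDeriv]
  · refine (h.hasDerivAt_iteratedDeriv_three x).ofReal_comp.congr_deriv ?_
    simp [evansMatrix, Matrix.mulVec, dotProduct, Fin.sum_univ_four, waveDeriv]
    ring

theorem tendsto_waveDeriv_atTop (h : IsSaddleWave p I κ s vinf uinf v u) :
    Tendsto (waveDeriv v u) atTop (𝓝 0) := by
  have h1 := h.deriv_atTop
  have h0 : Tendsto (deriv u) atTop (𝓝 0) := by
    rw [(funext h.wave.deriv_u : deriv u = _)]
    simpa using h1.const_mul (-s)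
  have h2 : Tendsto (iteratedDeriv 2 v) atTop (𝓝 0) := by
    have := ((h.hasDerivAt_force h.mem_inf).continuousAt.tendsto.comp h.wave.v_atTop).neg.div_const κ
    simp only [force_self, neg_zero, zero_div] at this
    refine this.congr fun x => ?_
    rw [Function.comp_apply, ← h.profile, mul_div_cancel_left₀ _ h.pos.ne']
  have h3 : Tendsto (iteratedDeriv 3 v) atTop (𝓝 0) := by
    rw [(funext h.iteratedDeriv_three : iteratedDeriv 3 v = _)]
    have := (((((h.hasDerivAt_deriv_p h.mem_inf).continuousAt.tendsto.comp
      h.wave.v_atTop).add_const (s ^ 2)).mul h1).neg).div_const κ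
    simpa using this
  refine tendsto_pi_nhds.2 fun i => ?_
  fin_cases i
  · exact (Complex.continuous_ofReal.tendsto' 0 0 Complex.ofReal_zero).comp h0
  · exact (Complex.continuous_ofReal.tendsto' 0 0 Complex.ofReal_zero).comp h1
  · exact (Complex.continuous_ofReal.tendsto' 0 0 Complex.ofReal_zero).comp h2
  · exact (Complex.continuous_ofReal.tendsto' 0 0 Complex.ofReal_zero).comp h3

theorem tendsto_waveDeriv_atBot (h : IsSaddleWave p I κ s vinf uinf v u) :
    Tendsto (waveDeriv v u) atBot (𝓝 0) := by
  have h1 := h.comp_neg.tendsto_waveDeriv_atTop.comp tendsto_neg_atBot_atTop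
  refine tendsto_pi_nhds.2 fun i => ?_
  have h2 := tendsto_pi_nhds.1 h1 i
  fin_cases i
  · have := h2.neg
    simp only [Function.comp_def, waveDeriv, deriv_comp_neg] at this
    simpa [waveDeriv] using this
  · have := h2.neg
    simp only [Function.comp_def, waveDeriv, deriv_comp_neg] at this
    simpa [waveDeriv] using this
  · simp only [Function.comp_def, waveDeriv, iteratedDeriv_comp_neg] at h2
    simpa [waveDeriv] using h2
  · have := h2.neg
    simp only [Function.comp_def, waveDeriv, iteratedDeriv_comp_neg] at this
    simpa [waveDeriv, pow_succ] using this

theorem exists_deriv_ne_zero (h : IsSaddleWave p I κ s vinf uinf v u) : ∃ x, deriv v x ≠ 0 := by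
  by_contra! hcon
  obtain ⟨x, hx⟩ := h.wave.nontrivial
  have hc : ∀ y, v y = v x := fun y =>
    is_const_of_deriv_eq_zero (h.wave.contDiff_v.differentiable (by norm_num)) hcon y x
  have := tendsto_nhds_unique (h.wave.v_atTop.congr hc) tendsto_const_nhds
  exact hx this.symm

theorem waveDeriv_ne_zero (h : IsSaddleWave p I κ s vinf uinf v u) : waveDeriv v u ≠ 0 := by
  obtain ⟨x, hx⟩ := h.exists_deriv_ne_zero
  intro h0
  have := congrFun (congrFun h0 x) 1
  exact hx (by simpa [waveDeriv] using this)

theorem sq_lt (h : IsSaddleWave p I κ s vinf uinf v u) : s ^ 2 < √(-deriv p vinf) ^ 2 := by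
  rw [Real.sq_sqrt (by nlinarith [h.saddle, sq_nonneg s])]
  linarith [h.saddle]

theorem sqrt_pos (h : IsSaddleWave p I κ s vinf uinf v u) : 0 < √(-deriv p vinf) :=
  Real.sqrt_pos.2 (by nlinarith [h.saddle, sq_nonneg s])

/-- Half-line bases about a wave. -/
theorem exists_halfLineBases (h : IsSaddleWave p I κ s vinf uinf v u) {a b : ℝ} (ha : a ≠ 0)
    (hb : b ≠ 0) : ∃ r > 0, ∃ W₁ W₂ W₃ W₄ : ℝ → Fin 4 → Disc r,
      IsHalfLineBasis κ s (fun y => deriv p (v y)) r atTop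
        ((a : ℂ) • ![((√(-deriv p vinf) : ℝ) : ℂ), -1, 0, 0]) W₁ W₂ ∧
      IsHalfLineBasis κ s (fun y => deriv p (v y)) r atBot
        ((b : ℂ) • ![((√(-deriv p vinf) : ℝ) : ℂ), 1, 0, 0]) W₄ W₃ ∧
      evalFun 0 W₁ = waveDeriv v u ∧ evalFun 0 W₄ = waveDeriv v u := by
  obtain ⟨g, hg, B, hα, -, -⟩ := h.exists_isLocalizedCoeff
  exact exists_bases h.pos h.sq_lt h.sqrt_pos hg hα (by exact_mod_cast ha) (by exact_mod_cast hb)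
    h.hasDerivAt_waveDeriv h.waveDeriv_ne_zero h.tendsto_waveDeriv_atTop h.tendsto_waveDeriv_atBot

end IsSaddleWave

theorem differentiableOn_evalFun {r : ℝ} (W : ℝ → Fin 4 → Disc r) (x : ℝ) :
    DifferentiableOn ℂ (fun z => evalFun z W x) (Metric.ball 0 r) :=
  differentiableOn_pi.2 fun i => Disc.differentiableOn_eval (W x i)

/-- The Evans basis assembled from bases on the two half-lines. -/
def EvansBasis.ofHalfLineBases {p : ℝ → ℝ} {κ s vinf : ℝ} {v u : ℝ → ℝ} {a b r : ℝ}
    {W₁ W₂ W₃ W₄ : ℝ → Fin 4 → Disc r}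
    (hp : IsHalfLineBasis κ s (fun y => deriv p (v y)) r atTop
        ((a : ℂ) • ![((√(-deriv p vinf) : ℝ) : ℂ), -1, 0, 0]) W₁ W₂)
    (hm : IsHalfLineBasis κ s (fun y => deriv p (v y)) r atBot
        ((b : ℂ) • ![((√(-deriv p vinf) : ℝ) : ℂ), 1, 0, 0]) W₄ W₃)
    (h₁ : evalFun 0 W₁ = waveDeriv v u) (h₄ : evalFun 0 W₄ = waveDeriv v u) :
    EvansBasis p κ s vinf v u a b (Metric.ball 0 r) where
  W₁ z := evalFun z W₁
  W₂ z := evalFun z W₂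
  W₃ z := evalFun z W₃
  W₄ z := evalFun z W₄
  solution := by
    rintro W (rfl | rfl | rfl | rfl) z hz x
    · exact hasDerivAt_evalFun (Metric.ball_subset_closedBall hz) (hp.ode₁ x)
    · exact hasDerivAt_evalFun (Metric.ball_subset_closedBall hz) (hp.ode₂ x)
    · exact hasDerivAt_evalFun (Metric.ball_subset_closedBall hz) (hm.ode₂ x)
    · exact hasDerivAt_evalFun (Metric.ball_subset_closedBall hz) (hm.ode₁ x)
  analytic := by
    rintro W (rfl | rfl | rfl | rfl) x <;> exact differentiableOn_evalFun _ x
  indep_plus z hz hzr := hp.indep z (Metric.ball_subset_closedBall hz) hzr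
  span_plus z hz hzr := hp.span z (Metric.ball_subset_closedBall hz) hzr
  indep_minus z hz hzr := by
    have := LinearIndependent.pair_symm_iff.1 (hm.indep z (Metric.ball_subset_closedBall hz) hzr)
    exact this
  span_minus z hz hzr := by
    rw [Set.pair_comm]
    exact hm.span z (Metric.ball_subset_closedBall hz) hzr
  W₁_zero x := congrFun h₁ x
  W₄_zero := h₄.trans h₁.symm
  W₂_zero := hp.lim
  W₃_zero := hm.lim

end
end Korteweg
namespace Korteweg
noncomputable section

section Parametric

variable {J : Set ℝ} {G G' : ℝ → ℝ → ℝ} {s : ℝ}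

theorem continuous_slice {E : Type*} [TopologicalSpace E] {G : ℝ → ℝ → E}
    (hG : ContinuousOn (fun q : ℝ × ℝ => G q.1 q.2) (J ×ˢ Set.univ))
    (hs : s ∈ J) : Continuous (G s) :=
  hG.comp_continuous (f := fun t => (s, t)) (by fun_prop) fun _ => ⟨hs, trivial⟩

theorem exists_bound_slice (hJ : IsOpen J)
    (hG : ContinuousOn (fun q : ℝ × ℝ => G q.1 q.2) (J ×ˢ Set.univ)) (hs : s ∈ J) (a b : ℝ) :
    ∃ C, ∀ᶠ σ in 𝓝 s, ∀ t ∈ Set.Icc a b, |G σ t| ≤ C := by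
  obtain ⟨r, hr, hsub⟩ := Metric.nhds_basis_closedBall.mem_iff.1 (hJ.mem_nhds hs)
  obtain ⟨C, hC⟩ := ((isCompact_closedBall s r).prod (isCompact_Icc (a := a) (b := b))).exists_bound_of_continuousOn
    (hG.mono (Set.prod_mono hsub (Set.subset_univ _)))
  refine ⟨C, ?_⟩
  filter_upwards [Metric.closedBall_mem_nhds s hr] with σ hσ t ht using hC (σ, t) ⟨hσ, ht⟩

/-- Differentiation under the integral sign over a compact interval. -/
theorem hasDerivAt_integral_slice (hJ : IsOpen J)
    (hG : ContinuousOn (fun q : ℝ × ℝ => G q.1 q.2) (J ×ˢ Set.univ))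
    (hG' : ContinuousOn (fun q : ℝ × ℝ => G' q.1 q.2) (J ×ˢ Set.univ))
    (hd : ∀ σ ∈ J, ∀ t, HasDerivAt (fun σ => G σ t) (G' σ t) σ) (hs : s ∈ J) (a b : ℝ) :
    HasDerivAt (fun σ => ∫ t in a..b, G σ t) (∫ t in a..b, G' s t) s := by
  obtain ⟨C, hC⟩ := exists_bound_slice hJ hG' hs (min a b) (max a b)
  have hCJ := hC.and (hJ.mem_nhds hs)
  refine (intervalIntegral.hasDerivAt_integral_of_dominated_loc_of_deriv_le (F := G)
    (bound := fun _ => C) hCJ ?_ ((continuous_slice hG hs).intervalIntegrable _ _)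
    (continuous_slice hG' hs).aestronglyMeasurable ?_ intervalIntegrable_const ?_).2
  · filter_upwards [hJ.mem_nhds hs] with σ hσ using (continuous_slice hG hσ).aestronglyMeasurable
  · exact Eventually.of_forall fun t ht σ hσ => hσ.1 t (Set.uIoc_subset_uIcc ht)
  · exact Eventually.of_forall fun t _ σ hσ => hd σ hσ.2 t

end Parametric

theorem integrable_exp_neg_mul_abs {g : ℝ} (hg : 0 < g) :
    Integrable fun x : ℝ => Real.exp (-g * |x|) := by
  have h1 : IntegrableOn (fun x : ℝ => Real.exp (-g * |x|)) (Set.Ioi 0) := by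
    refine (integrableOn_exp_mul_Ioi (neg_lt_zero.2 hg) 0).congr_fun (fun x hx => ?_) measurableSet_Ioi
    simp only [abs_of_pos (Set.mem_Ioi.1 hx)]
  have h2 : IntegrableOn (fun x : ℝ => Real.exp (-g * |x|)) (Set.Iic 0) := by
    refine (integrableOn_exp_mul_Iic hg 0).congr_fun (fun x hx => ?_) measurableSet_Iic
    simp only [abs_of_nonpos (Set.mem_Iic.1 hx)]
    simp
  have := h2.union h1
  rwa [Set.Iic_union_Ioi, integrableOn_univ] at this

/-- A family of solitary waves that is continuously differentiable in its speed `s ∈ J`. -/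
structure IsSaddleFamily (p : ℝ → ℝ) (I : Set ℝ) (κ : ℝ) (J : Set ℝ) (vinf uinf : ℝ)
    (V U : ℝ → ℝ → ℝ) : Prop where
  isOpen : IsOpen J
  wave : ∀ s ∈ J, IsSaddleWave p I κ s vinf uinf (V s) (U s)
  contDiffOn : ContDiffOn ℝ 1 (fun q : ℝ × ℝ => V q.1 q.2) (J ×ˢ Set.univ)

theorem IsWaveFamily.exists_isSaddleFamily {p : ℝ → ℝ} {I : Set ℝ} {κ sbar vinf uinf : ℝ}
    {v u : ℝ → ℝ} {V U : ℝ → ℝ → ℝ} (h : IsWaveFamily p I κ sbar vinf uinf v u V U)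
    (hw : IsSaddleWave p I κ sbar vinf uinf v u) :
    ∃ J, sbar ∈ J ∧ IsSaddleFamily p I κ J vinf uinf V U := by
  obtain ⟨δ, hδ, h1, h2, -⟩ := h.exists_interval
  have hc : Continuous fun s : ℝ => s ^ 2 + deriv p vinf := by fun_prop
  refine ⟨Set.Ioo (sbar - δ) (sbar + δ) ∩ {s | s ^ 2 + deriv p vinf < 0},
    ⟨⟨by linarith, by linarith⟩, hw.saddle⟩, isOpen_Ioo.inter (isOpen_lt hc continuous_const),
    fun s hs => { hw with saddle := hs.2, wave := h1 s hs.1 }, h2.mono ?_⟩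
  exact Set.prod_mono Set.inter_subset_left subset_rfl

/-- The derivative of a family of functions with respect to the parameter. -/
def speedDeriv (V : ℝ → ℝ → ℝ) (s x : ℝ) : ℝ := deriv (fun σ => V σ x) s

namespace IsSaddleFamily

variable {p : ℝ → ℝ} {I : Set ℝ} {κ vinf uinf s : ℝ} {J : Set ℝ} {V U : ℝ → ℝ → ℝ}

theorem comp_neg (h : IsSaddleFamily p I κ J vinf uinf V U) :
    IsSaddleFamily p I κ J vinf uinf (fun s x => V s (-x)) (fun s x => U s (-x)) where
  isOpen := h.isOpen
  wave s hs := (h.wave s hs).comp_neg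
  contDiffOn := h.contDiffOn.comp (g := fun q : ℝ × ℝ => V q.1 q.2)
    (f := fun q : ℝ × ℝ => (q.1, -q.2)) (contDiff_fst.prodMk contDiff_snd.neg).contDiffOn
    fun _ hq => ⟨hq.1, trivial⟩

theorem isOpen_prod (h : IsSaddleFamily p I κ J vinf uinf V U) :
    IsOpen (J ×ˢ (Set.univ : Set ℝ)) := h.isOpen.prod isOpen_univ

theorem hasFDerivAt (h : IsSaddleFamily p I κ J vinf uinf V U) (hs : s ∈ J) (x : ℝ) :
    HasFDerivAt (fun q : ℝ × ℝ => V q.1 q.2) (fderiv ℝ (fun q : ℝ × ℝ => V q.1 q.2) (s, x)) (s, x) :=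
  ((h.contDiffOn.contDiffAt (h.isOpen_prod.mem_nhds ⟨hs, trivial⟩)).differentiableAt
    (by norm_num)).hasFDerivAt

theorem hasDerivAt_speed (h : IsSaddleFamily p I κ J vinf uinf V U) (hs : s ∈ J) (x : ℝ) :
    HasDerivAt (fun σ => V σ x) (speedDeriv V s x) s :=
  (((h.hasFDerivAt hs x).comp_hasDerivAt (f := fun σ => (σ, x)) s
    ((hasDerivAt_id s).prodMk (hasDerivAt_const s x))).differentiableAt).hasDerivAt

theorem continuousOn (h : IsSaddleFamily p I κ J vinf uinf V U) :
    ContinuousOn (fun q : ℝ × ℝ => V q.1 q.2) (J ×ˢ Set.univ) := h.contDiffOn.continuousOn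

theorem continuousOn_fderiv (h : IsSaddleFamily p I κ J vinf uinf V U) :
    ContinuousOn (fderiv ℝ (fun q : ℝ × ℝ => V q.1 q.2)) (J ×ˢ Set.univ) :=
  h.contDiffOn.continuousOn_fderiv_of_isOpen h.isOpen_prod le_rfl

theorem continuousOn_speedDeriv (h : IsSaddleFamily p I κ J vinf uinf V U) :
    ContinuousOn (fun q : ℝ × ℝ => speedDeriv V q.1 q.2) (J ×ˢ Set.univ) := by
  refine (h.continuousOn_fderiv.clm_apply (continuousOn_const (c := ((1 : ℝ), (0 : ℝ))))).congr ?_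
  rintro ⟨s, x⟩ ⟨hs, -⟩
  exact ((h.hasFDerivAt hs x).comp_hasDerivAt (f := fun σ => (σ, x)) s
    ((hasDerivAt_id s).prodMk (hasDerivAt_const s x))).deriv

theorem continuousOn_deriv (h : IsSaddleFamily p I κ J vinf uinf V U) :
    ContinuousOn (fun q : ℝ × ℝ => deriv (V q.1) q.2) (J ×ˢ Set.univ) := by
  refine (h.continuousOn_fderiv.clm_apply (continuousOn_const (c := ((0 : ℝ), (1 : ℝ))))).congr ?_
  rintro ⟨s, x⟩ ⟨hs, -⟩
  exact ((h.hasFDerivAt hs x).comp_hasDerivAt (f := fun y => (s, y)) x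
    ((hasDerivAt_const x s).prodMk (hasDerivAt_id x))).deriv

theorem continuousOn_force (h : IsSaddleFamily p I κ J vinf uinf V U) :
    ContinuousOn (fun q : ℝ × ℝ => force p vinf q.1 (V q.1 q.2)) (J ×ˢ Set.univ) := by
  rcases J.eq_empty_or_nonempty with rfl | ⟨s₀, hs₀⟩
  · simp
  have hp : ContinuousOn (fun q : ℝ × ℝ => p (V q.1 q.2)) (J ×ˢ Set.univ) :=
    (h.wave s₀ hs₀).contDiffOn.continuousOn.comp h.continuousOn
      fun q hq => (h.wave q.1 hq.1).wave.mem q.2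
  exact (hp.sub continuousOn_const).add
    ((continuous_fst.pow 2).continuousOn.mul (h.continuousOn.sub continuousOn_const))

theorem continuousOn_coeff (h : IsSaddleFamily p I κ J vinf uinf V U) :
    ContinuousOn (fun q : ℝ × ℝ => deriv p (V q.1 q.2)) (J ×ˢ Set.univ) := by
  rcases J.eq_empty_or_nonempty with rfl | ⟨s₀, hs₀⟩
  · simp
  exact (h.wave s₀ hs₀).contDiffOn_deriv.continuousOn.comp h.continuousOn
      fun q hq => (h.wave q.1 hq.1).wave.mem q.2

/-- The derivative of the force along the family with respect to the speed. -/
def forceSpeed (p : ℝ → ℝ) (vinf : ℝ) (V : ℝ → ℝ → ℝ) (s x : ℝ) : ℝ :=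
  (deriv p (V s x) + s ^ 2) * speedDeriv V s x + 2 * s * (V s x - vinf)

theorem continuousOn_forceSpeed (h : IsSaddleFamily p I κ J vinf uinf V U) :
    ContinuousOn (fun q : ℝ × ℝ => forceSpeed p vinf V q.1 q.2) (J ×ˢ Set.univ) :=
  ((h.continuousOn_coeff.add (continuous_fst.pow 2).continuousOn).mul h.continuousOn_speedDeriv).add
    ((continuous_const.mul continuous_fst).continuousOn.mul (h.continuousOn.sub continuousOn_const))

theorem hasDerivAt_force_speed (h : IsSaddleFamily p I κ J vinf uinf V U) (hs : s ∈ J) (x : ℝ) :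
    HasDerivAt (fun σ => force p vinf σ (V σ x)) (forceSpeed p vinf V s x) s := by
  have hV := h.hasDerivAt_speed hs x
  have h1 := ((h.wave s hs).hasDerivAt_p ((h.wave s hs).wave.mem x)).comp s hV
  have h2 := (hasDerivAt_pow 2 s).mul (hV.sub_const vinf)
  refine ((h1.sub_const (p vinf)).add h2).congr_deriv ?_
  simp [forceSpeed]
  ring

theorem deriv_eq_integral (h : IsSaddleFamily p I κ J vinf uinf V U) (hs : s ∈ J) (a x : ℝ) :
    deriv (V s) x = deriv (V s) a - (1 / κ) * ∫ t in a..x, force p vinf s (V s t) := by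
  have h1 := intervalIntegral.integral_eq_sub_of_hasDerivAt
    (fun t _ => (h.wave s hs).hasDerivAt_deriv t) (a := a) (b := x)
    ((((continuous_slice (G := fun σ x => force p vinf σ (V σ x)) h.continuousOn_force
      hs).neg).div_const κ).intervalIntegrable a x)
  simp_rw [neg_div, div_eq_mul_inv] at h1
  rw [intervalIntegral.integral_neg, intervalIntegral.integral_mul_const] at h1
  linear_combination -h1

theorem eq_integral (h : IsSaddleFamily p I κ J vinf uinf V U) (hs : s ∈ J) (a x : ℝ) :
    V s x = V s a + (x - a) * deriv (V s) a -
      (1 / κ) * ∫ t in a..x, (x - t) * force p vinf s (V s t) := by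
  have hd : ∀ t, HasDerivAt (fun t => V s t + (x - t) * deriv (V s) t)
      (-(1 / κ) * ((x - t) * force p vinf s (V s t))) t := fun t => by
    refine (((h.wave s hs).wave.hasDerivAt_v t).add (((hasDerivAt_id t).const_sub x).mul
      ((h.wave s hs).hasDerivAt_deriv t))).congr_deriv ?_
    simp
    ring
  have hc : Continuous fun t => (x - t) * force p vinf s (V s t) :=
    (continuous_const.sub continuous_id).mul
      (continuous_slice (G := fun σ x => force p vinf σ (V σ x)) h.continuousOn_force hs)
  have h1 := intervalIntegral.integral_eq_sub_of_hasDerivAt (fun t _ => hd t) (a := a) (b := x)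
    ((hc.const_mul _).intervalIntegrable a x)
  rw [intervalIntegral.integral_const_mul] at h1
  linear_combination -h1

theorem exists_hasDerivAt_deriv_zero (h : IsSaddleFamily p I κ J vinf uinf V U) (hs : s ∈ J) :
    DifferentiableAt ℝ (fun σ => deriv (V σ) 0) s := by
  have h1 := hasDerivAt_integral_slice (G := fun σ t => (1 - t) * force p vinf σ (V σ t))
    (G' := fun σ t => (1 - t) * forceSpeed p vinf V σ t) h.isOpen
    ((continuous_const.sub continuous_snd).continuousOn.mul h.continuousOn_force)
    ((continuous_const.sub continuous_snd).continuousOn.mul h.continuousOn_forceSpeed)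
    (fun σ hσ t => (h.hasDerivAt_force_speed hσ t).const_mul _) hs 0 1
  have h2 := (((h.hasDerivAt_speed hs 1).sub (h.hasDerivAt_speed hs 0)).add
    (h1.const_mul (1 / κ))).differentiableAt
  refine h2.congr_of_eventuallyEq ?_
  filter_upwards [h.isOpen.mem_nhds hs] with σ hσ
  have := h.eq_integral hσ 0 1
  simp only [sub_zero, one_mul] at this
  simp only [Pi.add_apply, Pi.sub_apply]
  linear_combination -this

theorem hasDerivAt_deriv_speed_aux (h : IsSaddleFamily p I κ J vinf uinf V U) (hs : s ∈ J)
    (x : ℝ) : HasDerivAt (fun σ => deriv (V σ) x) (deriv (fun σ => deriv (V σ) 0) s -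
      (1 / κ) * ∫ t in (0 : ℝ)..x, forceSpeed p vinf V s t) s := by
  have h1 := hasDerivAt_integral_slice (G := fun σ t => force p vinf σ (V σ t)) h.isOpen
    h.continuousOn_force h.continuousOn_forceSpeed (fun σ hσ t => h.hasDerivAt_force_speed hσ t)
    hs 0 x
  refine ((h.exists_hasDerivAt_deriv_zero hs).hasDerivAt.sub
    (h1.const_mul (1 / κ))).congr_of_eventuallyEq ?_
  filter_upwards [h.isOpen.mem_nhds hs] with σ hσ
  rw [h.deriv_eq_integral hσ 0 x]
  rfl

theorem hasDerivAt_deriv_speed (h : IsSaddleFamily p I κ J vinf uinf V U) (hs : s ∈ J) (x : ℝ) :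
    HasDerivAt (fun σ => deriv (V σ) x) (speedDeriv (fun σ => deriv (V σ)) s x) s :=
  (h.hasDerivAt_deriv_speed_aux hs x).differentiableAt.hasDerivAt

theorem continuous_forceSpeed (h : IsSaddleFamily p I κ J vinf uinf V U) (hs : s ∈ J) :
    Continuous (forceSpeed p vinf V s) := continuous_slice h.continuousOn_forceSpeed hs

theorem hasDerivAt_speedDeriv_deriv (h : IsSaddleFamily p I κ J vinf uinf V U) (hs : s ∈ J)
    (x : ℝ) : HasDerivAt (speedDeriv (fun σ => deriv (V σ)) s) (-forceSpeed p vinf V s x / κ) x := by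
  have e : speedDeriv (fun σ => deriv (V σ)) s = fun x => deriv (fun σ => deriv (V σ) 0) s -
      (1 / κ) * ∫ t in (0 : ℝ)..x, forceSpeed p vinf V s t :=
    funext fun x => (h.hasDerivAt_deriv_speed_aux hs x).deriv
  rw [e]
  refine ((((h.continuous_forceSpeed hs).integral_hasStrictDerivAt 0 x).hasDerivAt.const_mul
    (1 / κ)).const_sub _).congr_deriv ?_
  ring

theorem hasDerivAt_speedDeriv (h : IsSaddleFamily p I κ J vinf uinf V U) (hs : s ∈ J) (x : ℝ) :
    HasDerivAt (speedDeriv V s) (speedDeriv (fun σ => deriv (V σ)) s x) x := by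
  have e : speedDeriv V s = fun x => speedDeriv V s 0 + x * deriv (fun σ => deriv (V σ) 0) s -
      (1 / κ) * (x * (∫ t in (0 : ℝ)..x, forceSpeed p vinf V s t) -
        ∫ t in (0 : ℝ)..x, t * forceSpeed p vinf V s t) := funext fun x => by
    have h1 := hasDerivAt_integral_slice (G := fun σ t => (x - t) * force p vinf σ (V σ t))
      (G' := fun σ t => (x - t) * forceSpeed p vinf V σ t) h.isOpen
      ((continuous_const.sub continuous_snd).continuousOn.mul h.continuousOn_force)
      ((continuous_const.sub continuous_snd).continuousOn.mul h.continuousOn_forceSpeed)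
      (fun σ hσ t => (h.hasDerivAt_force_speed hσ t).const_mul _) hs 0 x
    have h2 := ((h.hasDerivAt_speed hs 0).add
      ((h.exists_hasDerivAt_deriv_zero hs).hasDerivAt.const_mul x)).sub (h1.const_mul (1 / κ))
    have h3 := (h2.congr_of_eventuallyEq (f₁ := fun σ => V σ x) (by
      filter_upwards [h.isOpen.mem_nhds hs] with σ hσ
      simpa using h.eq_integral hσ 0 x)).unique (h.hasDerivAt_speed hs x)
    rw [← h3, ← intervalIntegral.integral_const_mul x, ← intervalIntegral.integral_sub]
    · simp only [sub_mul]
    · exact (continuous_const.mul (h.continuous_forceSpeed hs)).intervalIntegrable _ _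
    · exact (continuous_id.mul (h.continuous_forceSpeed hs)).intervalIntegrable _ _
  rw [show speedDeriv (fun σ => deriv (V σ)) s x = _ from
    (h.hasDerivAt_deriv_speed_aux hs x).deriv]
  nth_rewrite 1 [e]
  have i1 := ((h.continuous_forceSpeed hs).integral_hasStrictDerivAt 0 x).hasDerivAt
  have i2 := ((continuous_id.mul (h.continuous_forceSpeed hs)).integral_hasStrictDerivAt 0 x).hasDerivAt
  refine ((((hasDerivAt_id x).mul_const _).const_add _).sub
    ((((hasDerivAt_id x).mul i1).sub i2).const_mul (1 / κ))).congr_deriv ?_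
  simp

/-- The linearized energy relation satisfied by the derivative of the family with respect to the
speed. -/
theorem energy_speed (h : IsSaddleFamily p I κ J vinf uinf V U) (hs : s ∈ J) (x : ℝ) :
    κ * (deriv (V s) x * speedDeriv (fun σ => deriv (V σ)) s x) +
      force p vinf s (V s x) * speedDeriv V s x + s * (V s x - vinf) ^ 2 = 0 := by
  have hw := h.wave s hs
  have h1 := ((h.hasDerivAt_deriv_speed hs x).pow 2).const_mul (κ / 2)
  have h2 := (hasDerivAt_primitive (vinf := vinf) hw.isOpen hw.contDiffOn.continuousOn
    (hw.wave.uIcc_subset hw.mem_inf x)).comp s (h.hasDerivAt_speed hs x)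
  have h3 := ((hasDerivAt_pow 2 s).div_const 2).mul (((h.hasDerivAt_speed hs x).sub_const vinf).pow 2)
  have h4 := (h1.add (h2.add h3)).congr_of_eventuallyEq (f₁ := fun _ => (0 : ℝ)) (by
    filter_upwards [h.isOpen.mem_nhds hs] with σ hσ
    exact ((h.wave σ hσ).energy x).symm)
  have h5 := h4.unique (hasDerivAt_const s 0)
  simp at h5
  unfold force
  linear_combination h5

theorem hasDerivAt_potential_speed (h : IsSaddleFamily p I κ J vinf uinf V U) (hs : s ∈ J)
    (x : ℝ) : HasDerivAt (fun σ => deriv (V σ) x ^ 2)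
      (-(2 / κ) * (force p vinf s (V s x) * speedDeriv V s x + s * (V s x - vinf) ^ 2)) s := by
  refine ((h.hasDerivAt_deriv_speed hs x).pow 2).congr_deriv ?_
  have := h.energy_speed hs x
  have hk := (h.wave s hs).pos.ne'
  field_simp
  simp
  linear_combination 2 * this

end IsSaddleFamily
end
end Korteweg
namespace Korteweg
noncomputable section

theorem add_mul_exp_le {A D g t : ℝ} (hA : 0 ≤ A) (hD : 0 ≤ D) (hg : 0 < g) (ht : 0 ≤ t) :
    (A + D * t) * Real.exp (-g * t) ≤ (A + 2 * D / g) * Real.exp (-(g / 2) * t) := by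
  have e : Real.exp (-g * t) = Real.exp (-(g / 2) * t) * Real.exp (-(g / 2) * t) := by
    rw [← Real.exp_add]; congr 1; ring
  have e1 : Real.exp (-(g / 2) * t) * Real.exp (g / 2 * t) = 1 := by
    rw [← Real.exp_add]; simp
  have h1 := Real.add_one_le_exp (g / 2 * t)
  have h2 : t ≤ 2 / g * Real.exp (g / 2 * t) := by
    rw [div_mul_eq_mul_div, le_div_iff₀ hg]; linarith
  have h3 : A + D * t ≤ (A + 2 * D / g) * Real.exp (g / 2 * t) := by
    have h4 : A * 1 ≤ A * Real.exp (g / 2 * t) :=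
      mul_le_mul_of_nonneg_left (by linarith [mul_nonneg (half_pos hg).le ht]) hA
    have h5 := mul_le_mul_of_nonneg_left h2 hD
    calc A + D * t ≤ A * Real.exp (g / 2 * t) + D * (2 / g * Real.exp (g / 2 * t)) := by linarith
      _ = _ := by ring
  have hp := Real.exp_pos (-(g / 2) * t)
  calc (A + D * t) * Real.exp (-g * t)
      ≤ (A + 2 * D / g) * Real.exp (g / 2 * t) * Real.exp (-g * t) :=
        mul_le_mul_of_nonneg_right h3 (Real.exp_pos _).le
    _ = _ := by rw [e]; linear_combination (A + 2 * D / g) * Real.exp (-(g / 2) * t) * e1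

namespace IsSaddleFamily

variable {p : ℝ → ℝ} {I : Set ℝ} {κ vinf uinf s s₀ : ℝ} {J : Set ℝ} {V U : ℝ → ℝ → ℝ}

theorem hasDerivAt_ratio (h : IsSaddleFamily p I κ J vinf uinf V U) (hs : s ∈ J) {x : ℝ}
    (hx : deriv (V s) x ≠ 0) : HasDerivAt (fun x => speedDeriv V s x / deriv (V s) x)
      (-(s * (V s x - vinf) ^ 2) / (κ * deriv (V s) x ^ 2)) x := by
  refine ((h.hasDerivAt_speedDeriv hs x).div ((h.wave s hs).hasDerivAt_deriv x) hx).congr_deriv ?_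
  have := h.energy_speed hs x
  have hk := (h.wave s hs).pos.ne'
  field_simp
  linear_combination this

theorem exists_tail_bound (h : IsSaddleFamily p I κ J vinf uinf V U) (hs₀ : s₀ ∈ J) :
    ∃ g > 0, ∃ K X : ℝ, ∀ᶠ s in 𝓝 s₀, ∀ x, X ≤ x → |V s x - vinf| ≤ K * Real.exp (-g * x) ∧
      |deriv (V s) x| ≤ K * Real.exp (-g * x) ∧ |speedDeriv V s x| ≤ K * Real.exp (-g * x) := by
  have h₀ := h.wave s₀ hs₀
  obtain ⟨ε, hε, g, hg, Γ, hΓ, -, hb⟩ := exists_saddle_bounds h₀.isOpen h₀.contDiffOn h₀.pos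
    h₀.mem_inf h₀.saddle
  have hsq : ∀ s ∈ J, (∀ y, |y - vinf| ≤ ε → g ^ 2 * (y - vinf) ^ 2 ≤ -(2 / κ) * potential p vinf s y ∧
        -(2 / κ) * potential p vinf s y ≤ Γ ^ 2 * (y - vinf) ^ 2) →
      ∀ x, |V s x - vinf| ≤ ε → g ^ 2 * (V s x - vinf) ^ 2 ≤ deriv (V s) x ^ 2 ∧
        deriv (V s) x ^ 2 ≤ Γ ^ 2 * (V s x - vinf) ^ 2 := fun s hs hb x hx => by
    rw [(h.wave s hs).deriv_sq]; exact hb _ hx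
  have hne : ∀ s ∈ J, ∀ x, V s x - vinf ≠ 0 := fun s hs x => sub_ne_zero.2 ((h.wave s hs).ne_inf x)
  obtain ⟨X, hX1, hX2⟩ := (eventually_pointing hg hε h₀.hasDerivAt_sub h₀.wave.continuous_deriv
    (hne s₀ hs₀) (fun x hx => (hsq s₀ hs₀ hb.self_of_nhds.2 x hx).1) h₀.tendsto_sub).exists
  have hslice : ∀ G : ℝ → ℝ → ℝ, ContinuousOn (fun q : ℝ × ℝ => G q.1 q.2) (J ×ˢ Set.univ) →
      ContinuousAt (fun s => G s X) s₀ := fun G hG =>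
    ContinuousAt.comp (f := fun s : ℝ => (s, X)) (g := fun q : ℝ × ℝ => G q.1 q.2)
      (hG.continuousAt (h.isOpen_prod.mem_nhds ⟨hs₀, trivial⟩))
      (by fun_prop)
  have cV := (hslice V h.continuousOn).sub_const vinf
  have cD := hslice (fun s x => deriv (V s) x) h.continuousOn_deriv
  have cY := hslice _ h.continuousOn_speedDeriv
  have hD0 : deriv (V s₀) X ≠ 0 := right_ne_zero_of_mul hX2.ne
  have cR := (cY.div cD hD0).abs
  set A := |speedDeriv V s₀ X / deriv (V s₀) X| + 1 with hAdef
  set D := (|s₀| + 1) / (κ * g ^ 2) with hDdef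
  have hκ := h₀.pos
  have hA : 0 ≤ A := by positivity
  have hD : 0 ≤ D := by positivity
  refine ⟨g / 2, by positivity, (max ε (max (Γ * ε) ((A + 2 * D / g) * (Γ * ε)))) *
    Real.exp (g / 2 * X), X, ?_⟩
  filter_upwards [hb, h.isOpen.mem_nhds hs₀, cV.abs.eventually_lt_const hX1,
    (cV.mul cD).eventually_lt_const hX2, cR.eventually_lt_const (lt_add_one _),
    continuous_abs.continuousAt.eventually_lt_const (lt_add_one |s₀|)] with s hbs hs h1 h2 h3 h4 x hx
  have hw := h.wave s hs
  have htail := fun z (hz : X ≤ z) => tail_trapped hg hw.hasDerivAt_sub hw.wave.continuous_deriv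
    (hne s hs) (fun x hx => (hsq s hs hbs.2 x hx).1) h1 h2 hz
  have hdne : ∀ z, X ≤ z → deriv (V s) z ≠ 0 := fun z hz => right_ne_zero_of_mul (htail z hz).2.1.ne
  have hexp : ∀ t, Real.exp (g / 2 * X) * Real.exp (-(g / 2) * t) = Real.exp (-(g / 2) * (t - X)) :=
    fun t => by rw [← Real.exp_add]; congr 1; ring
  have ht : 0 ≤ x - X := by linarith
  have hle : Real.exp (-g * (x - X)) ≤ Real.exp (-(g / 2) * (x - X)) :=
    Real.exp_le_exp.2 (by nlinarith)
  have hwx : |V s x - vinf| ≤ ε * Real.exp (-g * (x - X)) :=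
    (htail x hx).2.2.trans (mul_le_mul_of_nonneg_right h1.le (Real.exp_pos _).le)
  have hdx : |deriv (V s) x| ≤ Γ * ε * Real.exp (-g * (x - X)) := by
    have h5 := (hsq s hs hbs.2 x (htail x hx).1.le).2
    rw [← mul_pow] at h5
    have h6 := sq_le_sq.1 h5
    rw [abs_mul, abs_of_pos hΓ] at h6
    calc _ ≤ Γ * |V s x - vinf| := h6
      _ ≤ Γ * (ε * Real.exp (-g * (x - X))) := by gcongr
      _ = _ := by ring
  have hr : |speedDeriv V s x / deriv (V s) x| ≤ A + D * (x - X) := by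
    have hmv := (convex_Icc X x).norm_image_sub_le_of_norm_hasDerivWithin_le
      (f := fun x => speedDeriv V s x / deriv (V s) x) (C := D)
      (fun z hz => (h.hasDerivAt_ratio hs (hdne z hz.1)).hasDerivWithinAt) (fun z hz => ?_)
      (Set.left_mem_Icc.2 hx) (Set.right_mem_Icc.2 hx)
    · rw [Real.norm_eq_abs, Real.norm_eq_abs, abs_of_nonneg ht] at hmv
      have := abs_sub_abs_le_abs_sub (speedDeriv V s x / deriv (V s) x)
        (speedDeriv V s X / deriv (V s) X)
      simp only [Pi.div_apply] at h3
      linarith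
    · have h5 := (hsq s hs hbs.2 z (htail z hz.1).1.le).1
      have hdz := hdne z hz.1
      have hpos : 0 < deriv (V s) z ^ 2 := by positivity
      rw [Real.norm_eq_abs, abs_div, abs_neg, abs_mul, abs_of_nonneg (sq_nonneg (V s z - vinf)),
        abs_of_pos (show 0 < κ * deriv (V s) z ^ 2 by positivity), hDdef,
        div_le_div_iff₀ (by positivity) (by positivity)]
      have h6 : |s| * (κ * (g ^ 2 * (V s z - vinf) ^ 2)) ≤ (|s₀| + 1) * (κ * deriv (V s) z ^ 2) := by
        gcongr
      linarith
  have hyx : |speedDeriv V s x| ≤ (A + 2 * D / g) * (Γ * ε) * Real.exp (-(g / 2) * (x - X)) := by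
    have e : speedDeriv V s x = speedDeriv V s x / deriv (V s) x * deriv (V s) x :=
      (div_mul_cancel₀ _ (hdne x hx)).symm
    rw [e, abs_mul]
    calc _ ≤ (A + D * (x - X)) * (Γ * ε * Real.exp (-g * (x - X))) := by gcongr
      _ = (Γ * ε) * ((A + D * (x - X)) * Real.exp (-g * (x - X))) := by ring
      _ ≤ (Γ * ε) * ((A + 2 * D / g) * Real.exp (-(g / 2) * (x - X))) := by
        exact mul_le_mul_of_nonneg_left (add_mul_exp_le hA hD hg ht) (by positivity)
      _ = _ := by ring
  have hE := (Real.exp_pos (-(g / 2) * (x - X))).le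
  simp only [mul_assoc, hexp]
  refine ⟨hwx.trans ?_, hdx.trans ?_, hyx.trans ?_⟩
  · exact mul_le_mul (le_max_left _ _) hle (Real.exp_pos _).le (hε.le.trans (le_max_left _ _))
  · exact mul_le_mul ((le_max_left _ _).trans (le_max_right _ _)) hle (Real.exp_pos _).le
      (hε.le.trans (le_max_left _ _))
  · exact mul_le_mul_of_nonneg_right ((le_max_right _ _).trans (le_max_right _ _)) hE

/-- Exponential localization of the waves and of their derivatives, uniformly in the speed. -/
theorem exists_uniform_bound (h : IsSaddleFamily p I κ J vinf uinf V U) (hs₀ : s₀ ∈ J) :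
    ∃ g > 0, ∃ K : ℝ, ∀ᶠ s in 𝓝 s₀, ∀ x, |V s x - vinf| ≤ K * Real.exp (-g * |x|) ∧
      |deriv (V s) x| ≤ K * Real.exp (-g * |x|) ∧ |speedDeriv V s x| ≤ K * Real.exp (-g * |x|) := by
  obtain ⟨g₁, hg₁, K₁, X₁, hb₁⟩ := h.exists_tail_bound hs₀
  obtain ⟨g₂, hg₂, K₂, X₂, hb₂⟩ := h.comp_neg.exists_tail_bound hs₀
  set X := max 0 (max X₁ X₂) with hX
  have hX0 : 0 ≤ X := le_max_left _ _
  obtain ⟨C₁, hC₁⟩ := exists_bound_slice (G := fun s x => V s x - vinf) h.isOpen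
    (h.continuousOn.sub continuousOn_const) hs₀ (-X) X
  obtain ⟨C₂, hC₂⟩ := exists_bound_slice (G := fun s x => deriv (V s) x) h.isOpen
    h.continuousOn_deriv hs₀ (-X) X
  obtain ⟨C₃, hC₃⟩ := exists_bound_slice h.isOpen h.continuousOn_speedDeriv hs₀ (-X) X
  set g := min g₁ g₂ with hgdef
  have hg : 0 < g := lt_min hg₁ hg₂
  set C := max |C₁| (max |C₂| |C₃|) * Real.exp (g * X) with hC
  refine ⟨g, hg, max C (max |K₁| |K₂|), ?_⟩
  filter_upwards [hb₁, hb₂, hC₁, hC₂, hC₃] with s h1 h2 h3 h4 h5 x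
  have hcomp : ∀ a K g' : ℝ, g ≤ g' → |K| ≤ max |K₁| |K₂| → a ≤ K * Real.exp (-g' * |x|) →
      a ≤ max C (max |K₁| |K₂|) * Real.exp (-g * |x|) := fun a K g' hg' hK ha => by
    refine ha.trans ?_
    calc K * Real.exp (-g' * |x|) ≤ |K| * Real.exp (-g * |x|) :=
          mul_le_mul (le_abs_self K) (Real.exp_le_exp.2 (by nlinarith [abs_nonneg x]))
            (Real.exp_pos _).le (abs_nonneg K)
      _ ≤ _ := mul_le_mul_of_nonneg_right (hK.trans (le_max_right _ _)) (Real.exp_pos _).le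
  rcases le_total X x with hx | hx
  · have hx1 : X₁ ≤ x := ((le_max_left _ _).trans (le_max_right _ _)).trans hx
    have := h1 x hx1
    have e : Real.exp (-g₁ * x) = Real.exp (-g₁ * |x|) := by rw [abs_of_nonneg (hX0.trans hx)]
    rw [e] at this
    exact ⟨hcomp _ _ _ (min_le_left _ _) (le_max_left _ _) this.1,
      hcomp _ _ _ (min_le_left _ _) (le_max_left _ _) this.2.1,
      hcomp _ _ _ (min_le_left _ _) (le_max_left _ _) this.2.2⟩
  rcases le_total x (-X) with hx' | hx'
  · have hx1 : X₂ ≤ -x := ((le_max_right _ _).trans (le_max_right _ _)).trans (le_neg_of_le_neg hx')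
    have := h2 (-x) hx1
    have e : Real.exp (-g₂ * -x) = Real.exp (-g₂ * |x|) := by
      rw [abs_of_nonpos (by linarith)]
    rw [e, deriv_comp_neg (V s), neg_neg, abs_neg] at this
    have e2 : speedDeriv (fun s x => V s (-x)) s (-x) = speedDeriv V s x := by
      simp [speedDeriv]
    rw [e2] at this
    exact ⟨hcomp _ _ _ (min_le_right _ _) (le_max_right _ _) this.1,
      hcomp _ _ _ (min_le_right _ _) (le_max_right _ _) this.2.1,
      hcomp _ _ _ (min_le_right _ _) (le_max_right _ _) this.2.2⟩
  · have hxX : |x| ≤ X := abs_le.2 ⟨hx', hx⟩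
    have hmid : ∀ a c : ℝ, |c| ≤ max |C₁| (max |C₂| |C₃|) → a ≤ c →
        a ≤ max C (max |K₁| |K₂|) * Real.exp (-g * |x|) := fun a c hc ha => by
      have h6 : 1 ≤ Real.exp (g * X) * Real.exp (-g * |x|) := by
        rw [← Real.exp_add]
        exact Real.one_le_exp (by nlinarith)
      calc a ≤ |c| * 1 := by linarith [le_abs_self c]
        _ ≤ max |C₁| (max |C₂| |C₃|) * (Real.exp (g * X) * Real.exp (-g * |x|)) :=
          mul_le_mul hc h6 zero_le_one ((abs_nonneg c).trans hc)
        _ = C * Real.exp (-g * |x|) := by rw [hC]; ring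
        _ ≤ _ := mul_le_mul_of_nonneg_right (le_max_left _ _) (Real.exp_pos _).le
    exact ⟨hmid _ _ (le_max_left _ _) (h3 x ⟨hx', hx⟩),
      hmid _ _ ((le_max_left _ _).trans (le_max_right _ _)) (h4 x ⟨hx', hx⟩),
      hmid _ _ ((le_max_right _ _).trans (le_max_right _ _)) (h5 x ⟨hx', hx⟩)⟩

end IsSaddleFamily
end
end Korteweg
namespace Korteweg
noncomputable section

namespace IsSaddleWave

variable {p : ℝ → ℝ} {I : Set ℝ} {κ s vinf uinf : ℝ} {v u : ℝ → ℝ}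

theorem energyDensity_eq (h : IsSaddleWave p I κ s vinf uinf v u) (x : ℝ) :
    energyDensity p κ vinf uinf v u x = κ * deriv v x ^ 2 + s ^ 2 * (v x - vinf) ^ 2 := by
  have h1 := h.energy x
  unfold potential at h1
  unfold energyDensity
  rw [h.wave.u_eq]
  linear_combination -h1

theorem momentumDensity_eq (h : IsSaddleWave p I κ s vinf uinf v u) (x : ℝ) :
    momentumDensity vinf uinf v u x = -s * (v x - vinf) ^ 2 := by
  unfold momentumDensity
  rw [h.wave.u_eq]
  ring

end IsSaddleWave

theorem integrable_of_abs_le_exp {f : ℝ → ℝ} (hf : Continuous f) {K g : ℝ} (hg : 0 < g)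
    (h : ∀ x, |f x| ≤ K * Real.exp (-g * |x|)) : Integrable f :=
  ((integrable_exp_neg_mul_abs hg).const_mul K).mono' hf.aestronglyMeasurable
    (Eventually.of_forall h)

theorem abs_mul_le_exp {a b K L g x : ℝ} (ha : |a| ≤ K * Real.exp (-g * |x|))
    (hb : |b| ≤ L) : |a * b| ≤ K * L * Real.exp (-g * |x|) := by
  rw [abs_mul]
  calc |a| * |b| ≤ K * Real.exp (-g * |x|) * L :=
        mul_le_mul ha hb (abs_nonneg b) ((abs_nonneg a).trans ha)
    _ = _ := by ring

theorem le_of_le_exp {a K g x : ℝ} (hg : 0 < g) (ha : |a| ≤ K * Real.exp (-g * |x|)) : |a| ≤ K := by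
  refine ha.trans (mul_le_of_le_one_right ?_ (Real.exp_le_one_iff.2 (by nlinarith [abs_nonneg x])))
  exact le_of_mul_le_mul_right (by simpa using (abs_nonneg a).trans ha) (Real.exp_pos (-g * |x|))

namespace IsSaddleFamily

variable {p : ℝ → ℝ} {I : Set ℝ} {κ vinf uinf s s₀ : ℝ} {J : Set ℝ} {V U : ℝ → ℝ → ℝ}

theorem exists_integrable (h : IsSaddleFamily p I κ J vinf uinf V U) (hs₀ : s₀ ∈ J) :
    ∀ᶠ s in 𝓝 s₀, Integrable (fun x => deriv (V s) x ^ 2) ∧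
      Integrable (fun x => (V s x - vinf) ^ 2) := by
  obtain ⟨g, hg, K, hb⟩ := h.exists_uniform_bound hs₀
  filter_upwards [hb, h.isOpen.mem_nhds hs₀] with s hs hsJ
  have hw := (h.wave s hsJ).wave
  have hc1 := hw.continuous_v
  have hc2 := hw.continuous_deriv
  constructor
  · refine integrable_of_abs_le_exp (K := K * K) (by fun_prop) hg fun x => ?_
    rw [sq]
    exact abs_mul_le_exp (hs x).2.1 (le_of_le_exp hg (hs x).2.1)
  · refine integrable_of_abs_le_exp (K := K * K) (by fun_prop) hg fun x => ?_
    rw [sq]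
    exact abs_mul_le_exp (hs x).1 (le_of_le_exp hg (hs x).1)

theorem moment_eq (h : IsSaddleFamily p I κ J vinf uinf V U) (hs₀ : s₀ ∈ J) :
    ∀ᶠ s in 𝓝 s₀, momentOfInstability p κ vinf uinf V U s = κ * ∫ x, deriv (V s) x ^ 2 := by
  filter_upwards [h.exists_integrable hs₀, h.isOpen.mem_nhds hs₀] with s hs hsJ
  unfold momentOfInstability hamiltonian momentum
  simp_rw [(h.wave s hsJ).energyDensity_eq, (h.wave s hsJ).momentumDensity_eq]
  rw [integral_add (hs.1.const_mul κ) (hs.2.const_mul _), integral_const_mul, integral_const_mul,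
    integral_const_mul]
  ring

theorem exists_integrable_density (h : IsSaddleFamily p I κ J vinf uinf V U) (hs₀ : s₀ ∈ J) :
    ∀ᶠ s in 𝓝 s₀, Integrable (energyDensity p κ vinf uinf (V s) (U s)) ∧
      Integrable (momentumDensity vinf uinf (V s) (U s)) := by
  filter_upwards [h.exists_integrable hs₀, h.isOpen.mem_nhds hs₀] with s hs hsJ
  rw [funext (h.wave s hsJ).energyDensity_eq, funext (h.wave s hsJ).momentumDensity_eq]
  exact ⟨(hs.1.const_mul κ).add (hs.2.const_mul _), hs.2.const_mul _⟩

theorem exists_force_bound (h : IsSaddleFamily p I κ J vinf uinf V U) (hs₀ : s₀ ∈ J) :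
    ∃ M, ∀ᶠ s in 𝓝 s₀, ∀ x, |force p vinf s (V s x)| ≤ M := by
  have h₀ := h.wave s₀ hs₀
  obtain ⟨g, hg, K, hb⟩ := h.exists_uniform_bound hs₀
  obtain ⟨r, hr, hsub⟩ := Metric.nhds_basis_closedBall.mem_iff.1 (h₀.isOpen.mem_nhds h₀.mem_inf)
  have hlim : Tendsto (fun x : ℝ => K * Real.exp (-g * x)) atTop (𝓝 0) := by
    have : Tendsto (fun x : ℝ => Real.exp (-g * x)) atTop (𝓝 0) :=
      Real.tendsto_exp_atBot.comp (tendsto_id.const_mul_atTop_of_neg (neg_lt_zero.2 hg))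
    simpa using this.const_mul K
  obtain ⟨X, hX⟩ := eventually_atTop.1 (hlim.eventually_lt_const hr)
  obtain ⟨C, hC⟩ := exists_bound_slice (G := fun s x => force p vinf s (V s x)) h.isOpen
    h.continuousOn_force hs₀ (-X) X
  have hp : ContinuousOn (fun q : ℝ × ℝ => force p vinf q.1 q.2)
      (Metric.closedBall s₀ 1 ×ˢ Metric.closedBall vinf r) := by
    have : ContinuousOn (fun q : ℝ × ℝ => p q.2) (Metric.closedBall s₀ 1 ×ˢ Metric.closedBall vinf r) :=
      h₀.contDiffOn.continuousOn.comp continuous_snd.continuousOn fun q hq => hsub hq.2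
    exact (this.sub continuousOn_const).add (by fun_prop)
  obtain ⟨C', hC'⟩ := ((isCompact_closedBall s₀ 1).prod
    (isCompact_closedBall vinf r)).exists_bound_of_continuousOn hp
  refine ⟨max C C', ?_⟩
  filter_upwards [hb, hC, Metric.closedBall_mem_nhds s₀ one_pos] with s h1 h2 h3 x
  by_cases hx : |x| ≤ X
  · exact (h2 x (abs_le.1 hx)).trans (le_max_left _ _)
  · refine (hC' (s, V s x) ⟨h3, ?_⟩).trans (le_max_right _ _)
    rw [Metric.mem_closedBall, Real.dist_eq]
    exact (h1 x).1.trans (hX _ (not_le.1 hx).le).le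

theorem continuous_force (h : IsSaddleFamily p I κ J vinf uinf V U) (hs : s ∈ J) :
    Continuous fun x => force p vinf s (V s x) :=
  continuous_slice (G := fun s x => force p vinf s (V s x)) h.continuousOn_force hs

theorem continuous_speedDeriv (h : IsSaddleFamily p I κ J vinf uinf V U) (hs : s ∈ J) :
    Continuous (speedDeriv V s) := continuous_slice h.continuousOn_speedDeriv hs

/-- The virial identity for the derivative of the family with respect to the speed. -/
theorem integral_force_mul_speedDeriv (h : IsSaddleFamily p I κ J vinf uinf V U) (hs₀ : s₀ ∈ J) :
    Integrable (fun x => force p vinf s₀ (V s₀ x) * speedDeriv V s₀ x) ∧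
    2 * ∫ x, force p vinf s₀ (V s₀ x) * speedDeriv V s₀ x = -s₀ * ∫ x, (V s₀ x - vinf) ^ 2 := by
  have hw := h.wave s₀ hs₀
  obtain ⟨g, hg, K, hb⟩ := h.exists_uniform_bound hs₀
  obtain ⟨M, hM⟩ := h.exists_force_bound hs₀
  have hb := hb.self_of_nhds
  have hM := hM.self_of_nhds
  have hi2 := (h.exists_integrable hs₀).self_of_nhds.2
  have hi1 : Integrable (fun x => force p vinf s₀ (V s₀ x) * speedDeriv V s₀ x) := by
    refine integrable_of_abs_le_exp (K := K * M)
      ((h.continuous_force hs₀).mul (h.continuous_speedDeriv hs₀)) hg fun x => ?_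
    rw [mul_comm]
    exact abs_mul_le_exp (hb x).2.2 (hM x)
  refine ⟨hi1, ?_⟩
  have hlim : Tendsto (fun x : ℝ => K * K * Real.exp (-g * |x|)) (cocompact ℝ) (𝓝 0) := by
    have h1 : Tendsto (fun x : ℝ => -g * |x|) (cocompact ℝ) atBot :=
      (tendsto_norm_cocompact_atTop (E := ℝ)).const_mul_atTop_of_neg (neg_lt_zero.2 hg)
    simpa using (Real.tendsto_exp_atBot.comp h1).const_mul (K * K)
  have hlim2 : Tendsto (fun x => deriv (V s₀) x * speedDeriv V s₀ x) (cocompact ℝ) (𝓝 0) := by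
    refine squeeze_zero_norm (fun x => ?_) hlim
    exact abs_mul_le_exp (hb x).2.1 (le_of_le_exp hg (hb x).2.2)
  rw [cocompact_eq_atBot_atTop, tendsto_sup] at hlim2
  have hd : ∀ x, HasDerivAt (fun x => deriv (V s₀) x * speedDeriv V s₀ x)
      (-(1 / κ) * (2 * (force p vinf s₀ (V s₀ x) * speedDeriv V s₀ x) +
        s₀ * (V s₀ x - vinf) ^ 2)) x := fun x => by
    refine ((hw.hasDerivAt_deriv x).mul (h.hasDerivAt_speedDeriv hs₀ x)).congr_deriv ?_
    have := h.energy_speed hs₀ x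
    have hk := hw.pos.ne'
    field_simp
    linear_combination this
  have h3 := integral_of_hasDerivAt_of_tendsto hd
    (((hi1.const_mul 2).add (hi2.const_mul s₀)).const_mul (-(1 / κ))) hlim2.1 hlim2.2
  rw [integral_const_mul, integral_add (hi1.const_mul 2) (hi2.const_mul s₀), integral_const_mul,
    integral_const_mul, sub_zero, mul_eq_zero] at h3
  have hk : -(1 / κ) ≠ 0 := by have := hw.pos; simp; positivity
  linarith [h3.resolve_left hk]

/-- The first variation of the moment of instability. -/
theorem hasDerivAt_moment_aux (h : IsSaddleFamily p I κ J vinf uinf V U) (hs₀ : s₀ ∈ J) :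
    HasDerivAt (fun s => κ * ∫ x, deriv (V s) x ^ 2) (-s₀ * ∫ x, (V s₀ x - vinf) ^ 2) s₀ := by
  have hw := h.wave s₀ hs₀
  obtain ⟨g, hg, K, hb⟩ := h.exists_uniform_bound hs₀
  obtain ⟨M, hM⟩ := h.exists_force_bound hs₀
  have hi := h.exists_integrable hs₀
  have hs1 := continuous_abs.continuousAt.eventually_lt_const (lt_add_one |s₀|)
  have hnear := (hb.and hM).and ((h.isOpen.eventually_mem hs₀).and hs1)
  have key := (hasDerivAt_integral_of_dominated_loc_of_deriv_le (μ := volume)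
    (F := fun s x => deriv (V s) x ^ 2) (bound := fun x => (2 / κ * (K * M + (|s₀| + 1) * (K * K))) *
      Real.exp (-g * |x|)) hnear (hi.mono fun s hs => hs.1.aestronglyMeasurable)
    hi.self_of_nhds.1 (F' := fun s x => -(2 / κ) * (force p vinf s (V s x) * speedDeriv V s x +
      s * (V s x - vinf) ^ 2)) ?_ ?_ ((integrable_exp_neg_mul_abs hg).const_mul _) ?_).2
  · have h1 := h.integral_force_mul_speedDeriv hs₀
    rw [integral_const_mul, integral_add h1.1 (hi.self_of_nhds.2.const_mul _),
      integral_const_mul] at key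
    refine (key.const_mul κ).congr_deriv ?_
    have hk := hw.pos.ne'
    field_simp
    linear_combination -h1.2
  · have hc := hw.wave.continuous_v
    have hc1 := h.continuous_force hs₀
    have hc2 := h.continuous_speedDeriv hs₀
    exact Continuous.aestronglyMeasurable (by fun_prop)
  · refine Eventually.of_forall fun x s hs => ?_
    obtain ⟨⟨hb, hM⟩, hsJ, hs1⟩ := hs
    have hk := hw.pos
    have h1 := abs_mul_le_exp (hb x).2.2 (hM x)
    have h2 := abs_mul_le_exp (hb x).1 (le_of_le_exp hg (hb x).1)
    have h3 : |s * (V s x - vinf) ^ 2| ≤ (|s₀| + 1) * (K * K * Real.exp (-g * |x|)) := by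
      rw [sq, abs_mul]
      exact mul_le_mul hs1.le h2 (abs_nonneg _) (by positivity)
    rw [Real.norm_eq_abs, abs_mul, abs_neg, abs_of_pos (show 0 < 2 / κ by positivity), mul_assoc]
    refine mul_le_mul_of_nonneg_left ?_ (by positivity)
    refine (abs_add_le _ _).trans ?_
    rw [mul_comm (force _ _ _ _)]
    linarith
  · exact Eventually.of_forall fun x s hs => h.hasDerivAt_potential_speed hs.2.1 x

theorem hasDerivAt_moment (h : IsSaddleFamily p I κ J vinf uinf V U) (hs₀ : s₀ ∈ J) :
    HasDerivAt (momentOfInstability p κ vinf uinf V U) (-s₀ * ∫ x, (V s₀ x - vinf) ^ 2) s₀ :=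
  (h.hasDerivAt_moment_aux hs₀).congr_of_eventuallyEq (h.moment_eq hs₀)

theorem integrable_mul_speedDeriv (h : IsSaddleFamily p I κ J vinf uinf V U) (hs₀ : s₀ ∈ J) :
    Integrable fun x => (V s₀ x - vinf) * speedDeriv V s₀ x := by
  obtain ⟨g, hg, K, hb⟩ := h.exists_uniform_bound hs₀
  have hc := (h.wave s₀ hs₀).wave.continuous_v
  have hc2 := h.continuous_speedDeriv hs₀
  exact integrable_of_abs_le_exp (by fun_prop) hg fun x =>
    abs_mul_le_exp (hb.self_of_nhds x).1 (le_of_le_exp hg (hb.self_of_nhds x).2.2)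

/-- The second variation of the moment of instability. -/
theorem hasDerivAt_deriv_moment (h : IsSaddleFamily p I κ J vinf uinf V U) (hs₀ : s₀ ∈ J) :
    HasDerivAt (deriv (momentOfInstability p κ vinf uinf V U))
      (-(∫ x, (V s₀ x - vinf) ^ 2) - 2 * s₀ * ∫ x, (V s₀ x - vinf) * speedDeriv V s₀ x) s₀ := by
  obtain ⟨g, hg, K, hb⟩ := h.exists_uniform_bound hs₀
  have hi := h.exists_integrable hs₀
  have hnear := hb.and (h.isOpen.eventually_mem hs₀)
  have key := (hasDerivAt_integral_of_dominated_loc_of_deriv_le (μ := volume)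
    (F := fun s x => (V s x - vinf) ^ 2) (bound := fun x => 2 * (K * K * Real.exp (-g * |x|))) hnear
    (hi.mono fun s hs => hs.2.aestronglyMeasurable)
    hi.self_of_nhds.2 (F' := fun s x => 2 * ((V s x - vinf) * speedDeriv V s x))
    ((h.integrable_mul_speedDeriv hs₀).const_mul 2).aestronglyMeasurable ?_
    (((integrable_exp_neg_mul_abs hg).const_mul _).const_mul _) ?_).2
  · rw [integral_const_mul] at key
    refine (((hasDerivAt_id s₀).neg.mul key).congr_of_eventuallyEq ?_).congr_deriv ?_
    · filter_upwards [h.isOpen.mem_nhds hs₀] with s hs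
      exact (h.hasDerivAt_moment hs).deriv
    · simp
      ring
  · refine Eventually.of_forall fun x s hs => ?_
    rw [Real.norm_eq_abs, abs_mul, abs_two]
    have := abs_mul_le_exp (hs.1 x).1 (le_of_le_exp hg (hs.1 x).2.2)
    linarith
  · refine Eventually.of_forall fun x s hs => ?_
    refine (((h.hasDerivAt_speed hs.2 x).sub_const vinf).pow 2).congr_deriv ?_
    simp
    ring

end IsSaddleFamily
end
end Korteweg
namespace Korteweg
noncomputable section

section Determinant

variable {R : Type*} [CommRing R]

theorem det_of_rows (A B C D : Fin 4 → R) : (Matrix.of ![A, B, C, D]).det =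
    (A 0 * B 1 - A 1 * B 0) * (C 2 * D 3 - C 3 * D 2) -
    (A 0 * B 2 - A 2 * B 0) * (C 1 * D 3 - C 3 * D 1) +
    (A 0 * B 3 - A 3 * B 0) * (C 1 * D 2 - C 2 * D 1) +
    (A 1 * B 2 - A 2 * B 1) * (C 0 * D 3 - C 3 * D 0) -
    (A 1 * B 3 - A 3 * B 1) * (C 0 * D 2 - C 2 * D 0) +
    (A 2 * B 3 - A 3 * B 2) * (C 0 * D 1 - C 1 * D 0) := by
  rw [Matrix.det_succ_row_zero]
  have e1 : Fin.succAbove (1 : Fin 4) = ![0, 2, 3] := by decide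
  have e2 : Fin.succAbove (2 : Fin 4) = ![0, 1, 3] := by decide
  have e3 : Fin.succAbove (3 : Fin 4) = ![0, 1, 2] := by decide
  simp [Fin.sum_univ_four, Matrix.det_fin_three, e1, e2, e3, Fin.succ]
  ring

theorem det_combination_rows (A B C D : Fin 4 → R) (a b c d a' b' c' d' : R) :
    (Matrix.of ![a • A + b • B, c • A + d • B, c' • D + d' • C, a' • D + b' • C]).det =
      (a * d - b * c) * (a' * d' - b' * c') * (Matrix.of ![A, B, C, D]).det := by
  simp only [det_of_rows, Pi.add_apply, Pi.smul_apply, smul_eq_mul]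
  have h1 : ∀ i j, (a * A i + b * B i) * (c * A j + d * B j) -
      (a * A j + b * B j) * (c * A i + d * B i) = (a * d - b * c) * (A i * B j - A j * B i) :=
    fun i j => by ring
  have h2 : ∀ i j, (c' * D i + d' * C i) * (a' * D j + b' * C j) -
      (c' * D j + d' * C j) * (a' * D i + b' * C i) =
        (a' * d' - b' * c') * (C i * D j - C j * D i) := fun i j => by ring
  simp only [h1, h2]
  ring

end Determinant

theorem frequently_re_pos : ∃ᶠ z : ℂ in 𝓝[≠] 0, 0 < z.re := by
  have h : Tendsto (fun t : ℝ => (t : ℂ)) (𝓝[>] 0) (𝓝[≠] 0) := by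
    refine tendsto_nhdsWithin_iff.2 ⟨?_, ?_⟩
    · exact (Complex.continuous_ofReal.tendsto' 0 0 Complex.ofReal_zero).mono_left nhdsWithin_le_nhds
    · filter_upwards [self_mem_nhdsWithin] with t ht
      exact Complex.ofReal_ne_zero.2 (ne_of_gt ht)
  refine h.frequently (Eventually.frequently ?_)
  filter_upwards [self_mem_nhdsWithin] with t ht
  simpa using ht

/-- If an analytic vector lies in the span of two others when `Re z > 0`, then its coefficients are
analytic at the origin. -/
theorem exists_analytic_coeff {E : Type*} [NormedAddCommGroup E] [NormedSpace ℂ E]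
    [FiniteDimensional ℂ E] {X₁ X₂ Y : ℂ → E} (h₁ : AnalyticAt ℂ X₁ 0) (h₂ : AnalyticAt ℂ X₂ 0)
    (hY : AnalyticAt ℂ Y 0) (hli : LinearIndependent ℂ ![X₁ 0, X₂ 0])
    (hspan : ∀ᶠ z : ℂ in 𝓝 0, 0 < z.re → ∃ a b : ℂ, Y z = a • X₁ z + b • X₂ z) :
    ∃ f g : ℂ → ℂ, AnalyticAt ℂ f 0 ∧ AnalyticAt ℂ g 0 ∧
      ∀ᶠ z in 𝓝 0, Y z = f z • X₁ z + g z • X₂ z := by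
  have : CompleteSpace E := FiniteDimensional.complete ℂ E
  obtain ⟨G, hG⟩ := LinearMap.exists_leftInverse_of_injective
    (Fintype.linearCombination ℂ ![X₁ 0, X₂ 0])
    (LinearMap.ker_eq_bot.2 (hli.fintypeLinearCombination_injective))
  have hG1 : G (X₁ 0) = Pi.single 0 1 := by
    have := LinearMap.congr_fun hG (Pi.single 0 1)
    simpa [Fintype.linearCombination_apply_single] using this
  have hG2 : G (X₂ 0) = Pi.single 1 1 := by
    have := LinearMap.congr_fun hG (Pi.single 1 1)
    simpa [Fintype.linearCombination_apply_single] using this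
  let l : Fin 2 → E →L[ℂ] ℂ := fun i =>
    LinearMap.toContinuousLinearMap ((LinearMap.proj i).comp G)
  have hl : ∀ i v, l i v = G v i := fun i v => rfl
  have hla : ∀ i {X : ℂ → E}, AnalyticAt ℂ X 0 → AnalyticAt ℂ (fun z => l i (X z)) 0 :=
    fun i X hX => ((l i).analyticAt _).comp hX
  let Δ : ℂ → ℂ := fun z => l 0 (X₁ z) * l 1 (X₂ z) - l 0 (X₂ z) * l 1 (X₁ z)
  have hΔ : AnalyticAt ℂ Δ 0 := ((hla 0 h₁).mul (hla 1 h₂)).sub ((hla 0 h₂).mul (hla 1 h₁))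
  have hΔ0 : Δ 0 = 1 := by simp [Δ, hl, hG1, hG2]
  have hΔne : Δ 0 ≠ 0 := by rw [hΔ0]; exact one_ne_zero
  let f : ℂ → ℂ := fun z => (l 0 (Y z) * l 1 (X₂ z) - l 0 (X₂ z) * l 1 (Y z)) / Δ z
  let g : ℂ → ℂ := fun z => (l 0 (X₁ z) * l 1 (Y z) - l 0 (Y z) * l 1 (X₁ z)) / Δ z
  have hf : AnalyticAt ℂ f 0 :=
    (((hla 0 hY).mul (hla 1 h₂)).sub ((hla 0 h₂).mul (hla 1 hY))).div hΔ hΔne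
  have hg : AnalyticAt ℂ g 0 :=
    (((hla 0 h₁).mul (hla 1 hY)).sub ((hla 0 hY).mul (hla 1 h₁))).div hΔ hΔne
  refine ⟨f, g, hf, hg, ?_⟩
  have key := (hY.sub ((hf.smul h₁).add (hg.smul h₂))).frequently_zero_iff_eventually_zero.1 ?_
  · filter_upwards [key] with z hz using sub_eq_zero.1 hz
  · have hev := (hspan.and (hΔ.continuousAt.eventually_ne hΔne)).filter_mono
      (nhdsWithin_le_nhds (s := {0}ᶜ))
    refine (frequently_re_pos.and_eventually hev).mono ?_
    rintro z ⟨hz, h3, h4⟩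
    obtain ⟨a, b, hab⟩ := h3 hz
    have e1 : f z = a := by
      simp only [f]
      rw [div_eq_iff h4, hab]
      simp only [map_add, map_smul, smul_eq_mul, Δ]
      ring
    have e2 : g z = b := by
      simp only [g]
      rw [div_eq_iff h4, hab]
      simp only [map_add, map_smul, smul_eq_mul, Δ]
      ring
    simp only [Pi.sub_apply, Pi.add_apply, Pi.smul_apply', e1, e2, hab, sub_self]

theorem analyticAt_evalFun {r : ℝ} (hr : 0 < r) (W : ℝ → Fin 4 → Disc r) (x : ℝ) :
    AnalyticAt ℂ (fun z => evalFun z W x) 0 :=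
  (differentiableOn_evalFun W x).analyticAt (Metric.ball_mem_nhds _ hr)

/-- Two normalized analytic bases of decaying solutions differ by an analytic matrix, whose value at
the origin is unipotent. -/
theorem IsHalfLineBasis.exists_transition {κ s c η B r : ℝ} {α : ℝ → ℝ} {l : Filter ℝ} [l.NeBot]
    {w : Fin 4 → ℂ} {W₁ W₂ : ℝ → Fin 4 → Disc r} (hb : IsHalfLineBasis κ s α r l w W₁ W₂)
    (hr : 0 < r) (hα : IsLocalizedCoeff α c η B) (hη : 0 < η) (hw : w ≠ 0) {V : ℝ → Fin 4 → ℂ}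
    (hV : evalFun 0 W₁ = V) (hV₀ : V ≠ 0) (hVl : Tendsto V l (𝓝 0)) {Ω : Set ℂ} (hΩ : IsOpen Ω)
    (h0 : (0 : ℂ) ∈ Ω) {Y₁ Y₂ : ℂ → ℝ → Fin 4 → ℂ}
    (hY₂ : ∀ x, HasDerivAt (Y₂ 0) ((evansMatrix α κ s 0 x).mulVec (Y₂ 0 x)) x)
    (han₁ : DifferentiableOn ℂ (fun z => Y₁ z 0) Ω) (han₂ : DifferentiableOn ℂ (fun z => Y₂ z 0) Ω)
    (hm₁ : ∀ z ∈ Ω, 0 < z.re → Y₁ z ∈ decayingSolutions (evansMatrix α κ s z) l)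
    (hm₂ : ∀ z ∈ Ω, 0 < z.re → Y₂ z ∈ decayingSolutions (evansMatrix α κ s z) l)
    (hY₁V : Y₁ 0 = V) (hlim : Tendsto (Y₂ 0) l (𝓝 w)) :
    ∃ a b c d : ℂ → ℂ, AnalyticAt ℂ a 0 ∧ AnalyticAt ℂ b 0 ∧ AnalyticAt ℂ c 0 ∧ AnalyticAt ℂ d 0 ∧
      a 0 * d 0 - b 0 * c 0 = 1 ∧
      ∀ᶠ z in 𝓝 0, Y₁ z 0 = a z • evalFun z W₁ 0 + b z • evalFun z W₂ 0 ∧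
        Y₂ z 0 = c z • evalFun z W₁ 0 + d z • evalFun z W₂ 0 := by
  have hz0 : (0 : ℂ) ∈ Metric.closedBall (0 : ℂ) r := by simpa using hr.le
  have o₁ := fun x => hasDerivAt_evalFun hz0 (hb.ode₁ x)
  have o₂ := fun x => hasDerivAt_evalFun hz0 (hb.ode₂ x)
  have hcomb : ∀ (x y : ℂ) (Z : ℝ → Fin 4 → ℂ),
      (∀ x, HasDerivAt Z ((evansMatrix α κ s 0 x).mulVec (Z x)) x) →
      Z 0 = x • evalFun 0 W₁ 0 + y • evalFun 0 W₂ 0 →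
      Z = x • evalFun 0 W₁ + y • evalFun 0 W₂ := fun x y Z hZ h => by
    refine hα.unique hη (x₀ := 0) hZ (fun t => ?_) h
    refine (((o₁ t).const_smul x).add ((o₂ t).const_smul y)).congr_deriv ?_
    simp only [Pi.add_apply, Pi.smul_apply, Matrix.mulVec_add, Matrix.mulVec_smul]
  have hlim' : ∀ x y : ℂ, Tendsto (x • evalFun 0 W₁ + y • evalFun 0 W₂) l (𝓝 (y • w)) :=
    fun x y => by
      have := (hVl.const_smul x).add (hb.lim.const_smul y)
      rw [smul_zero, zero_add] at this
      rw [hV]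
      exact this
  have hli : LinearIndependent ℂ ![evalFun 0 W₁ 0, evalFun 0 W₂ 0] := by
    rw [LinearIndependent.pair_iff]
    intro x y hxy
    have h1 := hcomb x y 0 (fun t => by
      rw [Pi.zero_apply, Matrix.mulVec_zero]
      exact hasDerivAt_const t (0 : Fin 4 → ℂ)) hxy.symm
    have h2 := hlim' x y
    rw [← h1] at h2
    have hy : y = 0 := by
      have := tendsto_nhds_unique h2 tendsto_const_nhds
      exact (smul_eq_zero.1 this).resolve_right hw
    subst hy
    rw [zero_smul, add_zero, hV] at h1
    exact ⟨(smul_eq_zero.1 h1.symm).resolve_right hV₀, rfl⟩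
  have hsp : ∀ Y : ℂ → ℝ → Fin 4 → ℂ,
      (∀ z ∈ Ω, 0 < z.re → Y z ∈ decayingSolutions (evansMatrix α κ s z) l) →
      ∀ᶠ z : ℂ in 𝓝 0, 0 < z.re → ∃ a b : ℂ, Y z 0 = a • evalFun z W₁ 0 + b • evalFun z W₂ 0 := by
    intro Y hY
    filter_upwards [hΩ.mem_nhds h0, Metric.closedBall_mem_nhds (0 : ℂ) hr] with z hz hzr hre
    have := hY z hz hre
    rw [← hb.span z hzr hre] at this
    obtain ⟨a, b, hab⟩ := Submodule.mem_span_pair.1 this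
    exact ⟨a, b, by rw [← hab]; rfl⟩
  have hX₁ := analyticAt_evalFun hr W₁ 0
  have hX₂ := analyticAt_evalFun hr W₂ 0
  obtain ⟨a, b, ha, hb', hab⟩ := exists_analytic_coeff hX₁ hX₂ (han₁.analyticAt (hΩ.mem_nhds h0)) hli
    (hsp Y₁ hm₁)
  obtain ⟨c, d, hc, hd, hcd⟩ := exists_analytic_coeff hX₁ hX₂ (han₂.analyticAt (hΩ.mem_nhds h0)) hli
    (hsp Y₂ hm₂)
  refine ⟨a, b, c, d, ha, hb', hc, hd, ?_, hab.and hcd⟩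
  have e1 := hab.self_of_nhds
  have e2 := hcomb _ _ _ hY₂ hcd.self_of_nhds
  have h3 : a 0 = 1 ∧ b 0 = 0 := by
    rw [LinearIndependent.pair_iff] at hli
    have := hli (a 0 - 1) (b 0) (by
      rw [sub_smul, one_smul]
      rw [hY₁V, ← hV] at e1
      nth_rewrite 2 [e1]
      abel)
    exact ⟨sub_eq_zero.1 this.1, this.2⟩
  have h4 : d 0 = 1 := by
    have h5 := hlim' (c 0) (d 0)
    rw [← e2] at h5
    have h6 := tendsto_nhds_unique h5 hlim
    have h7 : (d 0 - 1) • w = 0 := by rw [sub_smul, one_smul, h6, sub_self]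
    exact sub_eq_zero.1 ((smul_eq_zero.1 h7).resolve_right hw)
  rw [h3.1, h3.2, h4]
  ring

/-- A factor equal to one at a double zero does not affect the second derivative there. -/
theorem deriv_deriv_mul_of_double_zero {f g : ℂ → ℂ} (hf : AnalyticAt ℂ f 0) (hg : AnalyticAt ℂ g 0)
    (h0 : g 0 = 0) (h1 : deriv g 0 = 0) :
    deriv (fun z => f z * g z) 0 = 0 ∧
      deriv (deriv (fun z => f z * g z)) 0 = f 0 * deriv (deriv g) 0 := by
  have e : deriv (fun z => f z * g z) =ᶠ[𝓝 0] fun z => deriv f z * g z + f z * deriv g z := by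
    filter_upwards [hf.eventually_analyticAt, hg.eventually_analyticAt] with z h3 h4
    exact deriv_fun_mul h3.differentiableAt h4.differentiableAt
  constructor
  · rw [e.self_of_nhds]; simp [h0, h1]
  · rw [e.deriv_eq, deriv_fun_add (hf.deriv.differentiableAt.fun_mul hg.differentiableAt)
      (hf.differentiableAt.fun_mul hg.deriv.differentiableAt),
      deriv_fun_mul hf.deriv.differentiableAt hg.differentiableAt,
      deriv_fun_mul hf.differentiableAt hg.deriv.differentiableAt, h0, h1]
    simp

end
end Korteweg
namespace Korteweg
noncomputable section

namespace Disc

variable {r : ℝ}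

theorem map_algebraMap_mul (φ : Disc r →L[ℂ] ℂ) (t : ℝ) (f : Disc r) :
    φ (algebraMap ℝ (Disc r) t * f) = t * φ f := by
  rw [← Algebra.smul_def]
  exact (φ.restrictScalars ℝ).map_smul t f

variable [Fact (0 < r)]

theorem mul_double_zero {f : Disc r} (g : Disc r) (h0 : eval 0 f = 0) (h1 : derivZero f = 0) :
    eval 0 (f * g) = 0 ∧ derivZero (f * g) = 0 ∧
      derivTwoZero (f * g) = derivTwoZero f * eval 0 g := by
  rw [derivZero_apply] at h1
  have h2 := deriv_deriv_mul_of_double_zero (analyticAt_eval g) (analyticAt_eval f) h0 h1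
  have e : (fun z => eval z (f * g)) =ᶠ[𝓝 0] fun z => eval z g * eval z f :=
    (eval_mul_eventuallyEq f g).trans (Eventually.of_forall fun z => mul_comm _ _)
  refine ⟨?_, ?_, ?_⟩
  · rw [eval_mul zero_mem, h0, zero_mul]
  · rw [derivZero_apply, e.deriv_eq, h2.1]
  · rw [derivTwoZero_apply, derivTwoZero_apply, e.deriv.deriv_eq, h2.2, mul_comm]

theorem det_double_zero {F : Fin 4 → Disc r} (B C D : Fin 4 → Disc r) (h0 : ∀ i, eval 0 (F i) = 0)
    (h1 : ∀ i, derivZero (F i) = 0) :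
    eval 0 (Matrix.of ![F, B, C, D]).det = 0 ∧ derivZero (Matrix.of ![F, B, C, D]).det = 0 ∧
      derivTwoZero (Matrix.of ![F, B, C, D]).det =
        (Matrix.of ![fun i => derivTwoZero (F i), fun i => eval 0 (B i), fun i => eval 0 (C i),
          fun i => eval 0 (D i)]).det := by
  have key : (Matrix.of ![F, B, C, D]).det =
      F 0 * (B 1 * (C 2 * D 3 - C 3 * D 2) - B 2 * (C 1 * D 3 - C 3 * D 1) +
        B 3 * (C 1 * D 2 - C 2 * D 1)) +
      F 1 * (B 2 * (C 0 * D 3 - C 3 * D 0) - B 3 * (C 0 * D 2 - C 2 * D 0) -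
        B 0 * (C 2 * D 3 - C 3 * D 2)) +
      F 2 * (B 0 * (C 1 * D 3 - C 3 * D 1) - B 1 * (C 0 * D 3 - C 3 * D 0) +
        B 3 * (C 0 * D 1 - C 1 * D 0)) +
      F 3 * (B 1 * (C 0 * D 2 - C 2 * D 0) - B 0 * (C 1 * D 2 - C 2 * D 1) -
        B 2 * (C 0 * D 1 - C 1 * D 0)) := by
    rw [det_of_rows]; ring
  have hz := zero_mem (r := r)
  rw [key]
  refine ⟨?_, ?_, ?_⟩
  · simp only [map_add, (mul_double_zero _ (h0 _) (h1 _)).1, add_zero]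
  · simp only [map_add, (mul_double_zero _ (h0 _) (h1 _)).2.1, add_zero]
  · simp only [map_add, (mul_double_zero _ (h0 _) (h1 _)).2.2, map_sub, eval_mul hz, det_of_rows]
    ring

end Disc

/-- The derivative of the right-hand side of the eigenvalue equation with respect to the spectral
parameter. -/
def evansSource (κ s : ℝ) (Z : Fin 4 → ℂ) : Fin 4 → ℂ := ![Z 1, 0, 0, (-Z 0 + s * Z 1) / κ]

theorem hasDerivAt_map_disc {α : ℝ → ℝ} {κ s r : ℝ} (φ : Disc r →L[ℂ] ℂ) {W : ℝ → Fin 4 → Disc r}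
    {x : ℝ} (hW : HasDerivAt W ((evansGen κ s Disc.lam (α x) (deriv α x)).mulVec (W x)) x) :
    HasDerivAt (fun x i => φ (W x i)) ((evansMatrix α κ s 0 x).mulVec (fun i => φ (W x i)) +
      evansSource κ s fun i => φ (Disc.lam * W x i)) x := by
  refine hasDerivAt_pi.2 fun i => ?_
  have h1 := ((φ.restrictScalars ℝ).hasFDerivAt).comp_hasDerivAt x (hasDerivAt_pi.1 hW i)
  refine h1.congr_deriv ?_
  have hm := Disc.map_algebraMap_mul φ
  rw [evansGen_eq]
  change φ _ = _
  fin_cases i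
  · simp [Matrix.mulVec, dotProduct, Fin.sum_univ_four, evansMatrix, evansSource, hm]
    ring
  · simp [dotProduct, Fin.sum_univ_four, evansMatrix, evansSource]
  · simp [dotProduct, Fin.sum_univ_four, evansMatrix, evansSource]
  · have e : (-(Disc.lam * algebraMap ℝ (Disc r) κ⁻¹)) * W x 0 +
        (algebraMap ℝ (Disc r) s * Disc.lam * algebraMap ℝ (Disc r) κ⁻¹ -
          algebraMap ℝ (Disc r) (deriv α x) * algebraMap ℝ (Disc r) κ⁻¹) * W x 1 +
        (-(algebraMap ℝ (Disc r) s ^ 2 * algebraMap ℝ (Disc r) κ⁻¹) -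
          algebraMap ℝ (Disc r) (α x) * algebraMap ℝ (Disc r) κ⁻¹) * W x 2 + 0 * W x 3 =
        algebraMap ℝ (Disc r) (-κ⁻¹) * (Disc.lam * W x 0) +
        algebraMap ℝ (Disc r) (s * κ⁻¹) * (Disc.lam * W x 1) +
        algebraMap ℝ (Disc r) (-(deriv α x * κ⁻¹)) * W x 1 +
        algebraMap ℝ (Disc r) (-((s ^ 2 + α x) * κ⁻¹)) * W x 2 := by
      simp only [map_neg, map_mul, map_add, map_pow]
      ring
    have e' : Matrix.mulVec !![(0 : Disc r), Disc.lam, -algebraMap ℝ (Disc r) s, 0; 0, 0, 1, 0; 0, 0, 0, 1;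
         -(Disc.lam * algebraMap ℝ (Disc r) κ⁻¹),
           algebraMap ℝ (Disc r) s * Disc.lam * algebraMap ℝ (Disc r) κ⁻¹ -
            algebraMap ℝ (Disc r) (deriv α x) * algebraMap ℝ (Disc r) κ⁻¹,
           -(algebraMap ℝ (Disc r) s ^ 2 * algebraMap ℝ (Disc r) κ⁻¹) -
            algebraMap ℝ (Disc r) (α x) * algebraMap ℝ (Disc r) κ⁻¹, 0] (W x) 3 = _ :=
      (by simp [Matrix.mulVec, dotProduct, Fin.sum_univ_four] :
        _ = (-(Disc.lam * algebraMap ℝ (Disc r) κ⁻¹)) * W x 0 +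
        (algebraMap ℝ (Disc r) s * Disc.lam * algebraMap ℝ (Disc r) κ⁻¹ -
          algebraMap ℝ (Disc r) (deriv α x) * algebraMap ℝ (Disc r) κ⁻¹) * W x 1 +
        (-(algebraMap ℝ (Disc r) s ^ 2 * algebraMap ℝ (Disc r) κ⁻¹) -
          algebraMap ℝ (Disc r) (α x) * algebraMap ℝ (Disc r) κ⁻¹) * W x 2 + 0 * W x 3).trans e
    change φ (Matrix.mulVec _ (W x) 3) = _
    rw [e']
    simp only [map_add, hm]
    simp [dotProduct, Fin.sum_univ_four, evansMatrix, evansSource]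
    ring

/-- A solution of the eigenvalue equation remains one when multiplied by a function of the spectral
parameter. -/
theorem hasDerivAt_disc_smul {r : ℝ} {M : Matrix (Fin 4) (Fin 4) (Disc r)}
    {W : ℝ → Fin 4 → Disc r} {x : ℝ} (f : Disc r) (hW : HasDerivAt W (M.mulVec (W x)) x) :
    HasDerivAt (fun x => f • W x) (M.mulVec (f • W x)) x := by
  refine hasDerivAt_pi.2 fun i => ?_
  rw [Matrix.mulVec_smul]
  exact (hasDerivAt_pi.1 hW i).const_mul f

section Invariants

/-- The first conserved density of the linearization at `λ = 0`. -/
def chargeOne (s : ℝ) (W : Fin 4 → ℂ) : ℂ := W 0 + s * W 1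

/-- The second conserved density of the linearization at `λ = 0`. -/
def chargeTwo (κ s a : ℝ) (W : Fin 4 → ℂ) : ℂ := -a * W 1 - κ * W 3 + s * W 0

/-- The third conserved density of the linearization at `λ = 0` about a wave with `v - vinf = w`,
`v' = d`, `v'' = e`, `p'(v) = a`. -/
def waveForm (κ s a w d e : ℝ) (W : Fin 4 → ℂ) : ℂ :=
  d * W 2 - e * W 1 - w / κ * ((a + s ^ 2) * W 1 + κ * W 3)

theorem mul_det_of_wave {κ s a w d e t : ℝ} (hκ : κ ≠ 0) (ht : κ * t = -((a + s ^ 2) * d))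
    (A B C : Fin 4 → ℂ) :
    κ * (Matrix.of ![A, B, C, ![((-s * d : ℝ) : ℂ), (d : ℂ), (e : ℂ), (t : ℂ)]]).det =
      waveForm κ s a w d e A *
        (chargeOne s B * chargeTwo κ s a C - chargeTwo κ s a B * chargeOne s C) -
      waveForm κ s a w d e B *
        (chargeOne s A * chargeTwo κ s a C - chargeTwo κ s a A * chargeOne s C) +
      waveForm κ s a w d e C *
        (chargeOne s A * chargeTwo κ s a B - chargeTwo κ s a A * chargeOne s B) := by
  have hκ' : (κ : ℂ) ≠ 0 := by exact_mod_cast hκ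
  have ht' : (κ : ℂ) * t = -((a + s ^ 2) * d) := by exact_mod_cast ht
  rw [det_of_rows]
  simp [waveForm, chargeOne, chargeTwo]
  field_simp
  linear_combination (A 0 * (B 1 * C 2 - B 2 * C 1) - A 1 * (B 0 * C 2 - B 2 * C 0) +
    A 2 * (B 0 * C 1 - B 1 * C 0)) * κ * ht'

end Invariants

end
end Korteweg
namespace Korteweg
noncomputable section

namespace IsSaddleWave

variable {p : ℝ → ℝ} {I : Set ℝ} {κ s vinf uinf : ℝ} {v u : ℝ → ℝ}

theorem chargeOne_const {W : ℝ → Fin 4 → ℂ} {α : ℝ → ℝ}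
    (hW : ∀ x, HasDerivAt W ((evansMatrix α κ s 0 x).mulVec (W x)) x) (x y : ℝ) :
    chargeOne s (W x) = chargeOne s (W y) := by
  have hd : ∀ x, HasDerivAt (fun x => chargeOne s (W x)) 0 x := fun x => by
    refine ((hasDerivAt_pi.1 (hW x) 0).add ((hasDerivAt_pi.1 (hW x) 1).const_mul (s : ℂ))).congr_deriv ?_
    simp [evansMatrix, Matrix.mulVec, dotProduct, Fin.sum_univ_four]
  exact is_const_of_deriv_eq_zero (fun x => (hd x).differentiableAt) (fun x => (hd x).deriv) x y

theorem hasDerivAt_coeff_ofReal (h : IsSaddleWave p I κ s vinf uinf v u) (x : ℝ) :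
    HasDerivAt (fun y => ((deriv p (v y) : ℝ) : ℂ)) ((deriv (fun y => deriv p (v y)) x : ℝ) : ℂ) x := by
  rw [(h.hasDerivAt_coeff x).deriv]
  exact (h.hasDerivAt_coeff x).ofReal_comp

theorem chargeTwo_const (h : IsSaddleWave p I κ s vinf uinf v u) {W : ℝ → Fin 4 → ℂ}
    (hW : ∀ x, HasDerivAt W ((evansMatrix (fun y => deriv p (v y)) κ s 0 x).mulVec (W x)) x)
    (x y : ℝ) : chargeTwo κ s (deriv p (v x)) (W x) = chargeTwo κ s (deriv p (v y)) (W y) := by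
  have hκ : (κ : ℂ) ≠ 0 := by exact_mod_cast h.pos.ne'
  have hd : ∀ x, HasDerivAt (fun x => chargeTwo κ s (deriv p (v x)) (W x)) 0 x := fun x => by
    have hi := hasDerivAt_pi.1 (hW x)
    refine ((((h.hasDerivAt_coeff_ofReal x).neg.mul (hi 1)).sub ((hi 3).const_mul (κ : ℂ))).add
      ((hi 0).const_mul (s : ℂ))).congr_deriv ?_
    simp [evansMatrix, Matrix.mulVec, dotProduct, Fin.sum_univ_four]
    field_simp
    ring
  exact is_const_of_deriv_eq_zero (fun x => (hd x).differentiableAt) (fun x => (hd x).deriv) x y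

/-- The third density along a wave. -/
abbrev form (_ : IsSaddleWave p I κ s vinf uinf v u) (x : ℝ) (W : Fin 4 → ℂ) : ℂ :=
  waveForm κ s (deriv p (v x)) (v x - vinf) (deriv v x) (iteratedDeriv 2 v x) W

theorem hasDerivAt_form (h : IsSaddleWave p I κ s vinf uinf v u) {W : ℝ → Fin 4 → ℂ}
    {Z : Fin 4 → ℂ} {x : ℝ} (hW : HasDerivAt W
      ((evansMatrix (fun y => deriv p (v y)) κ s 0 x).mulVec (W x) + evansSource κ s Z) x) :
    HasDerivAt (fun x => h.form x (W x))
      (-((v x - vinf : ℝ) : ℂ) * (-Z 0 + s * Z 1) / κ) x := by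
  have hκ : (κ : ℂ) ≠ 0 := by exact_mod_cast h.pos.ne'
  have hi := hasDerivAt_pi.1 hW
  have d0 := (h.hasDerivAt_sub x).ofReal_comp
  have d1 := (h.wave.hasDerivAt_deriv x).ofReal_comp
  have d2 := (h.wave.hasDerivAt_deriv_two x).ofReal_comp
  have h3 : (κ : ℂ) * ((iteratedDeriv 3 v x : ℝ) : ℂ) =
      -(((deriv p (v x) : ℝ) + (s : ℂ) ^ 2) * ((deriv v x : ℝ) : ℂ)) := by
    rw [h.iteratedDeriv_three]
    push_cast
    field_simp
  refine (((d1.mul (hi 2)).sub (d2.mul (hi 1))).sub ((d0.div_const (κ : ℂ)).mul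
    ((((h.hasDerivAt_coeff_ofReal x).add_const ((s : ℂ) ^ 2)).mul (hi 1)).add
      ((hi 3).const_mul (κ : ℂ))))).congr_deriv ?_
  simp [evansMatrix, evansSource, dotProduct, Fin.sum_univ_four]
  field_simp
  linear_combination -(W x 1) * h3

theorem tendsto_wave (h : IsSaddleWave p I κ s vinf uinf v u) {l : Filter ℝ}
    (hl : l = atTop ∨ l = atBot) : Tendsto v l (𝓝 vinf) ∧ Tendsto (waveDeriv v u) l (𝓝 0) := by
  rcases hl with rfl | rfl
  · exact ⟨h.wave.v_atTop, h.tendsto_waveDeriv_atTop⟩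
  · exact ⟨h.wave.v_atBot, h.tendsto_waveDeriv_atBot⟩

theorem tendsto_coeff (h : IsSaddleWave p I κ s vinf uinf v u) {l : Filter ℝ}
    (hl : l = atTop ∨ l = atBot) :
    Tendsto (fun x => ((deriv p (v x) : ℝ) : ℂ)) l (𝓝 ((deriv p vinf : ℝ) : ℂ)) :=
  (Complex.continuous_ofReal.tendsto _).comp
    ((h.hasDerivAt_deriv_p h.mem_inf).continuousAt.tendsto.comp (h.tendsto_wave hl).1)

theorem tendsto_form (h : IsSaddleWave p I κ s vinf uinf v u) {l : Filter ℝ}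
    (hl : l = atTop ∨ l = atBot) {W : ℝ → Fin 4 → ℂ} {w : Fin 4 → ℂ} (hW : Tendsto W l (𝓝 w)) :
    Tendsto (fun x => h.form x (W x)) l (𝓝 0) := by
  have hi := tendsto_pi_nhds.1 hW
  have hd := tendsto_pi_nhds.1 (h.tendsto_wave hl).2
  have hw : Tendsto (fun x => ((v x - vinf : ℝ) : ℂ)) l (𝓝 0) := by
    have h1 := (h.tendsto_wave hl).1.sub_const vinf
    rw [sub_self] at h1
    exact (Complex.continuous_ofReal.tendsto' 0 0 Complex.ofReal_zero).comp h1
  have := (((hd 1).mul (hi 2)).sub ((hd 2).mul (hi 1))).sub ((hw.div_const (κ : ℂ)).mul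
    ((((h.tendsto_coeff hl).add_const ((s : ℂ) ^ 2)).mul (hi 1)).add ((hi 3).const_mul (κ : ℂ))))
  simpa [waveForm, waveDeriv] using this

/-- The third density vanishes on bounded solutions of the linearization at `λ = 0`. -/
theorem form_eq_zero (h : IsSaddleWave p I κ s vinf uinf v u) {l : Filter ℝ} [l.NeBot]
    (hl : l = atTop ∨ l = atBot) {W : ℝ → Fin 4 → ℂ} {w : Fin 4 → ℂ}
    (hW : ∀ x, HasDerivAt W ((evansMatrix (fun y => deriv p (v y)) κ s 0 x).mulVec (W x)) x)
    (hlim : Tendsto W l (𝓝 w)) (x : ℝ) : h.form x (W x) = 0 := by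
  have hd : ∀ x, HasDerivAt (fun x => h.form x (W x)) 0 x := fun x => by
    refine (h.hasDerivAt_form (Z := 0) ((hW x).congr_deriv ?_)).congr_deriv ?_
    · have : evansSource κ s 0 = 0 := by
        ext i; fin_cases i <;> simp [evansSource]
      rw [this, add_zero]
    · simp
  have hc : ∀ y, h.form y (W y) = h.form x (W x) := fun y =>
    is_const_of_deriv_eq_zero (fun x => (hd x).differentiableAt) (fun x => (hd x).deriv) y x
  exact (tendsto_nhds_unique ((h.tendsto_form hl hlim).congr hc) tendsto_const_nhds).symm

theorem charges_eq (h : IsSaddleWave p I κ s vinf uinf v u) {l : Filter ℝ} [l.NeBot]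
    (hl : l = atTop ∨ l = atBot) {W : ℝ → Fin 4 → ℂ} {w : Fin 4 → ℂ}
    (hW : ∀ x, HasDerivAt W ((evansMatrix (fun y => deriv p (v y)) κ s 0 x).mulVec (W x)) x)
    (hlim : Tendsto W l (𝓝 w)) (x : ℝ) : chargeOne s (W x) = chargeOne s w ∧
      chargeTwo κ s (deriv p (v x)) (W x) = chargeTwo κ s (deriv p vinf) w := by
  have hi := tendsto_pi_nhds.1 hlim
  have h1 : Tendsto (fun y => chargeOne s (W y)) l (𝓝 (chargeOne s w)) :=
    (hi 0).add ((hi 1).const_mul (s : ℂ))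
  have h2 : Tendsto (fun y => chargeTwo κ s (deriv p (v y)) (W y)) l
      (𝓝 (chargeTwo κ s (deriv p vinf) w)) :=
    ((((h.tendsto_coeff hl).neg.mul (hi 1)).sub ((hi 3).const_mul (κ : ℂ))).add
      ((hi 0).const_mul (s : ℂ)))
  exact ⟨(tendsto_nhds_unique (h1.congr fun y => chargeOne_const hW y x)
    tendsto_const_nhds).symm, (tendsto_nhds_unique (h2.congr fun y => h.chargeTwo_const hW y x)
    tendsto_const_nhds).symm⟩

end IsSaddleWave

namespace IsSaddleFamily

variable {p : ℝ → ℝ} {I : Set ℝ} {κ vinf uinf s : ℝ} {J : Set ℝ} {V U : ℝ → ℝ → ℝ}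

/-- The derivative of the reversed family of waves with respect to the speed, in phase variables. -/
def phaseSpeed (p : ℝ → ℝ) (κ vinf : ℝ) (V : ℝ → ℝ → ℝ) (s x : ℝ) : Fin 4 → ℂ :=
  ![((V s x - vinf + s * speedDeriv V s x : ℝ) : ℂ), ((-speedDeriv V s x : ℝ) : ℂ),
    ((-speedDeriv (fun σ => deriv (V σ)) s x : ℝ) : ℂ), ((forceSpeed p vinf V s x / κ : ℝ) : ℂ)]

theorem hasDerivAt_phaseSpeed (h : IsSaddleFamily p I κ J vinf uinf V U) (hs : s ∈ J) (x : ℝ) :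
    HasDerivAt (phaseSpeed p κ vinf V s)
      ((evansMatrix (fun y => deriv p (V s y)) κ s 0 x).mulVec (phaseSpeed p κ vinf V s x) +
        evansSource κ s (waveDeriv (V s) (U s) x)) x := by
  have hw := h.wave s hs
  have hκ : (κ : ℂ) ≠ 0 := by exact_mod_cast hw.pos.ne'
  have d0 := hw.hasDerivAt_sub x
  have d1 := h.hasDerivAt_speedDeriv hs x
  have d2 := h.hasDerivAt_speedDeriv_deriv hs x
  have d3 : HasDerivAt (fun x => deriv p (V s x)) (deriv (fun y => deriv p (V s y)) x) x :=
    (hw.hasDerivAt_coeff x).differentiableAt.hasDerivAt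
  have d4 := (((d3.add_const (s ^ 2)).mul d1).add (d0.const_mul (2 * s))).div_const κ
  refine hasDerivAt_pi.2 fun i => ?_
  fin_cases i
  · refine (d0.add (d1.const_mul s)).ofReal_comp.congr_deriv ?_
    simp [evansMatrix, evansSource, phaseSpeed, waveDeriv]
    ring
  · refine d1.neg.ofReal_comp.congr_deriv ?_
    simp [evansMatrix, evansSource, phaseSpeed]
  · refine d2.neg.ofReal_comp.congr_deriv ?_
    simp [evansMatrix, evansSource, phaseSpeed]
    ring
  · refine d4.ofReal_comp.congr_deriv ?_
    simp [evansMatrix, evansSource, phaseSpeed,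
      waveDeriv, hw.wave.deriv_u]
    field_simp
    ring

theorem tendsto_speedDeriv (h : IsSaddleFamily p I κ J vinf uinf V U) (hs : s ∈ J) {l : Filter ℝ}
    (hl : l = atTop ∨ l = atBot) : Tendsto (speedDeriv V s) l (𝓝 0) := by
  obtain ⟨g, hg, K, hb⟩ := h.exists_uniform_bound hs
  have hlim : Tendsto (fun x : ℝ => K * Real.exp (-g * |x|)) (cocompact ℝ) (𝓝 0) := by
    have h1 : Tendsto (fun x : ℝ => -g * |x|) (cocompact ℝ) atBot :=
      (tendsto_norm_cocompact_atTop (E := ℝ)).const_mul_atTop_of_neg (neg_lt_zero.2 hg)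
    simpa using (Real.tendsto_exp_atBot.comp h1).const_mul K
  have hle : l ≤ cocompact ℝ := by
    rw [cocompact_eq_atBot_atTop]
    rcases hl with rfl | rfl
    exacts [le_sup_right, le_sup_left]
  exact squeeze_zero_norm (fun x => (hb.self_of_nhds x).2.2) (hlim.mono_left hle)

theorem tendsto_forceSpeed (h : IsSaddleFamily p I κ J vinf uinf V U) (hs : s ∈ J) {l : Filter ℝ}
    (hl : l = atTop ∨ l = atBot) : Tendsto (forceSpeed p vinf V s) l (𝓝 0) := by
  have hw := h.wave s hs
  have h1 := (hw.tendsto_wave hl).1.sub_const vinf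
  have h2 := (hw.hasDerivAt_deriv_p hw.mem_inf).continuousAt.tendsto.comp (hw.tendsto_wave hl).1
  have := ((h2.add_const (s ^ 2)).mul (h.tendsto_speedDeriv hs hl)).add (h1.const_mul (2 * s))
  rw [sub_self, mul_zero, mul_zero, add_zero] at this
  exact this

theorem tendsto_speedDeriv_deriv_atTop (h : IsSaddleFamily p I κ J vinf uinf V U) (hs : s ∈ J) :
    Tendsto (speedDeriv (fun σ => deriv (V σ)) s) atTop (𝓝 0) := by
  have h1 := (h.tendsto_forceSpeed hs (Or.inl rfl)).neg.div_const κ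
  exact (tendsto_deriv_of_tendsto (h.hasDerivAt_speedDeriv hs) (h.hasDerivAt_speedDeriv_deriv hs)
    (h.tendsto_speedDeriv hs (Or.inl rfl)) h1).2

theorem tendsto_speedDeriv_deriv (h : IsSaddleFamily p I κ J vinf uinf V U) (hs : s ∈ J)
    {l : Filter ℝ} (hl : l = atTop ∨ l = atBot) :
    Tendsto (speedDeriv (fun σ => deriv (V σ)) s) l (𝓝 0) := by
  rcases hl with rfl | rfl
  · exact h.tendsto_speedDeriv_deriv_atTop hs
  · have h1 := ((h.comp_neg.tendsto_speedDeriv_deriv_atTop hs).comp tendsto_neg_atBot_atTop).neg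
    rw [neg_zero] at h1
    refine h1.congr fun x => ?_
    simp only [speedDeriv, Function.comp_apply, deriv_comp_neg, neg_neg]
    rw [deriv.fun_neg, neg_neg]

theorem tendsto_phaseSpeed (h : IsSaddleFamily p I κ J vinf uinf V U) (hs : s ∈ J)
    {l : Filter ℝ} (hl : l = atTop ∨ l = atBot) :
    Tendsto (phaseSpeed p κ vinf V s) l (𝓝 0) := by
  have hw := h.wave s hs
  have hc := Complex.continuous_ofReal.tendsto' 0 0 Complex.ofReal_zero
  refine tendsto_pi_nhds.2 fun i => ?_
  fin_cases i
  · refine hc.comp ?_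
    simpa using ((hw.tendsto_wave hl).1.sub_const vinf).add ((h.tendsto_speedDeriv hs hl).const_mul s)
  · refine hc.comp ?_
    simpa using (h.tendsto_speedDeriv hs hl).neg
  · refine hc.comp ?_
    simpa using (h.tendsto_speedDeriv_deriv hs hl).neg
  · refine hc.comp ?_
    simpa using (h.tendsto_forceSpeed hs hl).div_const κ

end IsSaddleFamily
end
end Korteweg
namespace Korteweg
noncomputable section

namespace IsSaddleFamily

variable {p : ℝ → ℝ} {I : Set ℝ} {κ vinf uinf s : ℝ} {J : Set ℝ} {V U : ℝ → ℝ → ℝ}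

/-- The exponentially decaying solution can be normalized so that its derivative in the spectral
parameter is given by the family of waves. -/
theorem exists_normalized (h : IsSaddleFamily p I κ J vinf uinf V U) (hs : s ∈ J) {r : ℝ}
    [Fact (0 < r)] {l : Filter ℝ} (hl : l = atTop ∨ l = atBot) {w : Fin 4 → ℂ}
    {W₁ W₂ : ℝ → Fin 4 → Disc r}
    (hb : IsHalfLineBasis κ s (fun y => deriv p (V s y)) r l w W₁ W₂)
    (h₁ : evalFun 0 W₁ = waveDeriv (V s) (U s)) :
    ∃ f : Disc r, Disc.eval 0 f = 1 ∧ Tendsto (fun x => f • W₁ x) l (𝓝 0) ∧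
      (∀ x, (fun i => Disc.eval 0 ((f • W₁ x) i)) = waveDeriv (V s) (U s) x) ∧
      ∀ x, (fun i => Disc.derivZero ((f • W₁ x) i)) = phaseSpeed p κ vinf V s x := by
  have hz := Disc.zero_mem (r := r)
  have hlim : Tendsto W₁ l (𝓝 0) := by
    obtain ⟨C, γ, hγ, hd⟩ := hb.decay
    have hle : l ≤ cocompact ℝ := by
      rw [cocompact_eq_atBot_atTop]
      rcases hl with rfl | rfl
      exacts [le_sup_right, le_sup_left]
    have h1 : Tendsto (fun x : ℝ => -γ * |x|) (cocompact ℝ) atBot :=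
      (tendsto_norm_cocompact_atTop (E := ℝ)).const_mul_atTop_of_neg (neg_lt_zero.2 hγ)
    have h2 := ((Real.tendsto_exp_atBot.comp h1).const_mul C).mono_left hle
    rw [mul_zero] at h2
    exact squeeze_zero_norm' hd h2
  have heval : ∀ x i, Disc.eval 0 (W₁ x i) = waveDeriv (V s) (U s) x i := fun x i =>
    congrFun (congrFun h₁ x) i
  have hd : ∀ x, HasDerivAt (fun x i => Disc.derivZero (W₁ x i))
      ((evansMatrix (fun y => deriv p (V s y)) κ s 0 x).mulVec (fun i => Disc.derivZero (W₁ x i)) +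
        evansSource κ s (waveDeriv (V s) (U s) x)) x := fun x => by
    have e1 := hasDerivAt_map_disc (α := fun y => deriv p (V s y)) Disc.derivZero (hb.ode₁ x)
    have e2 : (fun i => Disc.derivZero (Disc.lam * W₁ x i)) = waveDeriv (V s) (U s) x :=
      funext fun i => (Disc.derivZero_lam_mul _).trans (heval x i)
    rwa [e2] at e1
  have hdl : Tendsto (fun x i => Disc.derivZero (W₁ x i)) l (𝓝 0) := by
    refine tendsto_pi_nhds.2 fun i => ?_
    have h3 := (Disc.derivZero (r := r)).continuous.tendsto' 0 0 (map_zero _)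
    have h4 : Tendsto (fun x => W₁ x i) l (𝓝 0) := tendsto_pi_nhds.1 hlim i
    exact h3.comp h4
  have hdec : (fun x => (fun i => Disc.derivZero (W₁ x i)) - phaseSpeed p κ vinf V s x) ∈
      decayingSolutions (evansMatrix (fun y => deriv p (V s y)) κ s 0) l := by
    refine mem_decayingSolutions.2 ⟨fun x => ?_, ?_⟩
    · refine ((hd x).sub (h.hasDerivAt_phaseSpeed hs x)).congr_deriv ?_
      rw [Matrix.mulVec_sub]
      abel
    · have := hdl.sub (h.tendsto_phaseSpeed hs hl)
      rwa [sub_zero] at this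
  obtain ⟨c, hc⟩ := hb.zero _ hdec
  have hf1 : Disc.eval 0 (1 - c • Disc.lam : Disc r) = 1 := by
    rw [map_sub, map_smul, Disc.eval_one hz, Disc.eval_lam hz, smul_zero, sub_zero]
  refine ⟨1 - c • Disc.lam, hf1, ?_, fun x => ?_, fun x => ?_⟩
  · refine tendsto_pi_nhds.2 fun i => ?_
    have := (tendsto_pi_nhds.1 hlim i).const_mul (1 - c • Disc.lam : Disc r)
    simpa using this
  · funext i
    rw [Pi.smul_apply, smul_eq_mul, Disc.eval_mul hz, hf1, one_mul, heval]
  · funext i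
    have h2 := congrFun (congrFun hc x) i
    simp only [Pi.sub_apply, Pi.smul_apply, smul_eq_mul] at h2
    rw [Pi.smul_apply, smul_eq_mul, sub_mul, one_mul, smul_mul_assoc, map_sub, map_smul,
      Disc.derivZero_lam_mul, smul_eq_mul]
    rw [show evalFun 0 W₁ x i = Disc.eval 0 (W₁ x i) from rfl] at h2
    rw [← h2]
    ring

/-- The second derivatives, with respect to the spectral parameter, of the two normalized decaying
solutions are separated by the second derivative of the moment of instability. -/
theorem form_derivTwoZero_sub (h : IsSaddleFamily p I κ J vinf uinf V U) (hs : s ∈ J) {r : ℝ}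
    [Fact (0 < r)] {Y Y' : ℝ → Fin 4 → Disc r}
    (hY : ∀ x, HasDerivAt Y ((evansGen κ s Disc.lam (deriv p (V s x))
      (deriv (fun y => deriv p (V s y)) x)).mulVec (Y x)) x)
    (hY' : ∀ x, HasDerivAt Y' ((evansGen κ s Disc.lam (deriv p (V s x))
      (deriv (fun y => deriv p (V s y)) x)).mulVec (Y' x)) x)
    (hYl : Tendsto Y atTop (𝓝 0)) (hYl' : Tendsto Y' atBot (𝓝 0))
    (hd : ∀ x, (fun i => Disc.derivZero (Y x i)) = phaseSpeed p κ vinf V s x)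
    (hd' : ∀ x, (fun i => Disc.derivZero (Y' x i)) = phaseSpeed p κ vinf V s x) :
    (h.wave s hs).form 0 (fun i => Disc.derivTwoZero ((Y 0 - Y' 0) i)) =
      ((2 / κ * deriv (deriv (momentOfInstability p κ vinf uinf V U)) s : ℝ) : ℂ) := by
  have hw := h.wave s hs
  have hκ : (κ : ℂ) ≠ 0 := by exact_mod_cast hw.pos.ne'
  set ρ : ℝ → ℝ := fun x => 2 / κ * ((V s x - vinf) ^ 2 +
    2 * s * ((V s x - vinf) * speedDeriv V s x)) with hρ
  have hode : ∀ Z : ℝ → Fin 4 → Disc r, (∀ x, HasDerivAt Z ((evansGen κ s Disc.lam (deriv p (V s x))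
      (deriv (fun y => deriv p (V s y)) x)).mulVec (Z x)) x) →
      (∀ x, (fun i => Disc.derivZero (Z x i)) = phaseSpeed p κ vinf V s x) →
      ∀ x, HasDerivAt (fun x => hw.form x (fun i => Disc.derivTwoZero (Z x i))) (ρ x : ℂ) x := by
    intro Z hZ hZd x
    have e1 := hasDerivAt_map_disc (α := fun y => deriv p (V s y)) Disc.derivTwoZero (hZ x)
    simp only [Disc.derivTwoZero_lam_mul] at e1
    refine (hw.hasDerivAt_form e1).congr_deriv ?_
    have h0 := congrFun (hZd x) 0
    have h1 := congrFun (hZd x) 1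
    rw [h0, h1]
    simp [phaseSpeed, hρ]
    field_simp
    ring
  have hlim : ∀ (Z : ℝ → Fin 4 → Disc r) {l : Filter ℝ}, (l = atTop ∨ l = atBot) →
      Tendsto Z l (𝓝 0) → Tendsto (fun x => hw.form x (fun i => Disc.derivTwoZero (Z x i))) l (𝓝 0) := by
    intro Z l hl hZ
    refine hw.tendsto_form hl (w := 0) (tendsto_pi_nhds.2 fun i => ?_)
    exact ((Disc.derivTwoZero (r := r)).continuous.tendsto' 0 0 (map_zero _)).comp
      (tendsto_pi_nhds.1 hZ i)
  have hG := hode Y hY hd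
  have hH := hode Y' hY' hd'
  have hGl := hlim Y (Or.inl rfl) hYl
  have hHl := hlim Y' (Or.inr rfl) hYl'
  set G := fun x => hw.form x (fun i => Disc.derivTwoZero (Y x i)) with hGdef
  set H := fun x => hw.form x (fun i => Disc.derivTwoZero (Y' x i)) with hHdef
  have hconst : ∀ x, H x = G x - (G 0 - H 0) := fun x => by
    have hdiff : ∀ x, HasDerivAt (fun x => G x - H x) 0 x := fun x => by
      simpa using (hG x).fun_sub (hH x)
    have := is_const_of_deriv_eq_zero (fun x => (hdiff x).differentiableAt)
      (fun x => (hdiff x).deriv) x 0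
    linear_combination -this
  have hHl2 : Tendsto H atTop (𝓝 (0 - (G 0 - H 0))) :=
    (hGl.sub_const (G 0 - H 0)).congr fun x => (hconst x).symm
  have i1 := (h.exists_integrable hs).self_of_nhds.2
  have i2 := h.integrable_mul_speedDeriv hs
  have iρ : Integrable ρ := (i1.add (i2.const_mul (2 * s))).const_mul (2 / κ)
  have hint := integral_of_hasDerivAt_of_tendsto hH iρ.ofReal hHl hHl2
  rw [integral_complex_ofReal, hρ, integral_const_mul, integral_add i1 (i2.const_mul (2 * s)),
    integral_const_mul] at hint
  rw [(h.hasDerivAt_deriv_moment hs).deriv]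
  have hform : hw.form 0 (fun i => Disc.derivTwoZero ((Y 0 - Y' 0) i)) = G 0 - H 0 := by
    simp only [hGdef, hHdef, IsSaddleWave.form, waveForm, Pi.sub_apply, map_sub]
    ring
  rw [hform]
  push_cast at hint ⊢
  linear_combination hint

end IsSaddleFamily
end
end Korteweg
namespace Korteweg
noncomputable section

namespace EvansBasis

variable {p : ℝ → ℝ} {κ s vinf : ℝ} {v u : ℝ → ℝ} {a b : ℝ} {Ω : Set ℂ}

theorem evans_eq (E : EvansBasis p κ s vinf v u a b Ω) (lam : ℂ) :
    E.evans lam = (Matrix.of ![E.W₁ lam 0, E.W₂ lam 0, E.W₃ lam 0, E.W₄ lam 0]).det :=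
  Matrix.det_transpose _

theorem differentiableOn_evans (E : EvansBasis p κ s vinf v u a b Ω) :
    DifferentiableOn ℂ E.evans Ω := by
  have h1 := differentiableOn_pi.1 (E.analytic E.W₁ (by simp) 0)
  have h2 := differentiableOn_pi.1 (E.analytic E.W₂ (by simp) 0)
  have h3 := differentiableOn_pi.1 (E.analytic E.W₃ (by simp) 0)
  have h4 := differentiableOn_pi.1 (E.analytic E.W₄ (by simp) 0)
  rw [funext E.evans_eq]
  simp only [det_of_rows]
  fun_prop

theorem mem_plus (E : EvansBasis p κ s vinf v u a b Ω) {z : ℂ} (hz : z ∈ Ω) (hre : 0 < z.re) :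
    E.W₁ z ∈ decayingSolutions (evansMatrix (fun y => deriv p (v y)) κ s z) atTop ∧
      E.W₂ z ∈ decayingSolutions (evansMatrix (fun y => deriv p (v y)) κ s z) atTop := by
  rw [← E.span_plus z hz hre]
  exact ⟨Submodule.subset_span (by simp), Submodule.subset_span (by simp)⟩

theorem mem_minus (E : EvansBasis p κ s vinf v u a b Ω) {z : ℂ} (hz : z ∈ Ω) (hre : 0 < z.re) :
    E.W₃ z ∈ decayingSolutions (evansMatrix (fun y => deriv p (v y)) κ s z) atBot ∧
      E.W₄ z ∈ decayingSolutions (evansMatrix (fun y => deriv p (v y)) κ s z) atBot := by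
  rw [← E.span_minus z hz hre]
  exact ⟨Submodule.subset_span (by simp), Submodule.subset_span (by simp)⟩

end EvansBasis

theorem Disc.eval_det_rows {r : ℝ} {z : ℂ} (hz : z ∈ Metric.closedBall (0 : ℂ) r)
    (A B C D : Fin 4 → Disc r) : Disc.eval z (Matrix.of ![A, B, C, D]).det =
      (Matrix.of ![fun i => Disc.eval z (A i), fun i => Disc.eval z (B i),
        fun i => Disc.eval z (C i), fun i => Disc.eval z (D i)]).det := by
  rw [Disc.eval_det hz]
  congr 1
  ext i j
  fin_cases i <;> rfl

theorem deriv_deriv_eq_of_factor {D F K : ℂ → ℂ} (hK : AnalyticAt ℂ K 0) (hF : AnalyticAt ℂ F 0)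
    (hK0 : K 0 = 1) (h : D =ᶠ[𝓝 0] fun z => K z * F z) (h0 : F 0 = 0) (h1 : deriv F 0 = 0) :
    deriv (deriv D) 0 = deriv (deriv F) 0 := by
  rw [h.deriv.deriv_eq, (deriv_deriv_mul_of_double_zero hK hF h0 h1).2, hK0, one_mul]

namespace IsSaddleFamily

variable {p : ℝ → ℝ} {I : Set ℝ} {κ vinf uinf s : ℝ} {J : Set ℝ} {V U : ℝ → ℝ → ℝ}

/-- The second derivative of the Evans function, in terms of normalized bases. -/
theorem deriv_deriv_evans_eq_det (h : IsSaddleFamily p I κ J vinf uinf V U) (hs : s ∈ J) {a b : ℝ}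
    (ha : a ≠ 0) (hb : b ≠ 0) {Ω : Set ℂ} (hΩ : IsOpen Ω) (h0 : (0 : ℂ) ∈ Ω)
    (E : EvansBasis p κ s vinf (V s) (U s) a b Ω) {r : ℝ} [Fact (0 < r)]
    {W₁ W₂ W₃ W₄ : ℝ → Fin 4 → Disc r}
    (hp : IsHalfLineBasis κ s (fun y => deriv p (V s y)) r atTop
        ((a : ℂ) • ![((√(-deriv p vinf) : ℝ) : ℂ), -1, 0, 0]) W₁ W₂)
    (hm : IsHalfLineBasis κ s (fun y => deriv p (V s y)) r atBot
        ((b : ℂ) • ![((√(-deriv p vinf) : ℝ) : ℂ), 1, 0, 0]) W₄ W₃)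
    (e₁ : evalFun 0 W₁ = waveDeriv (V s) (U s)) (e₄ : evalFun 0 W₄ = waveDeriv (V s) (U s))
    {f₁ f₄ : Disc r} (hf₁ : Disc.eval 0 f₁ = 1) (hf₄ : Disc.eval 0 f₄ = 1)
    (hfe₁ : (fun i => Disc.eval 0 ((f₁ • W₁ 0) i)) = waveDeriv (V s) (U s) 0)
    (hfe₄ : (fun i => Disc.eval 0 ((f₄ • W₄ 0) i)) = waveDeriv (V s) (U s) 0)
    (hfd : (fun i => Disc.derivZero ((f₁ • W₁ 0) i)) = fun i => Disc.derivZero ((f₄ • W₄ 0) i)) :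
    deriv (deriv E.evans) 0 = (Matrix.of ![fun i => Disc.derivTwoZero ((f₁ • W₁ 0 - f₄ • W₄ 0) i),
      evalFun 0 W₂ 0, evalFun 0 W₃ 0, waveDeriv (V s) (U s) 0]).det := by
  have hw := h.wave s hs
  have hr : 0 < r := Fact.out
  obtain ⟨η, hη, B, hα, -, -⟩ := hw.exists_isLocalizedCoeff
  have ha' : (a : ℂ) ≠ 0 := by exact_mod_cast ha
  have hb' : (b : ℂ) ≠ 0 := by exact_mod_cast hb
  have hE1 : E.W₁ 0 = waveDeriv (V s) (U s) := funext E.W₁_zero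
  obtain ⟨k₁, k₂, k₃, k₄, ak₁, ak₂, ak₃, ak₄, hk, hplus⟩ := hp.exists_transition hr hα hη
    (smul_ne_zero ha' fun h => by simpa using congrFun h 1) e₁ hw.waveDeriv_ne_zero
    hw.tendsto_waveDeriv_atTop hΩ h0 (Y₁ := E.W₁) (Y₂ := E.W₂) (E.solution E.W₂ (by simp) 0 h0)
    (E.analytic _ (by simp) 0) (E.analytic _ (by simp) 0) (fun z hz hre => (E.mem_plus hz hre).1)
    (fun z hz hre => (E.mem_plus hz hre).2) hE1 E.W₂_zero
  obtain ⟨l₁, l₂, l₃, l₄, al₁, al₂, al₃, al₄, hl, hminus⟩ := hm.exists_transition hr hα hη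
    (smul_ne_zero hb' fun h => by simpa using congrFun h 1) e₄ hw.waveDeriv_ne_zero
    hw.tendsto_waveDeriv_atBot hΩ h0 (Y₁ := E.W₄) (Y₂ := E.W₃) (E.solution E.W₃ (by simp) 0 h0)
    (E.analytic _ (by simp) 0) (E.analytic _ (by simp) 0) (fun z hz hre => (E.mem_minus hz hre).2)
    (fun z hz hre => (E.mem_minus hz hre).1) (E.W₄_zero.trans hE1) E.W₃_zero
  set F : Disc r := (Matrix.of ![f₁ • W₁ 0 - f₄ • W₄ 0, W₂ 0, W₃ 0, f₄ • W₄ 0]).det with hF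
  have hFeq : F = f₁ * f₄ * (Matrix.of ![W₁ 0, W₂ 0, W₃ 0, W₄ 0]).det := by
    simp only [hF, det_of_rows, Pi.sub_apply, Pi.smul_apply, smul_eq_mul]
    ring
  obtain ⟨F0, F1, F2⟩ := Disc.det_double_zero (F := f₁ • W₁ 0 - f₄ • W₄ 0) (W₂ 0) (W₃ 0)
    (f₄ • W₄ 0) (fun i => by
      rw [Pi.sub_apply, map_sub, congrFun hfe₁ i, congrFun hfe₄ i, sub_self]) (fun i => by
      rw [Pi.sub_apply, map_sub, congrFun hfd i, sub_self])
  rw [← hF] at F0 F1 F2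
  have af₁ := Disc.analyticAt_eval f₁
  have af₄ := Disc.analyticAt_eval f₄
  have hne : Disc.eval 0 f₁ * Disc.eval 0 f₄ ≠ 0 := by rw [hf₁, hf₄]; simp
  rw [deriv_deriv_eq_of_factor (D := E.evans) (F := fun z => Disc.eval z F)
    (K := fun z => (k₁ z * k₄ z - k₂ z * k₃ z) * (l₁ z * l₄ z - l₂ z * l₃ z) /
      (Disc.eval z f₁ * Disc.eval z f₄))
    ((((ak₁.mul ak₄).sub (ak₂.mul ak₃)).mul ((al₁.mul al₄).sub (al₂.mul al₃))).div
      (af₁.mul af₄) hne) (Disc.analyticAt_eval F) (by simp only [hk, hl, hf₁, hf₄]; norm_num) ?_ F0 F1]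
  · rw [← Disc.derivTwoZero_apply, F2, hfe₄]
    rfl
  · filter_upwards [hplus, hminus, Metric.closedBall_mem_nhds (0 : ℂ) hr,
      (af₁.mul af₄).continuousAt.eventually_ne hne] with z h1 h2 hzr hzne
    rw [Pi.mul_apply] at hzne
    rw [E.evans_eq, h1.1, h1.2, h2.1, h2.2, hFeq, Disc.eval_mul hzr, Disc.eval_mul hzr,
      Disc.eval_det_rows hzr, det_combination_rows (evalFun z W₁ 0) (evalFun z W₂ 0)
      (evalFun z W₃ 0) (evalFun z W₄ 0), ← mul_assoc (_ / _), div_mul_cancel₀ _ hzne]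
    rfl

/-- The second derivative of the Evans function at the origin is proportional to that of the moment
of instability. -/
theorem deriv_deriv_evans (h : IsSaddleFamily p I κ J vinf uinf V U) (hs : s ∈ J) {a b : ℝ}
    (ha : a ≠ 0) (hb : b ≠ 0) {Ω : Set ℂ} (hΩ : IsOpen Ω) (h0 : (0 : ℂ) ∈ Ω)
    (E : EvansBasis p κ s vinf (V s) (U s) a b Ω) :
    deriv (deriv E.evans) 0 = ((4 * a * b * √(-deriv p vinf) * (-deriv p vinf - s ^ 2) / κ ^ 2 *
      deriv (deriv (momentOfInstability p κ vinf uinf V U)) s : ℝ) : ℂ) := by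
  have hw := h.wave s hs
  have hκ : (κ : ℂ) ≠ 0 := by exact_mod_cast hw.pos.ne'
  obtain ⟨r, hr, W₁, W₂, W₃, W₄, hp, hm, e₁, e₄⟩ := hw.exists_halfLineBases ha hb
  have : Fact (0 < r) := ⟨hr⟩
  have hz := Disc.zero_mem (r := r)
  obtain ⟨f₁, hf₁, hfl₁, hfe₁, hfd₁⟩ := h.exists_normalized hs (Or.inl rfl) hp e₁
  obtain ⟨f₄, hf₄, hfl₄, hfe₄, hfd₄⟩ := h.exists_normalized hs (Or.inr rfl) hm e₄
  rw [h.deriv_deriv_evans_eq_det hs ha hb hΩ h0 E hp hm e₁ e₄ hf₁ hf₄ (hfe₁ 0) (hfe₄ 0)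
    ((hfd₁ 0).trans (hfd₄ 0).symm)]
  have hform := h.form_derivTwoZero_sub hs (Y := fun x => f₁ • W₁ x) (Y' := fun x => f₄ • W₄ x)
    (fun x => hasDerivAt_disc_smul f₁ (hp.ode₁ x)) (fun x => hasDerivAt_disc_smul f₄ (hm.ode₁ x))
    hfl₁ hfl₄ hfd₁ hfd₄
  have o₂ : ∀ x, HasDerivAt (evalFun 0 W₂)
      ((evansMatrix (fun y => deriv p (V s y)) κ s 0 x).mulVec (evalFun 0 W₂ x)) x :=
    fun x => hasDerivAt_evalFun (α := fun y => deriv p (V s y)) hz (hp.ode₂ x)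
  have o₃ : ∀ x, HasDerivAt (evalFun 0 W₃)
      ((evansMatrix (fun y => deriv p (V s y)) κ s 0 x).mulVec (evalFun 0 W₃ x)) x :=
    fun x => hasDerivAt_evalFun (α := fun y => deriv p (V s y)) hz (hm.ode₂ x)
  have fB := hw.form_eq_zero (Or.inl rfl) o₂ hp.lim 0
  have fC := hw.form_eq_zero (Or.inr rfl) o₃ hm.lim 0
  have qB := hw.charges_eq (Or.inl rfl) o₂ hp.lim 0
  have qC := hw.charges_eq (Or.inr rfl) o₃ hm.lim 0
  have hdet := mul_det_of_wave (a := deriv p (V s 0)) (w := V s 0 - vinf)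
    (e := iteratedDeriv 2 (V s) 0) hw.pos.ne' (s := s) (d := deriv (V s) 0)
    (t := iteratedDeriv 3 (V s) 0) (by rw [hw.iteratedDeriv_three, mul_div_cancel₀ _ hw.pos.ne'])
    (fun i => Disc.derivTwoZero ((f₁ • W₁ 0 - f₄ • W₄ 0) i)) (evalFun 0 W₂ 0) (evalFun 0 W₃ 0)
  have ewave : waveDeriv (V s) (U s) 0 = ![((-s * deriv (V s) 0 : ℝ) : ℂ), ((deriv (V s) 0 : ℝ) : ℂ),
      ((iteratedDeriv 2 (V s) 0 : ℝ) : ℂ), ((iteratedDeriv 3 (V s) 0 : ℝ) : ℂ)] := by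
    rw [waveDeriv, hw.wave.deriv_u]
  unfold IsSaddleWave.form at fB fC hform
  rw [← ewave, fB, fC, hform, qB.1, qB.2, qC.1, qC.2] at hdet
  refine mul_left_cancel₀ hκ (hdet.trans ?_)
  clear hdet hform qB qC fB fC o₂ o₃ ewave
  generalize deriv (deriv (momentOfInstability p κ vinf uinf V U)) s = m
  generalize √(-deriv p vinf) = c
  generalize deriv p vinf = q
  simp [chargeOne, chargeTwo]
  field_simp
  ring

end IsSaddleFamily
end
end Korteweg
namespace Korteweg
noncomputable section

/-- Integrals over the unit interval of functions that are continuously differentiable jointly in the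
variable and the parameter are continuously differentiable in the parameter. -/
theorem contDiffAt_integral {E : Type*} [NormedAddCommGroup E] [NormedSpace ℝ E] [ProperSpace E]
    {G : E → ℝ → ℝ} {U : Set E} (hU : IsOpen U)
    (hG : ∀ e ∈ U, ∀ t ∈ Set.Icc (0 : ℝ) 1, ContDiffAt ℝ 1 (fun q : E × ℝ => G q.1 q.2) (e, t))
    {e₀ : E} (he₀ : e₀ ∈ U) : ContDiffAt ℝ 1 (fun e => ∫ t in (0 : ℝ)..1, G e t) e₀ := by
  let G' : E → ℝ → E →L[ℝ] ℝ := fun e t =>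
    (fderiv ℝ (fun q : E × ℝ => G q.1 q.2) (e, t)).comp (ContinuousLinearMap.inl ℝ E ℝ)
  have hG'c : ∀ e ∈ U, ∀ t ∈ Set.Icc (0 : ℝ) 1,
      ContinuousAt (fun q : E × ℝ => G' q.1 q.2) (e, t) := fun e he t ht => by
    have h1 : ContinuousAt (fderiv ℝ (fun q : E × ℝ => G q.1 q.2)) (e, t) :=
      ((hG e he t ht).fderiv_right (m := 0) (by norm_num)).continuousAt
    exact h1.clm_comp continuousAt_const
  have hd : ∀ e ∈ U, ∀ t ∈ Set.Icc (0 : ℝ) 1, HasFDerivAt (fun e => G e t) (G' e t) e :=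
    fun e he t ht => by
      have h1 := ((hG e he t ht).differentiableAt (by norm_num)).hasFDerivAt
      exact h1.comp (f := fun e : E => (e, t)) e (hasFDerivAt_prodMk_left e t)
  have hslice : ∀ e ∈ U, ContinuousOn (G e) (Set.Icc 0 1) := fun e he t ht =>
    (ContinuousAt.comp (f := fun t : ℝ => (e, t)) (hG e he t ht).continuousAt
      (by fun_prop)).continuousWithinAt
  have hslice' : ∀ e ∈ U, ContinuousOn (G' e) (Set.Icc 0 1) := fun e he t ht =>
    (ContinuousAt.comp (f := fun t : ℝ => (e, t)) (hG'c e he t ht)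
      (by fun_prop)).continuousWithinAt
  have hsub : Set.uIoc (0 : ℝ) 1 ⊆ Set.Icc 0 1 := by
    rw [Set.uIoc_of_le zero_le_one]; exact Set.Ioc_subset_Icc_self
  have hbound : ∀ e ∈ U, ∃ C, ∀ᶠ y in 𝓝 e, y ∈ U ∧ ∀ t ∈ Set.Icc (0 : ℝ) 1, ‖G' y t‖ ≤ C := by
    intro e he
    obtain ⟨r, hr, hrU⟩ := Metric.nhds_basis_closedBall.mem_iff.1 (hU.mem_nhds he)
    obtain ⟨C, hC⟩ := ((isCompact_closedBall e r).prod
      (isCompact_Icc (a := (0 : ℝ)) (b := 1))).exists_bound_of_continuousOn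
      (f := fun q : E × ℝ => G' q.1 q.2)
      (fun q hq => (hG'c q.1 (hrU hq.1) q.2 hq.2).continuousWithinAt)
    refine ⟨C, ?_⟩
    filter_upwards [Metric.closedBall_mem_nhds e hr] with y hy
    exact ⟨hrU hy, fun t ht => hC (y, t) ⟨hy, ht⟩⟩
  rw [contDiffAt_one_iff]
  refine ⟨fun e => ∫ t in (0 : ℝ)..1, G' e t, U, hU.mem_nhds he₀, fun e he => ?_, fun e he => ?_⟩
  · obtain ⟨C, hC⟩ := hbound e he
    refine ContinuousAt.continuousWithinAt (intervalIntegral.continuousAt_of_dominated_interval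
      (bound := fun _ => C) ?_ ?_ intervalIntegrable_const ?_)
    · filter_upwards [hU.mem_nhds he] with y hy
      exact ((hslice' y hy).mono hsub).aestronglyMeasurable measurableSet_uIoc
    · filter_upwards [hC] with y hy
      exact Eventually.of_forall fun t ht => hy.2 t (hsub ht)
    · exact Eventually.of_forall fun t ht => ContinuousAt.comp (f := fun e : E => (e, t))
        (hG'c e he t (hsub ht)) (by fun_prop)
  · obtain ⟨C, hC⟩ := hbound e he
    refine intervalIntegral.hasFDerivAt_integral_of_dominated_of_fderiv_le (bound := fun _ => C) hC
      ?_ ?_ (((hslice' e he).mono hsub).aestronglyMeasurable measurableSet_uIoc) ?_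
      intervalIntegrable_const ?_
    · filter_upwards [hU.mem_nhds he] with y hy
      exact ((hslice y hy).mono hsub).aestronglyMeasurable measurableSet_uIoc
    · refine ContinuousOn.intervalIntegrable ?_
      rw [Set.uIcc_of_le zero_le_one]
      exact hslice e he
    · exact Eventually.of_forall fun t ht y hy => hy.2 t (hsub ht)
    · exact Eventually.of_forall fun t ht y hy => hd y hy.1 t (hsub ht)

/-- The implicit function theorem for a scalar unknown. -/
theorem exists_implicit {E : Type*} [NormedAddCommGroup E] [NormedSpace ℝ E] [CompleteSpace E]
    {f : E × ℝ → ℝ} {e : E} {y d : ℝ} (hf : ContDiffAt ℝ 1 f (e, y))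
    (hd : HasDerivAt (fun y => f (e, y)) d y) (hd0 : d ≠ 0) :
    ∃ ψ : E → ℝ, ContDiffAt ℝ 1 ψ e ∧ ψ e = y ∧ ∀ᶠ z in 𝓝 e, f (z, ψ z) = f (e, y) := by
  have h1 : fderiv ℝ f (e, y) (0, 1) = d := by
    have h2 := (hf.differentiableAt (by norm_num)).hasFDerivAt.comp_hasDerivAt
      (f := fun y : ℝ => (e, y)) y ((hasDerivAt_const y e).prodMk (hasDerivAt_id y))
    exact h2.unique hd
  have hinv : (fderiv ℝ f (e, y) ∘L .inr ℝ E ℝ).IsInvertible := by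
    refine ⟨ContinuousLinearEquiv.unitsEquivAut ℝ (Units.mk0 d hd0), ?_⟩
    ext
    simp [h1]
  exact ⟨hf.implicitFunction (by norm_num) hinv, hf.contDiffAt_implicitFunction (by norm_num) hinv,
    hf.implicitFunction_apply_self (by norm_num) hinv,
    hf.eventually_apply_implicitFunction (by norm_num) hinv⟩

/-- Continuous functions that agree off a point are equal. -/
theorem eq_of_eq_off_point {f g : ℝ → ℝ} (hf : Continuous f) (hg : Continuous g) {a : ℝ}
    (h : ∀ x, x ≠ a → f x = g x) : f = g :=
  Continuous.ext_on (dense_compl_singleton a) hf hg fun x hx => h x hx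

/-- The function `1 / cosh ^ 2`. -/
def sechSq (x : ℝ) : ℝ := (Real.cosh x ^ 2)⁻¹

theorem contDiff_sechSq {n : WithTop ℕ∞} : ContDiff ℝ n sechSq :=
  (Real.contDiff_cosh.pow 2).inv fun x => by have := Real.cosh_pos x; positivity

theorem sechSq_pos (x : ℝ) : 0 < sechSq x := by
  have := Real.cosh_pos x
  unfold sechSq; positivity

theorem sechSq_le_one (x : ℝ) : sechSq x ≤ 1 :=
  inv_le_one_of_one_le₀ (one_le_pow₀ (Real.one_le_cosh x))

theorem sechSq_lt_one {x : ℝ} (hx : x ≠ 0) : sechSq x < 1 :=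
  inv_lt_one_of_one_lt₀ (one_lt_pow₀ (Real.one_lt_cosh.2 hx) two_ne_zero)

@[simp] theorem sechSq_zero : sechSq 0 = 1 := by simp [sechSq]

theorem hasDerivAt_sechSq (x : ℝ) :
    HasDerivAt sechSq (-2 * (Real.sinh x / Real.cosh x) * sechSq x) x := by
  have hc := (Real.cosh_pos x).ne'
  refine (((Real.hasDerivAt_cosh x).pow 2).inv (pow_ne_zero 2 hc)).congr_deriv ?_
  simp [sechSq]
  field_simp

theorem sq_sinh_div_cosh (x : ℝ) : (Real.sinh x / Real.cosh x) ^ 2 = 1 - sechSq x := by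
  have hc := (Real.cosh_pos x).ne'
  unfold sechSq
  field_simp
  linarith [Real.cosh_sq x]

theorem tendsto_sechSq_atTop : Tendsto sechSq atTop (𝓝 0) := by
  have h1 : Tendsto (fun x : ℝ => Real.cosh x ^ 2) atTop atTop := by
    refine tendsto_atTop_mono (fun x => ?_) (Real.tendsto_exp_atTop.atTop_div_const two_pos)
    have h2 : Real.exp x / 2 ≤ Real.cosh x := by
      rw [Real.cosh_eq]
      linarith [Real.exp_pos (-x)]
    exact h2.trans (le_self_pow₀ (Real.one_le_cosh x) two_ne_zero)
  exact tendsto_inv_atTop_zero.comp h1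

theorem tendsto_sechSq_atBot : Tendsto sechSq atBot (𝓝 0) :=
  (tendsto_sechSq_atTop.comp tendsto_neg_atBot_atTop).congr fun x => by simp [sechSq]

end
end Korteweg
namespace Korteweg
noncomputable section

/-- Families of autonomous scalar equations `ξ' = 1 / T s ξ` with `T` bounded below have global
flows, which depend continuously differentiably on the parameter. -/
theorem exists_travel {T : ℝ → ℝ → ℝ} {S : Set ℝ} (hS : IsOpen S)
    (hT : ∀ s ∈ S, ∀ ξ, ContDiffAt ℝ 1 (fun q : ℝ × ℝ => T q.1 q.2) (s, ξ))
    (hb : ∀ s ∈ S, ∃ b > 0, ∀ ξ, b ≤ T s ξ) :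
    ∃ Ξ : ℝ → ℝ → ℝ, ∀ s ∈ S, Ξ s 0 = 0 ∧ (∀ x, HasDerivAt (Ξ s) (1 / T s (Ξ s x)) x) ∧
      (∀ x, ContDiffAt ℝ 1 (fun q : ℝ × ℝ => Ξ q.1 q.2) (s, x)) ∧
      StrictMono (Ξ s) ∧ Tendsto (Ξ s) atTop atTop ∧ Tendsto (Ξ s) atBot atBot := by
  have hTc : ∀ s ∈ S, Continuous (T s) := fun s hs => continuous_iff_continuousAt.2 fun ξ =>
    ContinuousAt.comp (f := fun ξ : ℝ => (s, ξ)) (hT s hs ξ).continuousAt (by fun_prop)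
  let X : ℝ → ℝ → ℝ := fun s ξ => ∫ t in (0 : ℝ)..ξ, T s t
  have hX0 : ∀ s, X s 0 = 0 := fun s => intervalIntegral.integral_same
  have hXd : ∀ s ∈ S, ∀ ξ, HasDerivAt (X s) (T s ξ) ξ := fun s hs ξ =>
    ((hTc s hs).integral_hasStrictDerivAt 0 ξ).hasDerivAt
  have hXc : ∀ s ∈ S, ∀ ξ, ContDiffAt ℝ 1 (fun q : ℝ × ℝ => X q.1 q.2) (s, ξ) := by
    intro s hs ξ
    have e : (fun q : ℝ × ℝ => X q.1 q.2) =
        fun q : ℝ × ℝ => q.2 * ∫ t in (0 : ℝ)..1, T q.1 (t * q.2) := by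
      funext q
      rw [intervalIntegral.mul_integral_comp_mul_right]
      simp [X]
    rw [e]
    refine contDiffAt_snd.mul (contDiffAt_integral (G := fun q : ℝ × ℝ => fun t => T q.1 (t * q.2))
      (U := S ×ˢ Set.univ) (hS.prod isOpen_univ) (fun q hq t _ => ?_) ⟨hs, trivial⟩)
    exact ContDiffAt.comp (g := fun q : ℝ × ℝ => T q.1 q.2)
      (f := fun r : (ℝ × ℝ) × ℝ => (r.1.1, r.2 * r.1.2)) (q, t) (hT q.1 hq.1 (t * q.2))
      (by fun_prop)
  have hXcont : ∀ s ∈ S, Continuous (X s) := fun s hs =>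
    continuous_iff_continuousAt.2 fun ξ => (hXd s hs ξ).continuousAt
  have hmono : ∀ s ∈ S, StrictMono (X s) := fun s hs => by
    obtain ⟨b, hb0, hb⟩ := hb s hs
    exact strictMono_of_deriv_pos fun ξ => by
      rw [(hXd s hs ξ).deriv]; exact hb0.trans_le (hb ξ)
  have hlow : ∀ s ∈ S, ∃ b > 0, Monotone fun ξ => X s ξ - b * ξ := fun s hs => by
    obtain ⟨b, hb0, hb⟩ := hb s hs
    have hd : ∀ ξ, HasDerivAt (fun ξ => X s ξ - b * ξ) (T s ξ - b * 1) ξ := fun ξ =>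
      (hXd s hs ξ).sub ((hasDerivAt_id ξ).const_mul b)
    refine ⟨b, hb0, monotone_of_deriv_nonneg (fun ξ => (hd ξ).differentiableAt) fun ξ => ?_⟩
    rw [(hd ξ).deriv]
    linarith [hb ξ]
  have htop : ∀ s ∈ S, Tendsto (X s) atTop atTop := fun s hs => by
    obtain ⟨b, hb0, hm⟩ := hlow s hs
    refine tendsto_atTop_mono' _ ?_ (tendsto_id.const_mul_atTop hb0)
    filter_upwards [eventually_ge_atTop 0] with ξ hξ
    have := hm hξ
    simp only [hX0, mul_zero, sub_zero] at this
    simp only [id]; linarith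
  have hbot : ∀ s ∈ S, Tendsto (X s) atBot atBot := fun s hs => by
    obtain ⟨b, hb0, hm⟩ := hlow s hs
    refine tendsto_atBot_mono' _ ?_ (tendsto_id.const_mul_atBot hb0)
    filter_upwards [eventually_le_atBot 0] with ξ hξ
    have := hm hξ
    simp only [hX0, mul_zero, sub_zero] at this
    simp only [id]; linarith
  have hsurj : ∀ s ∈ S, Function.Surjective (X s) := fun s hs =>
    (hXcont s hs).surjective (htop s hs) (hbot s hs)
  let Ξ : ℝ → ℝ → ℝ := fun s => Function.invFun (X s)
  have hr : ∀ s ∈ S, ∀ x, X s (Ξ s x) = x := fun s hs =>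
    Function.rightInverse_invFun (hsurj s hs)
  have hl : ∀ s ∈ S, ∀ ξ, Ξ s (X s ξ) = ξ := fun s hs =>
    Function.leftInverse_invFun (hmono s hs).injective
  have hΞc : ∀ s ∈ S, ∀ x, ContDiffAt ℝ 1 (fun q : ℝ × ℝ => Ξ q.1 q.2) (s, x) := by
    intro s hs x
    have hf : ContDiffAt ℝ 1 (fun r : (ℝ × ℝ) × ℝ => X r.1.1 r.2 - r.1.2) ((s, x), Ξ s x) :=
      (ContDiffAt.comp (g := fun q : ℝ × ℝ => X q.1 q.2)
        (f := fun r : (ℝ × ℝ) × ℝ => (r.1.1, r.2)) ((s, x), Ξ s x) (hXc s hs _)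
        (by fun_prop)).sub (by fun_prop)
    have hne : T s (Ξ s x) ≠ 0 := by
      obtain ⟨b, hb0, hb⟩ := hb s hs
      exact (hb0.trans_le (hb _)).ne'
    obtain ⟨ψ, hψ, -, hev⟩ := exists_implicit hf ((hXd s hs _).sub_const x) hne
    refine hψ.congr_of_eventuallyEq ?_
    filter_upwards [hev, (hS.prod isOpen_univ).mem_nhds (Set.mk_mem_prod hs (Set.mem_univ x))]
      with q hq hqS
    simp only [hr s hs, sub_self, sub_eq_zero] at hq
    rw [← hl q.1 hqS.1 (ψ q), hq]
  have hΞmono : ∀ s ∈ S, StrictMono (Ξ s) := fun s hs x y hxy => by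
    rw [← hr s hs x, ← hr s hs y] at hxy
    exact (hmono s hs).lt_iff_lt.1 hxy
  have hΞsurj : ∀ s ∈ S, Function.Surjective (Ξ s) := fun s hs ξ => ⟨X s ξ, hl s hs ξ⟩
  refine ⟨Ξ, fun s hs => ⟨?_, fun x => ?_, hΞc s hs, hΞmono s hs, ?_, ?_⟩⟩
  · have := hl s hs 0
    rwa [hX0] at this
  · have hc : ContinuousAt (Ξ s) x :=
      ContinuousAt.comp (f := fun x : ℝ => (s, x)) (hΞc s hs x).continuousAt (by fun_prop)
    rw [one_div]
    refine HasDerivAt.of_local_left_inverse hc (hXd s hs _) ?_ (Eventually.of_forall (hr s hs))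
    obtain ⟨b, hb0, hb⟩ := hb s hs
    exact (hb0.trans_le (hb _)).ne'
  · exact (hΞmono s hs).monotone.tendsto_atTop_atTop fun ξ => (hΞsurj s hs ξ).imp fun _ h => h.ge
  · exact (hΞmono s hs).monotone.tendsto_atBot_atBot fun ξ => (hΞsurj s hs ξ).imp fun _ h => h.le

end
end Korteweg
namespace Korteweg
noncomputable section

/-- The mean of the force over the segment between the values `vinf + M` and
`vinf + M * sechSq ξ`. -/
def chord (p : ℝ → ℝ) (vinf s M ξ : ℝ) : ℝ :=
  ∫ t in (0 : ℝ)..1, force p vinf s (vinf + M * (1 - t * (1 - sechSq ξ)))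

theorem segment_param_mem {ξ t : ℝ} (ht : t ∈ Set.Icc (0 : ℝ) 1) :
    1 - t * (1 - sechSq ξ) ∈ Set.Icc (0 : ℝ) 1 := by
  have h1 := sechSq_pos ξ
  have h2 := sechSq_le_one ξ
  have h3 : t * (1 - sechSq ξ) ≤ 1 * (1 - sechSq ξ) :=
    mul_le_mul_of_nonneg_right ht.2 (by linarith)
  have h4 : 0 ≤ t * (1 - sechSq ξ) := mul_nonneg ht.1 (by linarith)
  constructor <;> linarith

theorem mem_uIcc_of_segment {vinf M r : ℝ} (hr : r ∈ Set.Icc (0 : ℝ) 1) :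
    vinf + M * r ∈ Set.uIcc vinf (vinf + M) := by
  rw [Set.mem_uIcc]
  rcases le_total 0 M with h | h
  · left; constructor <;> nlinarith [hr.1, hr.2]
  · right; constructor <;> nlinarith [hr.1, hr.2]

theorem uIcc_segment_subset {vinf M r : ℝ} (hr : r ∈ Set.Icc (0 : ℝ) 1) :
    Set.uIcc vinf (vinf + M * r) ⊆ Set.uIcc vinf (vinf + M) :=
  Set.uIcc_subset_uIcc_left (mem_uIcc_of_segment hr)

section Segment

variable {p : ℝ → ℝ} {I : Set ℝ} {κ vinf : ℝ}

theorem sechSq_mem (ξ : ℝ) : sechSq ξ ∈ Set.Icc (0 : ℝ) 1 := ⟨(sechSq_pos ξ).le, sechSq_le_one ξ⟩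

theorem contDiffAt_force (hI : IsOpen I) (hp : ContDiffOn ℝ 2 p I) {s y : ℝ} (hy : y ∈ I) :
    ContDiffAt ℝ 1 (fun q : ℝ × ℝ => force p vinf q.1 q.2) (s, y) := by
  have h1 : ContDiffAt ℝ 1 (fun q : ℝ × ℝ => p q.2) (s, y) :=
    ContDiffAt.comp (g := p) (f := fun q : ℝ × ℝ => q.2) (s, y)
      ((hp.contDiffAt (hI.mem_nhds hy)).of_le (by norm_num)) contDiffAt_snd
  unfold force
  exact (h1.sub contDiffAt_const).add (by fun_prop)

/-- The increment of the potential from the crest value. -/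
theorem potential_segment (hI : IsOpen I) (hp : ContDiffOn ℝ 2 p I) {s M : ℝ}
    (hsub : Set.uIcc vinf (vinf + M) ⊆ I) (h0 : potential p vinf s (vinf + M) = 0) (ξ : ℝ) :
    potential p vinf s (vinf + M * sechSq ξ) = -(M * (1 - sechSq ξ)) * chord p vinf s M ξ := by
  have hd : ∀ t ∈ Set.uIcc (0 : ℝ) 1,
      HasDerivAt (fun t => potential p vinf s (vinf + M * (1 - t * (1 - sechSq ξ))))
        (-(M * (1 - sechSq ξ)) * force p vinf s (vinf + M * (1 - t * (1 - sechSq ξ)))) t := by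
    intro t ht
    rw [Set.uIcc_of_le zero_le_one] at ht
    have h1 : HasDerivAt (fun t => vinf + M * (1 - t * (1 - sechSq ξ))) (-(M * (1 - sechSq ξ))) t := by
      refine ((((hasDerivAt_id t).mul_const (1 - sechSq ξ)).const_sub 1).const_mul M).const_add vinf
        |>.congr_deriv ?_
      ring
    rw [mul_comm]
    exact (hasDerivAt_potential hI hp.continuousOn
      ((uIcc_segment_subset (segment_param_mem ht)).trans hsub)).comp t h1
  have hc : ContinuousOn (fun t => -(M * (1 - sechSq ξ)) *
      force p vinf s (vinf + M * (1 - t * (1 - sechSq ξ)))) (Set.uIcc 0 1) := by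
    intro t ht
    rw [Set.uIcc_of_le zero_le_one] at ht
    refine (ContinuousAt.comp (g := fun q : ℝ × ℝ => force p vinf q.1 q.2)
      (f := fun t : ℝ => (s, vinf + M * (1 - t * (1 - sechSq ξ)))) (contDiffAt_force hI hp
        (hsub (mem_uIcc_of_segment (segment_param_mem ht)))).continuousAt
      (by fun_prop)).const_mul _ |>.continuousWithinAt
  have := intervalIntegral.integral_eq_sub_of_hasDerivAt hd hc.intervalIntegrable
  rw [intervalIntegral.integral_const_mul] at this
  unfold chord
  rw [this]
  simp [h0]

theorem contDiffAt_chord (hI : IsOpen I) (hp : ContDiffOn ℝ 2 p I) {S : Set ℝ} (hS : IsOpen S)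
    {M : ℝ → ℝ} (hM : ∀ s ∈ S, ContDiffAt ℝ 1 M s)
    (hsub : ∀ s ∈ S, Set.uIcc vinf (vinf + M s) ⊆ I) {s : ℝ} (hs : s ∈ S) (ξ : ℝ) :
    ContDiffAt ℝ 1 (fun q : ℝ × ℝ => chord p vinf q.1 (M q.1) q.2) (s, ξ) := by
  unfold chord
  refine contDiffAt_integral
    (G := fun q t => force p vinf q.1 (vinf + M q.1 * (1 - t * (1 - sechSq q.2))))
    (hS.prod isOpen_univ) (fun q hq t ht => ?_) (Set.mk_mem_prod hs (Set.mem_univ ξ))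
  have h1 : ContDiffAt ℝ 1 (fun r : (ℝ × ℝ) × ℝ => M r.1.1) (q, t) :=
    ContDiffAt.comp (g := M) (f := fun r : (ℝ × ℝ) × ℝ => r.1.1) (q, t) (hM _ hq.1) (by fun_prop)
  have h2 : ContDiffAt ℝ 1 (fun r : (ℝ × ℝ) × ℝ => sechSq r.1.2) (q, t) :=
    ContDiffAt.comp (g := sechSq) (f := fun r : (ℝ × ℝ) × ℝ => r.1.2) (q, t)
      contDiff_sechSq.contDiffAt (by fun_prop)
  exact ContDiffAt.comp (g := fun q : ℝ × ℝ => force p vinf q.1 q.2)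
    (f := fun r : (ℝ × ℝ) × ℝ => (r.1.1, vinf + M r.1.1 * (1 - r.2 * (1 - sechSq r.1.2))))
    (q, t) (contDiffAt_force hI hp (hsub _ hq.1 (mem_uIcc_of_segment (segment_param_mem ht))))
    (ContDiffAt.prodMk (by fun_prop) (contDiffAt_const.add
      (h1.mul (contDiffAt_const.sub (contDiffAt_snd.mul (contDiffAt_const.sub h2))))))

/-- Profiles reconstructed from their crests: a curve of nonzero zeros `vinf + M s` of the potential
that are separated from the endstate by a well carries a family of homoclinic orbits. -/
theorem exists_profiles (hI : IsOpen I) (hp : ContDiffOn ℝ 2 p I) (hκ : 0 < κ) {S : Set ℝ}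
    (hS : IsOpen S) {M : ℝ → ℝ} (hM : ∀ s ∈ S, ContDiffAt ℝ 1 M s) (hM0 : ∀ s ∈ S, M s ≠ 0)
    (hsub : ∀ s ∈ S, Set.uIcc vinf (vinf + M s) ⊆ I)
    (hpot : ∀ s ∈ S, potential p vinf s (vinf + M s) = 0)
    (hpos : ∀ s ∈ S, ∀ ξ, 0 < chord p vinf s (M s) ξ / M s) {ε Γ : ℝ} (hε : 0 < ε) (hΓ : 0 < Γ)
    (hsad : ∀ s ∈ S, ∀ y, |y - vinf| ≤ ε →
      -(2 / κ) * potential p vinf s y ≤ Γ ^ 2 * (y - vinf) ^ 2) :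
    ∃ V V' : ℝ → ℝ → ℝ, ∀ s ∈ S, (∀ x, ContDiffAt ℝ 1 (fun q : ℝ × ℝ => V q.1 q.2) (s, x)) ∧
      V s 0 = vinf + M s ∧ V' s 0 = 0 ∧ (∀ x, HasDerivAt (V s) (V' s x) x) ∧
      (∀ x, HasDerivAt (V' s) (-force p vinf s (V s x) / κ) x) ∧ (∀ x, V s x ∈ I) ∧
      Tendsto (V s) atTop (𝓝 vinf) ∧ Tendsto (V s) atBot (𝓝 vinf) := by
  let k : ℝ → ℝ → ℝ := fun s ξ => chord p vinf s (M s) ξ / M s / (2 * κ)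
  have hk : ∀ s ∈ S, ∀ ξ, 0 < k s ξ := fun s hs ξ => div_pos (hpos s hs ξ) (by positivity)
  have hkc : ∀ s ∈ S, ∀ ξ, ContDiffAt ℝ 1 (fun q : ℝ × ℝ => k q.1 q.2) (s, ξ) := fun s hs ξ =>
    ((contDiffAt_chord hI hp hS hM hsub hs ξ).div (ContDiffAt.comp (g := M) (f := Prod.fst) (s, ξ)
      (hM s hs) contDiffAt_fst) (hM0 s hs)).div_const _
  have hpk : ∀ s ∈ S, ∀ ξ, -(2 / κ) * potential p vinf s (vinf + M s * sechSq ξ) =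
      4 * M s ^ 2 * (1 - sechSq ξ) * k s ξ := fun s hs ξ => by
    have := hM0 s hs
    rw [potential_segment hI hp (hsub s hs) (hpot s hs)]
    simp only [k]
    field_simp
    ring
  have hq : ContDiff ℝ 1 fun q : ℝ × ℝ => sechSq q.2 := contDiff_sechSq.comp contDiff_snd
  let T : ℝ → ℝ → ℝ := fun s ξ => sechSq ξ / √(k s ξ)
  have hTc : ∀ s ∈ S, ∀ ξ, ContDiffAt ℝ 1 (fun q : ℝ × ℝ => T q.1 q.2) (s, ξ) := fun s hs ξ =>
    hq.contDiffAt.div ((hkc s hs ξ).sqrt (hk s hs ξ).ne') (Real.sqrt_pos.2 (hk s hs ξ)).ne'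
  have hTpos : ∀ s ∈ S, ∀ ξ, 0 < T s ξ := fun s hs ξ =>
    div_pos (sechSq_pos ξ) (Real.sqrt_pos.2 (hk s hs ξ))
  have hTb : ∀ s ∈ S, ∃ b > 0, ∀ ξ, b ≤ T s ξ := by
    intro s hs
    have hcont : Continuous fun ξ => 1 / T s ξ := continuous_iff_continuousAt.2 fun ξ =>
      continuousAt_const.div (ContinuousAt.comp (f := fun ξ : ℝ => (s, ξ)) (hTc s hs ξ).continuousAt
        (by fun_prop)) (hTpos s hs ξ).ne'
    have hsmall : ∀ ξ, |M s| * sechSq ξ ≤ ε → sechSq ξ ≤ 1 / 2 → |1 / T s ξ| ≤ Γ := by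
      intro ξ h1 h2
      have hqp := sechSq_pos ξ
      have h3 := hsad s hs (vinf + M s * sechSq ξ) (by
        rw [add_sub_cancel_left, abs_mul, abs_of_pos hqp]; exact h1)
      rw [hpk s hs, add_sub_cancel_left] at h3
      have hM2 : 0 < M s ^ 2 := by have := hM0 s hs; positivity
      have h4 : 4 * (1 - sechSq ξ) * k s ξ ≤ Γ ^ 2 * sechSq ξ ^ 2 := by
        refine le_of_mul_le_mul_left ?_ hM2
        linarith
      have h5 : k s ξ ≤ (Γ * sechSq ξ) ^ 2 := by nlinarith [hk s hs ξ]
      rw [abs_of_pos (one_div_pos.2 (hTpos s hs ξ))]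
      simp only [T, one_div_div]
      rw [div_le_iff₀ hqp]
      exact Real.sqrt_le_iff.2 ⟨by positivity, h5⟩
    have hev : ∀ l : Filter ℝ, Tendsto sechSq l (𝓝 0) → ∀ᶠ ξ in l, |1 / T s ξ| ≤ Γ := by
      intro l hl
      have h1 : Tendsto (fun ξ => |M s| * sechSq ξ) l (𝓝 0) := by simpa using hl.const_mul |M s|
      filter_upwards [h1.eventually_le_const hε, hl.eventually_le_const (half_pos one_pos)]
        with ξ h1 h2 using hsmall ξ h1 h2
    obtain ⟨B, hB⟩ := exists_bound_of_eventually hcont (hev _ tendsto_sechSq_atTop)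
      (hev _ tendsto_sechSq_atBot)
    have hBpos : 0 < B := (abs_pos.2 (one_div_pos.2 (hTpos s hs 0)).ne').trans_le (hB 0)
    refine ⟨1 / B, by positivity, fun ξ => ?_⟩
    rw [one_div_le hBpos (hTpos s hs ξ)]
    exact (le_abs_self _).trans (hB ξ)
  obtain ⟨Ξ, hΞ⟩ := exists_travel hS hTc hTb
  let th : ℝ → ℝ := fun x => Real.sinh x / Real.cosh x
  have hth : ContDiff ℝ 1 th := Real.contDiff_sinh.div Real.contDiff_cosh fun x =>
    (Real.cosh_pos x).ne'
  let D : ℝ → ℝ → ℝ := fun s ξ => -2 * M s * th ξ * √(k s ξ)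
  refine ⟨fun s x => vinf + M s * sechSq (Ξ s x), fun s x => D s (Ξ s x), fun s hs => ?_⟩
  obtain ⟨hΞ0, hΞd, hΞc, hΞm, hΞt, hΞb⟩ := hΞ s hs
  have hVd : ∀ x, HasDerivAt (fun x => vinf + M s * sechSq (Ξ s x)) (D s (Ξ s x)) x := fun x => by
    refine ((((hasDerivAt_sechSq (Ξ s x)).comp x (hΞd x)).const_mul (M s)).const_add
      vinf).congr_deriv ?_
    have h1 := (sechSq_pos (Ξ s x)).ne'
    have h2 := (Real.sqrt_pos.2 (hk s hs (Ξ s x))).ne'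
    simp only [D, T, th]
    field_simp
  have hmem : ∀ x, vinf + M s * sechSq (Ξ s x) ∈ I := fun x =>
    hsub s hs (mem_uIcc_of_segment (sechSq_mem _))
  have hDc : ContDiff ℝ 1 fun x => D s (Ξ s x) := by
    rw [contDiff_iff_contDiffAt]
    intro x
    have h1 : ContDiffAt ℝ 1 (D s) (Ξ s x) := by
      have h2 : ContDiffAt ℝ 1 (k s) (Ξ s x) := ContDiffAt.comp (g := fun q : ℝ × ℝ => k q.1 q.2)
        (f := fun ξ : ℝ => (s, ξ)) (Ξ s x) (hkc s hs _) (by fun_prop)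
      exact (contDiffAt_const.mul hth.contDiffAt).mul (h2.sqrt (hk s hs _).ne')
    exact h1.comp x (ContDiffAt.comp (g := fun q : ℝ × ℝ => Ξ q.1 q.2)
      (f := fun x : ℝ => (s, x)) x (hΞc x) (by fun_prop))
  have hD2 : ∀ x, D s (Ξ s x) ^ 2 = -(2 / κ) * potential p vinf s (vinf + M s * sechSq (Ξ s x)) :=
    fun x => by
      rw [hpk s hs]
      simp only [D, mul_pow, th, sq_sinh_div_cosh, Real.sq_sqrt (hk s hs _).le]
      ring
  have hVc : Continuous fun x => vinf + M s * sechSq (Ξ s x) :=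
    continuous_iff_continuousAt.2 fun x => (hVd x).continuousAt
  have hDd : ∀ x, HasDerivAt (fun x => D s (Ξ s x)) (deriv (fun x => D s (Ξ s x)) x) x := fun x =>
    (hDc.differentiable (by norm_num) x).hasDerivAt
  have hD' : deriv (fun x => D s (Ξ s x)) =
      fun x => -force p vinf s (vinf + M s * sechSq (Ξ s x)) / κ := by
    refine eq_of_eq_off_point (a := 0) (hDc.continuous_deriv (by norm_num)) ?_ fun x hx => ?_
    · refine continuous_iff_continuousAt.2 fun x => ?_
      have h1 : ContinuousAt (fun x => force p vinf s (vinf + M s * sechSq (Ξ s x))) x :=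
        ContinuousAt.comp (g := fun q : ℝ × ℝ => force p vinf q.1 q.2)
          (f := fun x => (s, vinf + M s * sechSq (Ξ s x))) (contDiffAt_force hI hp
          (hmem x)).continuousAt (continuousAt_const.prodMk hVc.continuousAt)
      exact h1.neg.div_const κ
    · have hne : D s (Ξ s x) ≠ 0 := by
        have h1 : Ξ s x ≠ 0 := fun h => hx (hΞm.injective (h.trans hΞ0.symm))
        have h2 := Real.sinh_ne_zero.2 h1
        have h3 := (Real.cosh_pos (Ξ s x)).ne'
        have h4 := (Real.sqrt_pos.2 (hk s hs (Ξ s x))).ne'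
        have h5 := hM0 s hs
        simp only [D, th]
        positivity
      have h1 := (hDd x).pow 2
      have h2 := ((hasDerivAt_potential (s := s) hI hp.continuousOn
        ((uIcc_segment_subset (sechSq_mem (Ξ s x))).trans (hsub s hs))).comp x
        (hVd x)).const_mul (-(2 / κ))
      have h3 := h1.unique (h2.congr_of_eventuallyEq (Eventually.of_forall hD2))
      have h4 := hκ.ne'
      refine mul_left_cancel₀ hne ?_
      simp at h3
      field_simp at h3 ⊢
      linarith
  have hlim : ∀ l : Filter ℝ, Tendsto (fun x => sechSq (Ξ s x)) l (𝓝 0) →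
      Tendsto (fun x => vinf + M s * sechSq (Ξ s x)) l (𝓝 vinf) := fun l hl => by
    simpa using (hl.const_mul (M s)).const_add vinf
  refine ⟨fun x => ?_, by simp [hΞ0], by simp [D, th, hΞ0], hVd, fun x => ?_, hmem,
    hlim _ (tendsto_sechSq_atTop.comp hΞt), hlim _ (tendsto_sechSq_atBot.comp hΞb)⟩
  · have h1 : ContDiffAt ℝ 1 (fun q : ℝ × ℝ => M q.1) (s, x) :=
      ContDiffAt.comp (g := M) (f := Prod.fst) (s, x) (hM s hs) contDiffAt_fst
    have h2 : ContDiffAt ℝ 1 (fun q : ℝ × ℝ => sechSq (Ξ q.1 q.2)) (s, x) :=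
      ContDiffAt.comp (g := sechSq) (f := fun q : ℝ × ℝ => Ξ q.1 q.2) (s, x)
        contDiff_sechSq.contDiffAt (hΞc x)
    exact contDiffAt_const.add (h1.mul h2)
  · have := hDd x
    rwa [hD'] at this

/-- Homoclinic orbits of the profile equation are profiles of solitary waves. -/
theorem isSolitaryWave_of_profile (hI : IsOpen I) (hp : ContDiffOn ℝ 2 p I) (hκ : 0 < κ)
    {s uinf : ℝ} {v v' : ℝ → ℝ} (h1 : ∀ x, HasDerivAt v (v' x) x)
    (h2 : ∀ x, HasDerivAt v' (-force p vinf s (v x) / κ) x) (hmem : ∀ x, v x ∈ I)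
    (htop : Tendsto v atTop (𝓝 vinf)) (hbot : Tendsto v atBot (𝓝 vinf)) (hne : ∃ x, v x ≠ vinf) :
    IsSolitaryWave p I κ s vinf uinf v fun x => uinf - s * (v x - vinf) := by
  have hκ' := hκ.ne'
  have e1 : deriv v = v' := funext fun x => (h1 x).deriv
  have e2 : deriv v' = fun x => -force p vinf s (v x) / κ := funext fun x => (h2 x).deriv
  have hpd : ∀ x, HasDerivAt (fun y => p (v y)) (deriv p (v x) * v' x) x := fun x =>
    ((hp.contDiffAt (hI.mem_nhds (hmem x))).differentiableAt (by norm_num)).hasDerivAt.comp x (h1 x)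
  have h3 : ∀ x, HasDerivAt (fun x => -force p vinf s (v x) / κ)
      (-(deriv p (v x) * v' x + s ^ 2 * v' x) / κ) x := fun x =>
    ((((hpd x).sub_const _).add (((h1 x).sub_const vinf).const_mul (s ^ 2))).neg).div_const κ
  have hv1 : ContDiff ℝ 1 v := by
    refine contDiff_one_iff_deriv.2 ⟨fun x => (h1 x).differentiableAt, ?_⟩
    rw [e1]
    exact continuous_iff_continuousAt.2 fun x => (h2 x).continuousAt
  have hF : ContDiff ℝ 1 fun x => -force p vinf s (v x) / κ := by
    refine contDiff_iff_contDiffAt.2 fun x => ContDiffAt.div_const (ContDiffAt.neg ?_) κ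
    exact ContDiffAt.comp (g := fun q : ℝ × ℝ => force p vinf q.1 q.2) (f := fun x => (s, v x)) x
      (contDiffAt_force hI hp (hmem x)) (contDiffAt_const.prodMk hv1.contDiffAt)
  have hv' : ContDiff ℝ 2 v' := by
    rw [show (2 : WithTop ℕ∞) = 1 + 1 by norm_num, contDiff_succ_iff_deriv]
    exact ⟨fun x => (h2 x).differentiableAt, by simp, by rw [e2]; exact hF⟩
  have hv : ContDiff ℝ 3 v := by
    rw [show (3 : WithTop ℕ∞) = 2 + 1 by norm_num, contDiff_succ_iff_deriv]
    exact ⟨fun x => (h1 x).differentiableAt, by simp, by rw [e1]; exact hv'⟩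
  have hu : ∀ x, HasDerivAt (fun x => uinf - s * (v x - vinf)) (-(s * v' x)) x := fun x =>
    (((h1 x).sub_const vinf).const_mul s).const_sub uinf
  have hlim : ∀ l : Filter ℝ, Tendsto v l (𝓝 vinf) →
      Tendsto (fun x => uinf - s * (v x - vinf)) l (𝓝 uinf) := fun l hl => by
    simpa using ((hl.sub_const vinf).const_mul s).const_sub uinf
  refine ⟨hv, contDiff_const.sub (contDiff_const.mul (hv1.sub contDiff_const)), hmem, fun x => ?_,
    fun x => ?_, htop, hbot, hlim _ htop, hlim _ hbot, hne⟩
  · rw [(hu x).deriv, e1]; ring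
  · rw [(hu x).deriv, (hpd x).deriv, iteratedDeriv_succ, iteratedDeriv_succ, iteratedDeriv_one, e1,
      e2, (h3 x).deriv]
    field_simp
    ring

end Segment
end
end Korteweg
namespace Korteweg
noncomputable section

theorem eventually_uIcc_subset {I : Set ℝ} (hI : IsOpen I) {a b : ℝ} (h : Set.uIcc a b ⊆ I) :
    ∀ᶠ y in 𝓝 b, Set.uIcc a y ⊆ I := by
  obtain ⟨δ, hδ, hball⟩ := Metric.isOpen_iff.1 hI b (h Set.right_mem_uIcc)
  filter_upwards [Metric.ball_mem_nhds b hδ] with y hy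
  refine Set.uIcc_subset_uIcc_union_uIcc.trans (Set.union_subset h (Set.Subset.trans ?_ hball))
  have hb := Metric.mem_ball_self (x := b) hδ
  rw [Real.ball_eq_Ioo] at hy hb ⊢
  exact Set.ordConnected_Ioo.uIcc_subset hb hy

theorem contDiffAt_potential {p : ℝ → ℝ} {I : Set ℝ} {vinf : ℝ} (hI : IsOpen I)
    (hp : ContDiffOn ℝ 2 p I) {s y : ℝ} (hy : Set.uIcc vinf y ⊆ I) :
    ContDiffAt ℝ 1 (fun q : ℝ × ℝ => potential p vinf q.1 q.2) (s, y) := by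
  have h1 : ContDiffAt ℝ 1 (fun y => ∫ z in vinf..y, (p z - p vinf)) y := by
    refine contDiffAt_one_iff.2 ⟨fun y => ContinuousLinearMap.toSpanSingleton ℝ (p y - p vinf), _,
      eventually_uIcc_subset hI hy, ?_, fun y hy => ?_⟩
    · intro y hy
      have hc : ContinuousAt p y :=
        hp.continuousOn.continuousAt (hI.mem_nhds (hy Set.right_mem_uIcc))
      exact ((ContinuousLinearMap.toSpanSingletonCLE (𝕜 := ℝ) (E := ℝ)).continuous.continuousAt.comp
        (f := fun y => p y - p vinf) (hc.sub continuousAt_const)).continuousWithinAt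
    · exact (hasDerivAt_primitive hI hp.continuousOn hy).hasFDerivAt
  have h2 : ContDiffAt ℝ 1 (fun q : ℝ × ℝ => ∫ z in vinf..q.2, (p z - p vinf)) (s, y) :=
    ContDiffAt.comp (f := Prod.snd) (s, y) h1 contDiffAt_snd
  unfold potential
  exact h2.add (by fun_prop)

namespace IsSaddleWave

variable {p : ℝ → ℝ} {I : Set ℝ} {κ s vinf uinf : ℝ} {v u : ℝ → ℝ}

theorem exists_crest (h : IsSaddleWave p I κ s vinf uinf v u) : ∃ x₀, deriv v x₀ = 0 := by
  have hc : Continuous fun x => (v x - vinf) ^ 2 := (h.wave.continuous_v.sub continuous_const).pow 2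
  have hlim : ∀ l : Filter ℝ, Tendsto v l (𝓝 vinf) →
      Tendsto (fun x => (v x - vinf) ^ 2) l (𝓝 0) := fun l hl => by
    simpa using (hl.sub_const vinf).pow 2
  have hpos : 0 < (v 0 - vinf) ^ 2 := by
    have := sub_ne_zero.2 (h.ne_inf 0)
    positivity
  obtain ⟨x₀, hx₀⟩ := hc.exists_forall_ge' (x₀ := 0) (by
    rw [cocompact_eq_atBot_atTop, eventually_sup]
    exact ⟨(hlim _ h.wave.v_atBot).eventually_le_const hpos,
      (hlim _ h.wave.v_atTop).eventually_le_const hpos⟩)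
  have hd := ((h.wave.hasDerivAt_v x₀).sub_const vinf).pow 2
  have h0 := IsLocalMax.hasDerivAt_eq_zero (Eventually.of_forall hx₀) hd
  refine ⟨x₀, ?_⟩
  simpa [sub_ne_zero.2 (h.ne_inf x₀)] using h0

/-- The potential is negative strictly between the endstate and the crest. -/
theorem potential_neg (h : IsSaddleWave p I κ s vinf uinf v u) (x₀ : ℝ) {r : ℝ}
    (hr : r ∈ Set.Ioo (0 : ℝ) 1) : potential p vinf s (vinf + (v x₀ - vinf) * r) < 0 := by
  have hM := sub_ne_zero.2 (h.ne_inf x₀)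
  have hrange : ∀ r ∈ Set.Ioo (0 : ℝ) 1, ∃ x, v x = vinf + (v x₀ - vinf) * r := fun r hr => by
    refine h.wave.mem_range (x := x₀) ?_ (by simp [hM, hr.1.ne'])
    have := mem_uIcc_of_segment (vinf := vinf) (M := v x₀ - vinf) (Set.Ioo_subset_Icc_self hr)
    rwa [add_sub_cancel] at this
  have hle : ∀ r ∈ Set.Ioo (0 : ℝ) 1, potential p vinf s (vinf + (v x₀ - vinf) * r) ≤ 0 :=
    fun r hr => by
      obtain ⟨x, hx⟩ := hrange r hr
      have := h.energy x
      rw [← hx]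
      nlinarith [h.pos, sq_nonneg (deriv v x)]
  refine lt_of_le_of_ne (hle r hr) fun h0 => ?_
  obtain ⟨x, hx⟩ := hrange r hr
  have hd : deriv v x = 0 := by
    have h1 := h.energy x
    rw [hx, h0, add_zero] at h1
    have h2 := h.pos.ne'
    simpa [h2] using h1
  have hmax : IsLocalMax (fun r => potential p vinf s (vinf + (v x₀ - vinf) * r)) r := by
    filter_upwards [isOpen_Ioo.mem_nhds hr] with r' hr'
    rw [h0]
    exact hle r' hr'
  have h1 : HasDerivAt (fun r => vinf + (v x₀ - vinf) * r) ((v x₀ - vinf) * 1) r :=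
    ((hasDerivAt_id r).const_mul (v x₀ - vinf)).const_add vinf
  have h2 := h.hasDerivAt_potential x
  rw [hx] at h2
  have h3 := hmax.hasDerivAt_eq_zero (HasDerivAt.comp (h₂ := potential p vinf s) r h2 h1)
  rw [← hx] at h3
  simp [h.force_ne_zero hd, hM] at h3

theorem chord_pos (h : IsSaddleWave p I κ s vinf uinf v u) {x₀ : ℝ} (hx₀ : deriv v x₀ = 0)
    (ξ : ℝ) : 0 < chord p vinf s (v x₀ - vinf) ξ / (v x₀ - vinf) := by
  have hM := sub_ne_zero.2 (h.ne_inf x₀)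
  have hsub := h.wave.uIcc_subset h.mem_inf x₀
  have hpot : potential p vinf s (v x₀) = 0 := by
    have := h.energy x₀
    rw [hx₀] at this
    simpa using this
  rw [← add_sub_cancel vinf (v x₀)] at hsub hpot
  have hpos : ∀ ξ ≠ 0, 0 < chord p vinf s (v x₀ - vinf) ξ / (v x₀ - vinf) := fun ξ hξ => by
    have h1 := h.potential_neg x₀ ⟨sechSq_pos ξ, sechSq_lt_one hξ⟩
    rw [potential_segment h.isOpen h.contDiffOn hsub hpot] at h1
    have h2 : 0 < (chord p vinf s (v x₀ - vinf) ξ / (v x₀ - vinf)) *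
        ((1 - sechSq ξ) * (v x₀ - vinf) ^ 2) := by
      field_simp
      linarith
    exact pos_of_mul_pos_left h2 (mul_nonneg (by linarith [sechSq_le_one ξ]) (sq_nonneg _))
  rcases eq_or_ne ξ 0 with rfl | hξ
  · have hc : ContinuousAt (fun ξ => chord p vinf s (v x₀ - vinf) ξ / (v x₀ - vinf)) 0 :=
      (ContinuousAt.comp (g := fun q : ℝ × ℝ => chord p vinf q.1 (v x₀ - vinf) q.2)
        (f := fun ξ : ℝ => (s, ξ)) (contDiffAt_chord h.isOpen h.contDiffOn isOpen_univ
        (M := fun _ => v x₀ - vinf) (fun _ _ => contDiffAt_const) (fun _ _ => hsub)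
        (Set.mem_univ s) 0).continuousAt (by fun_prop)).div_const _
    refine lt_of_le_of_ne ?_ (Ne.symm (div_ne_zero ?_ hM))
    · exact ge_of_tendsto (hc.tendsto.mono_left nhdsWithin_le_nhds)
        (eventually_nhdsWithin_of_forall (s := {0}ᶜ) fun ξ hξ => (hpos ξ hξ).le)
    · simpa [chord] using h.force_ne_zero hx₀
  · exact hpos ξ hξ

theorem exists_crest_curve (h : IsSaddleWave p I κ s vinf uinf v u) {x₀ : ℝ}
    (hx₀ : deriv v x₀ = 0) : ∃ M : ℝ → ℝ, M s = v x₀ - vinf ∧ ∀ᶠ r in 𝓝 s, ContDiffAt ℝ 1 M r ∧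
      M r ≠ 0 ∧ Set.uIcc vinf (vinf + M r) ⊆ I ∧ potential p vinf r (vinf + M r) = 0 := by
  have hsub := h.wave.uIcc_subset h.mem_inf x₀
  have hpot : potential p vinf s (v x₀) = 0 := by
    have := h.energy x₀
    rw [hx₀] at this
    simpa using this
  obtain ⟨ψ, hψ, hψs, hev⟩ := exists_implicit (contDiffAt_potential h.isOpen h.contDiffOn hsub)
    (h.hasDerivAt_potential x₀) (h.force_ne_zero hx₀)
  refine ⟨fun r => ψ r - vinf, by simp [hψs], ?_⟩
  have hψc : Tendsto ψ (𝓝 s) (𝓝 (v x₀)) := hψs ▸ hψ.continuousAt.tendsto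
  filter_upwards [hψ.eventually (by simp), hev, hψc.eventually_ne (h.ne_inf x₀),
    hψc.eventually (eventually_uIcc_subset h.isOpen hsub)] with r h1 h2 h3 h4
  refine ⟨h1.sub contDiffAt_const, sub_ne_zero.2 h3, ?_, ?_⟩
  · rwa [add_sub_cancel]
  · rw [add_sub_cancel]
    exact h2.trans hpot

/-- The existence of a wave family. -/
theorem exists_waveFamily (h : IsSaddleWave p I κ s vinf uinf v u) :
    ∃ V U : ℝ → ℝ → ℝ, IsWaveFamily p I κ s vinf uinf v u V U := by
  obtain ⟨x₀, hx₀⟩ := h.exists_crest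
  obtain ⟨M, hMs, hM⟩ := h.exists_crest_curve hx₀
  obtain ⟨ε, hε, g, hg, Γ, hΓ, -, hb⟩ := exists_saddle_bounds h.isOpen h.contDiffOn h.pos h.mem_inf
    h.saddle
  obtain ⟨S, hS, hSo, hsS⟩ := eventually_nhds_iff.1 (hM.and hb)
  have hchord : ∀ r ∈ S, ∀ ξ, ContDiffAt ℝ 1 (fun q : ℝ × ℝ => chord p vinf q.1 (M q.1) q.2)
      (r, ξ) := fun r hr ξ => contDiffAt_chord h.isOpen h.contDiffOn hSo
    (fun r hr => (hS r hr).1.1) (fun r hr => (hS r hr).1.2.2.1) hr ξ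
  have hMc : ContinuousAt M s := (hS s hsS).1.1.continuousAt
  have hfar : ∃ Λ : ℝ, ∀ ξ, Λ < |ξ| → (|M s| + 1) * sechSq ξ ≤ ε ∧ sechSq ξ < 1 := by
    have h1 : ∀ l : Filter ℝ, Tendsto sechSq l (𝓝 0) →
        ∀ᶠ ξ in l, (|M s| + 1) * sechSq ξ ≤ ε ∧ sechSq ξ < 1 := fun l hl => by
      have h2 : Tendsto (fun ξ => (|M s| + 1) * sechSq ξ) l (𝓝 0) := by
        simpa using hl.const_mul (|M s| + 1)
      exact (h2.eventually_le_const hε).and (hl.eventually_lt_const one_pos)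
    obtain ⟨A, hA⟩ := eventually_atTop.1 (h1 _ tendsto_sechSq_atTop)
    obtain ⟨B, hB⟩ := eventually_atBot.1 (h1 _ tendsto_sechSq_atBot)
    refine ⟨max A (-B), fun ξ hξ => ?_⟩
    rcases le_total 0 ξ with h0 | h0
    · rw [abs_of_nonneg h0] at hξ
      exact hA ξ ((le_max_left _ _).trans hξ.le)
    · rw [abs_of_nonpos h0] at hξ
      exact hB ξ (by linarith [le_max_right A (-B)])
  obtain ⟨Λ, hΛ⟩ := hfar
  have hnear : ∀ᶠ r in 𝓝 s, ∀ ξ ∈ Set.Icc (-Λ) Λ, 0 < chord p vinf r (M r) ξ / M r := by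
    refine isCompact_Icc.eventually_forall_of_forall_eventually fun ξ _ => ?_
    have hc : ContinuousAt (fun q : ℝ × ℝ => chord p vinf q.1 (M q.1) q.2 / M q.1) (s, ξ) :=
      (hchord s hsS ξ).continuousAt.div (ContinuousAt.comp (g := M) (f := Prod.fst) hMc
        continuousAt_fst) (hS s hsS).1.2.1
    exact hc.eventually_const_lt (by simpa [hMs] using h.chord_pos hx₀ ξ)
  have hpos : ∀ᶠ r in 𝓝 s, r ∈ S ∧ ∀ ξ, 0 < chord p vinf r (M r) ξ / M r := by
    have hMb : ∀ᶠ r in 𝓝 s, |M r| < |M s| + 1 :=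
      hMc.abs.eventually_lt_const (lt_add_one _)
    filter_upwards [hnear, hMb, hSo.mem_nhds hsS] with r h1 h2 hr
    refine ⟨hr, fun ξ => ?_⟩
    rcases le_or_gt |ξ| Λ with hξ | hξ
    · exact h1 ξ (abs_le.1 hξ)
    obtain ⟨⟨-, hM0, hsub, hpot⟩, -, hwell⟩ := hS r hr
    have hq := sechSq_pos ξ
    have h3 := (hwell (vinf + M r * sechSq ξ) (by
      rw [add_sub_cancel_left, abs_mul, abs_of_pos hq]
      exact (mul_le_mul_of_nonneg_right h2.le hq.le).trans (hΛ ξ hξ).1)).1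
    rw [potential_segment h.isOpen h.contDiffOn hsub hpot, add_sub_cancel_left] at h3
    have hκ := h.pos
    have h4 : 0 < (chord p vinf r (M r) ξ / M r) * (2 / κ * (1 - sechSq ξ) * M r ^ 2) := by
      have h5 : 0 < g ^ 2 * (M r * sechSq ξ) ^ 2 := by positivity
      refine (h5.trans_le h3).trans_eq ?_
      field_simp
    refine pos_of_mul_pos_left h4 ?_
    have := (hΛ ξ hξ).2
    have : 0 < 1 - sechSq ξ := by linarith
    positivity
  obtain ⟨δ, hδ, hball⟩ := Metric.eventually_nhds_iff_ball.1 hpos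
  rw [Real.ball_eq_Ioo] at hball
  obtain ⟨V, V', hV⟩ := exists_profiles h.isOpen h.contDiffOn h.pos
    (S := Set.Ioo (s - δ) (s + δ)) isOpen_Ioo
    (fun r hr => (hS r (hball r hr).1).1.1) (fun r hr => (hS r (hball r hr).1).1.2.1)
    (fun r hr => (hS r (hball r hr).1).1.2.2.1) (fun r hr => (hS r (hball r hr).1).1.2.2.2)
    (fun r hr => (hball r hr).2) hε hΓ (fun r hr y hy => ((hS r (hball r hr).1).2.2 y hy).2)
  have hsδ : s ∈ Set.Ioo (s - δ) (s + δ) := by constructor <;> linarith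
  have hveq : (fun x => V s (x - x₀)) = v := by
    obtain ⟨-, h0, h0', h1, h2, -⟩ := hV s hsδ
    refine (h.eq_of_eq (v₂ := fun x => V s (x - x₀)) (v₂' := fun x => V' s (x - x₀)) (x₀ := x₀)
      (fun x => (h1 (x - x₀)).comp_sub_const x x₀) (fun x => (h2 (x - x₀)).comp_sub_const x x₀)
      ?_ ?_).symm
    · simp [h0, hMs]
    · simp [h0', hx₀]
  have hVc : ContDiffOn ℝ 1 (fun q : ℝ × ℝ => V q.1 (q.2 - x₀))
      (Set.Ioo (s - δ) (s + δ) ×ˢ Set.univ) := fun q hq =>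
    (ContDiffAt.comp (g := fun q : ℝ × ℝ => V q.1 q.2) (f := fun q : ℝ × ℝ => (q.1, q.2 - x₀)) q
      ((hV q.1 hq.1).1 (q.2 - x₀)) (by fun_prop)).contDiffWithinAt
  refine ⟨fun r x => V r (x - x₀), fun r x => uinf - r * (V r (x - x₀) - vinf), hveq, ?_, δ, hδ,
    fun r hr => ?_, hVc, ?_⟩
  · funext x
    rw [congrFun hveq x]
    linarith [h.wave.u_eq x]
  · obtain ⟨-, h0, -, h1, h2, hmem, htop, hbot⟩ := hV r hr
    refine isSolitaryWave_of_profile h.isOpen h.contDiffOn h.pos (v' := fun x => V' r (x - x₀))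
      (fun x => (h1 (x - x₀)).comp_sub_const x x₀) (fun x => (h2 (x - x₀)).comp_sub_const x x₀)
      (fun x => hmem _) (htop.comp (tendsto_atTop_add_const_right _ _ tendsto_id))
      (hbot.comp (tendsto_atBot_add_const_right _ _ tendsto_id)) ⟨x₀, ?_⟩
    simp [h0, (hS r (hball r hr).1).1.2.1]
  · exact contDiffOn_const.sub (contDiffOn_fst.mul (hVc.sub contDiffOn_const))

end IsSaddleWave
end
end Korteweg
theorem theorem1p1
    (p : ℝ → ℝ) (I : Set ℝ) (hI : IsOpen I) (hp : ContDiffOn ℝ 2 p I)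
    (κ : ℝ) (hκ : 0 < κ) (sbar vinf uinf : ℝ) (hvinf : vinf ∈ I)
    (hsaddle : sbar ^ 2 + deriv p vinf < 0)
    (vbar ubar : ℝ → ℝ)
    (hwave : Korteweg.IsSolitaryWave p I κ sbar vinf uinf vbar ubar)
    (a b : ℝ) (ha : a ≠ 0) (hb : b ≠ 0) (C c : ℝ)
    (hC : C = 2 * √(-deriv p vinf) * (deriv p vinf + sbar ^ 2))
    (hc : c = a * b * (-2 * C / κ ^ 2)) :
    -- the constant is nonzero, and positive when `a b > 0`
    c ≠ 0 ∧ (0 < a * b → 0 < c) ∧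
    -- the wave belongs to a one-parameter family of waves
    (∃ V U : ℝ → ℝ → ℝ, Korteweg.IsWaveFamily p I κ sbar vinf uinf vbar ubar V U) ∧
    -- an Evans function exists near the origin
    (∃ r > 0, Nonempty
      (Korteweg.EvansBasis p κ sbar vinf vbar ubar a b (Metric.ball (0 : ℂ) r))) ∧
    -- for every such family, the moment of instability is well defined and twice differentiable
    (∀ V U : ℝ → ℝ → ℝ, Korteweg.IsWaveFamily p I κ sbar vinf uinf vbar ubar V U →
      (∀ᶠ s in 𝓝 sbar,
        Integrable (Korteweg.energyDensity p κ vinf uinf (V s) (U s)) ∧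
        Integrable (Korteweg.momentumDensity vinf uinf (V s) (U s)) ∧
        DifferentiableAt ℝ (Korteweg.momentOfInstability p κ vinf uinf V U) s) ∧
      DifferentiableAt ℝ (deriv (Korteweg.momentOfInstability p κ vinf uinf V U)) sbar ∧
      -- and its second derivative is related to that of every Evans function
      ∀ (Ω : Set ℂ), IsOpen Ω → (0 : ℂ) ∈ Ω →
        ∀ E : Korteweg.EvansBasis p κ sbar vinf vbar ubar a b Ω,
          DifferentiableOn ℂ E.evans Ω ∧
          deriv (deriv E.evans) 0 =
            ((c * deriv (deriv (Korteweg.momentOfInstability p κ vinf uinf V U)) sbar : ℝ) : ℂ)) := by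
  have hw : Korteweg.IsSaddleWave p I κ sbar vinf uinf vbar ubar :=
    ⟨hI, hp, hκ, hvinf, hsaddle, hwave⟩
  have hsq : 0 < √(-deriv p vinf) := hw.sqrt_pos
  have hc' : c = 4 * a * b * √(-deriv p vinf) * (-deriv p vinf - sbar ^ 2) / κ ^ 2 := by
    rw [hc, hC]; ring
  have hpos : 0 < 4 * √(-deriv p vinf) * (-deriv p vinf - sbar ^ 2) / κ ^ 2 :=
    div_pos (mul_pos (by positivity) (by linarith)) (by positivity)
  have hc'' : c = a * b * (4 * √(-deriv p vinf) * (-deriv p vinf - sbar ^ 2) / κ ^ 2) := by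
    rw [hc']; ring
  refine ⟨?_, fun hab => ?_, hw.exists_waveFamily, ?_, fun V U hVU => ?_⟩
  · rw [hc'']
    exact mul_ne_zero (mul_ne_zero ha hb) hpos.ne'
  · rw [hc'']
    exact mul_pos hab hpos
  · obtain ⟨r, hr, W₁, W₂, W₃, W₄, hp, hm, e₁, e₄⟩ := hw.exists_halfLineBases ha hb
    exact ⟨r, hr, ⟨Korteweg.EvansBasis.ofHalfLineBases hp hm e₁ e₄⟩⟩
  · obtain ⟨J, hsJ, hfam⟩ := hVU.exists_isSaddleFamily hw
    obtain rfl := hVU.v_eq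
    obtain rfl := hVU.u_eq
    refine ⟨?_, (hfam.hasDerivAt_deriv_moment hsJ).differentiableAt, fun Ω hΩ h0 E =>
      ⟨E.differentiableOn_evans, ?_⟩⟩
    · filter_upwards [hfam.exists_integrable_density hsJ, hfam.isOpen.mem_nhds hsJ] with s hs hs'
      exact ⟨hs.1, hs.2, (hfam.hasDerivAt_moment hs').differentiableAt⟩
    · rw [hfam.deriv_deriv_evans hsJ ha hb hΩ h0 E, hc']
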